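/- Let $\mathbb F_2[a,b]=H^*(B(\mathbb Z/2)^2;\mathbb F_2)$ with $\deg a=\deg b=1$, and let $\mathrm{GL}_2(\mathbb F_2)$ act on it by linear substitutions. Let $C_3\subset \mathrm{GL}_2(\mathbb F_2)$ be the cyclic subgroup of order $3$ generated by $a\mapsto b,\ b\mapsto a+b$. Identify, as usual, $$H^*(BA_4;\mathbb F_2)=\mathbb F_2[a,b]^{C_3},\qquad D(2)=H^*(BSO(3);\mathbb F_2)=\mathbb F_2[a,b]^{\mathrm{GL}_2(\mathbb F_2)}\subset H^*(BA_4;\mathbb F_2),$$ with the total Steenrod square $\mathrm{Sq}$ given by restricting the ring homomorphism $\mathrm{Sq}(a)=a+a^2$, $\mathrm{Sq}(b)=b+b^2$; for homogeneous $f$ of degree $n$, $\mathrm{Sq}^i(f)$ is the component of $\mathrm{Sq}(f)$ of degree $n+i$. Put $u=a^2+ab+b^2$ and $v=a^2b+ab^2$, and define $x_1=u$, $x_{n+1}=u x_n^2+\mathrm{Sq}^1(x_n)^2$ for $n\ge 1$; these elements lie in $D(2)$. For either of the two rings $A$, a parameter ideal is an ideal $I$ generated by $d$ homogeneous elements of positive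 degree, where $d$ is the Krull dimension of $A$, such that $A/I$ is finite over $\mathbb F_2$; an ideal $I$ is Steenrod closed if $\mathrm{Sq}(I)\subset I$. Then the restriction of ideals $I\mapsto I\cap D(2)$ is a bijection from the set of Steenrod closed parameter ideals of $H^*(BA_4;\mathbb F_2)$ onto the set of Steenrod closed parameter ideals of $D(2)$. The set of Steenrod closed parameter ideals of $D(2)$ is the disjoint union of the three sets formed by the restrictions to $D(2)$ of the following ideals of $H^*(BA_4;\mathbb F_2)$: 1. the fibered ideals $\langle v^k,u^l\rangle$ with $l\ge 1$ and $1\le k\le 2^t$, where $2^t$ is the largest power of $2$ dividing $l$; 2. the twisted ideals $\langle x_n,\mathrm{Sq}^1(x_n)\rangle$ with $n\ge 2$; 3. the mixed ideals $\langle v^i x_n^{2^m},\,x_{n+1}^{2^{m-1}}\rangle$ with $m\ge 1$ and either $n=1$ and $1\le i<2^{m-1}$, or $n\ge 2$ and $0\le i<2^{m-1}$. -/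

import Mathlib

noncomputable section

namespace SteenrodParam

open MvPolynomial

/-- The mod-`2` cohomology ring `𝔽₂[a,b]` of `(ℤ/2)²`, with `a = X 0` and `b = X 1` in degree `1`. -/
abbrev P : Type := MvPolynomial (Fin 2) (ZMod 2)

/-- The group `GL₂(𝔽₂)`. -/
abbrev G : Type := GL (Fin 2) (ZMod 2)

/-- The action of `g` on `𝔽₂[a,b]` by linear substitution; the `j`-th variable is sent to the
linear form whose coefficients are the `j`-th column of `g`. -/
def act (g : G) : P →ₐ[ZMod 2] P :=
  aeval fun j => ∑ i, C ((g : Matrix (Fin 2) (Fin 2) (ZMod 2)) i j) * X i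

/-- The total Steenrod square on `𝔽₂[a,b]`: the ring homomorphism with
`a ↦ a + a²`, `b ↦ b + b²`. -/
def totalSq : P →ₐ[ZMod 2] P :=
  aeval fun j => X j + X j ^ 2

/-- The Steenrod square `Sqⁱ` on `𝔽₂[a,b]`: on a homogeneous `f` of degree `n`, it is the
component of degree `n + i` of the total square of `f`; it is extended additively. -/
def sq (i : ℕ) (f : P) : P :=
  ∑ n ∈ Finset.range (f.totalDegree + 1),
    homogeneousComponent (n + i) (totalSq (homogeneousComponent n f))

/-- The ring of invariants `𝔽₂[a,b]^H` of a subgroup `H` of `GL₂(𝔽₂)`. -/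
def Inv (H : Subgroup G) : Subalgebra (ZMod 2) P where
  carrier := {f | ∀ g ∈ H, act g f = f}
  mul_mem' hf hf' g hg := by rw [map_mul, hf g hg, hf' g hg]
  add_mem' hf hf' g hg := by rw [map_add, hf g hg, hf' g hg]
  algebraMap_mem' r g _ := AlgHom.commutes (act g) r

/-- The element of order three of `GL₂(𝔽₂)` that acts by `a ↦ b`, `b ↦ a + b`. -/
def c3 : G := ⟨!![0, 1; 1, 1], !![1, 1; 1, 0], by decide, by decide⟩

/-- `H^*(BA₄; 𝔽₂) = 𝔽₂[a,b]^{C₃}`. -/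
abbrev HA4 : Subalgebra (ZMod 2) P := Inv (Subgroup.zpowers c3)

/-- The Dickson algebra `D(2) = H^*(BSO(3); 𝔽₂) = 𝔽₂[a,b]^{GL₂(𝔽₂)}`. -/
abbrev D2 : Subalgebra (ZMod 2) P := Inv ⊤

theorem D2_le_HA4 : D2 ≤ HA4 := fun _ hf g _ => hf g trivial

/-! The Steenrod squares commute with the action, so they restrict to rings of invariants. -/

theorem act_totalSq (g : G) (f : P) : act g (totalSq f) = totalSq (act g f) := by
  have h : (act g).comp totalSq = totalSq.comp (act g) := by
    apply MvPolynomial.algHom_ext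
    intro j
    have hz : ∀ z : ZMod 2, z ^ 2 = z := by decide
    have h2 : (2 : P) = 0 := CharP.cast_eq_zero P 2
    simp only [AlgHom.comp_apply, totalSq, act, aeval_X, map_add, map_pow, map_mul,
      Fin.sum_univ_two, MvPolynomial.algHom_C, MvPolynomial.algebraMap_eq]
    generalize (g : Matrix (Fin 2) (Fin 2) (ZMod 2)) 0 j = p
    generalize (g : Matrix (Fin 2) (Fin 2) (ZMod 2)) 1 j = q
    have hp : (C p : P) ^ 2 = C p := by rw [← C_pow, hz]
    have hq : (C q : P) ^ 2 = C q := by rw [← C_pow, hz]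
    linear_combination (X 0) ^ 2 * hp + (X 1) ^ 2 * hq + C p * C q * X 0 * X 1 * h2
  exact DFunLike.congr_fun h f

theorem act_isHomogeneous (g : G) {f : P} {n : ℕ} (hf : f.IsHomogeneous n) :
    (act g f).IsHomogeneous n := by
  have := hf.aeval (S := ZMod 2)
    (fun j => ∑ i, C ((g : Matrix (Fin 2) (Fin 2) (ZMod 2)) i j) * X i : Fin 2 → P) (n := 1)
    (fun j => IsHomogeneous.sum _ _ _ fun i _ => by
      simpa using (isHomogeneous_C (Fin 2) _).mul (isHomogeneous_X (ZMod 2) i))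
  simpa [act] using this

theorem act_homogeneousComponent (g : G) (n : ℕ) (f : P) :
    act g (homogeneousComponent n f) = homogeneousComponent n (act g f) := by
  conv_rhs => rw [← sum_homogeneousComponent f, map_sum, map_sum]
  have h : ∀ i, homogeneousComponent n (act g (homogeneousComponent i f))
      = if i = n then act g (homogeneousComponent i f) else 0 := fun i => by
    have := homogeneousComponent_of_mem (m := n)
      (act_isHomogeneous g (homogeneousComponent_isHomogeneous i f))
    rw [this]
    simp only [eq_comm]
  simp only [h, Finset.sum_ite_eq', Finset.mem_range]
  split_ifs with hn
  · rfl
  · rw [homogeneousComponent_eq_zero _ _ (by omega), map_zero]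

/-- The total Steenrod square on a ring of invariants. -/
def invTotalSq {H : Subgroup G} (f : Inv H) : Inv H :=
  ⟨totalSq f, fun g hg => by rw [act_totalSq, f.2 g hg]⟩

/-- The Steenrod square `Sqⁱ` on a ring of invariants. -/
def invSq {H : Subgroup G} (i : ℕ) (f : Inv H) : Inv H :=
  ⟨sq i f, fun g hg => by
    simp only [sq, map_sum, act_homogeneousComponent, act_totalSq, f.2 g hg]⟩

theorem u_v_invariant (g : G) :
    act g (X 0 ^ 2 + X 0 * X 1 + X 1 ^ 2) = X 0 ^ 2 + X 0 * X 1 + X 1 ^ 2 ∧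
    act g (X 0 ^ 2 * X 1 + X 0 * X 1 ^ 2) = X 0 ^ 2 * X 1 + X 0 * X 1 ^ 2 := by
  have hd : ((g : Matrix (Fin 2) (Fin 2) (ZMod 2))).det ≠ 0 :=
    (Matrix.isUnits_det_units g).ne_zero
  rw [Matrix.det_fin_two] at hd
  simp only [act, map_add, map_mul, map_pow, aeval_X, Fin.sum_univ_two]
  generalize (g : Matrix (Fin 2) (Fin 2) (ZMod 2)) 0 0 = p at *
  generalize (g : Matrix (Fin 2) (Fin 2) (ZMod 2)) 0 1 = q at *
  generalize (g : Matrix (Fin 2) (Fin 2) (ZMod 2)) 1 0 = r at *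
  generalize (g : Matrix (Fin 2) (Fin 2) (ZMod 2)) 1 1 = s at *
  have h2 : (2 : P) = 0 := CharP.cast_eq_zero P 2
  have hz : ∀ z : ZMod 2, z = 0 ∨ z = 1 := by decide
  rcases hz p with rfl | rfl <;> rcases hz q with rfl | rfl <;>
    rcases hz r with rfl | rfl <;> rcases hz s with rfl | rfl <;>
    first
    | exact absurd (by decide) hd
    | (simp only [C_0, C_1]
       constructor <;> grind)

/-- `u = a² + ab + b²`, in degree `2`. -/
def u {H : Subgroup G} : Inv H :=
  ⟨X 0 ^ 2 + X 0 * X 1 + X 1 ^ 2, fun g _ => (u_v_invariant g).1⟩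

/-- `v = a²b + ab²`, in degree `3`. -/
def v {H : Subgroup G} : Inv H :=
  ⟨X 0 ^ 2 * X 1 + X 0 * X 1 ^ 2, fun g _ => (u_v_invariant g).2⟩

/-- The sequence `x₁ = u`, `xₙ₊₁ = u xₙ² + Sq¹(xₙ)²`; the value at `0` is not used. -/
def x {H : Subgroup G} : ℕ → Inv H
  | 0 => 1
  | 1 => u
  | n + 2 => u * x (n + 1) ^ 2 + invSq 1 (x (n + 1)) ^ 2

/-- A parameter ideal: it is generated by `d` homogeneous elements of positive degree, where `d`
is the Krull dimension of the ring, and the quotient by it is finite over `𝔽₂`. -/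
def IsParameterIdeal {H : Subgroup G} (I : Ideal (Inv H)) : Prop :=
  ∃ (d : ℕ) (t : Fin d → Inv H),
    ringKrullDim (Inv H) = d ∧
    (∀ i, ∃ n, 0 < n ∧ (t i : P).IsHomogeneous n) ∧
    I = Ideal.span (Set.range t) ∧
    Module.Finite (ZMod 2) (Inv H ⧸ I)

/-- An ideal is Steenrod closed if the total Steenrod square maps it into itself. -/
def IsSteenrodClosed {H : Subgroup G} (I : Ideal (Inv H)) : Prop :=
  ∀ f ∈ I, invTotalSq f ∈ I

/-- The set of Steenrod closed parameter ideals. -/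
def steenrodClosedParameterIdeals (H : Subgroup G) : Set (Ideal (Inv H)) :=
  {I | IsParameterIdeal I ∧ IsSteenrodClosed I}

/-- Restriction (contraction) of ideals along the inclusion of `D(2)` into `H^*(BA₄; 𝔽₂)`. -/
def restrict (I : Ideal HA4) : Ideal D2 :=
  I.comap (Subalgebra.inclusion D2_le_HA4)

/-- The ideals `⟨v^k, u^l⟩` of `H^*(BA₄; 𝔽₂)` with `l ≥ 1` and `1 ≤ k ≤ 2^t`, where `2^t` is the
largest power of `2` that divides `l`. -/
def fiberedIdeals : Set (Ideal HA4) :=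
  {I | ∃ k l : ℕ, 1 ≤ l ∧ 1 ≤ k ∧ k ≤ 2 ^ padicValNat 2 l ∧ I = Ideal.span {v ^ k, u ^ l}}

/-- The ideals `⟨xₙ, Sq¹(xₙ)⟩` of `H^*(BA₄; 𝔽₂)` with `n ≥ 2`. -/
def twistedIdeals : Set (Ideal HA4) :=
  {I | ∃ n : ℕ, 2 ≤ n ∧ I = Ideal.span {x n, invSq 1 (x n)}}

/-- The ideals `⟨v^i xₙ^(2^m), xₙ₊₁^(2^(m-1))⟩` of `H^*(BA₄; 𝔽₂)` with `m ≥ 1`, and either `n = 1`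
and `1 ≤ i < 2^(m-1)`, or `n ≥ 2` and `0 ≤ i < 2^(m-1)`. -/
def mixedIdeals : Set (Ideal HA4) :=
  {I | ∃ i m n : ℕ, 1 ≤ m ∧
    ((n = 1 ∧ 1 ≤ i ∧ i < 2 ^ (m - 1)) ∨ (2 ≤ n ∧ i < 2 ^ (m - 1))) ∧
    I = Ideal.span {v ^ i * x n ^ 2 ^ m, x (n + 1) ^ 2 ^ (m - 1)}}

end SteenrodParam

end

open SteenrodParam

/-!
The rings of invariants of `C₃` and of `GL₂(𝔽₂)` are treated together: `A = 𝔽₂[a,b]^H` for a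
subgroup `H` that contains `C₃`. The main tool is the restriction `res : A → 𝔽₂[t]` to the line
`a = 0`. Its kernel is generated by `v` (`v_dvd_iff`), and a homogeneous element of degree `n`
restricts to `0` or to `tⁿ`.

Let `J` be a closed parameter ideal. If both generators are nonzero on the line, one of them can be
subtracted from the other, after multiplication by an invariant, to get a generator divisible by
`v`. This fails only if the degrees are consecutive, and then `J` is not closed
(`not_closed_of_consecutive`): such an ideal determines a closed ideal `(σY, Y)` of `𝔽₂[a,b]`, where
`σ` generates `C₃`, a descent along Frobenius shows that `Y` is a `2^k`-th power of a linear form,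
and that is impossible. Hence `J = (vf, g)` with `res g = t^L`. The colon ideal `J : v = (f, g)` is
again closed and contains a smaller power of `v`, so by induction it is an ideal `(p, q)` of the
list, or the unit ideal. It remains to find the closed ideals among the `v(p, q) + (g)`, where `g`
may be taken to be `q`, `q + rp` or `p + rq` (`span_v_mul_cases`). Comparing `Sq g` with `g` modulo
`v(p, q)` on the line (`exists_of_closed`) turns this into congruences for powers of `1 + t` modulo
powers of `t`.

The total squares of the generators of the list follow from
`(1 + u + v) Sq(xₙ₊₁) = xₙ₊₁ + xₙ₊₂ + v xₙ₊₁² + v xₙ²` (`one_add_mul_invS_x`); the factor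
`1 + u + v` is invertible modulo every ideal that contains powers of `u` and `v`
(`mem_of_one_add_mul_mem`). With `e = 2^m`, the ideals obtained are the fibered ones and
`(vⁱ xₙ^(2e), xₙ₊₁^e)` with `1 ≤ i ≤ e`, where `x₀ = 1`. For `n = 0` the latter are fibered. For
`n ≥ 1` they are mixed if `i < e`; they are twisted if `i = e = 1`, because `v xₙ² = Sq¹(xₙ₊₁)`; and
they are the mixed ideals `(xₙ₊₁^e, xₙ₊₂^(e/2))` if `i = e > 1` (`span_genP_zero`).

Finally `H^*(BA₄)` is free over `D(2)` on `1` and an element `w` of degree `3`. Therefore an ideal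
of `H^*(BA₄)` with generators in `D(2)` restricts to the ideal of `D(2)` with the same generators
(`restrict_span`), and the two classifications match.
-/

noncomputable section

namespace SteenrodParam

open MvPolynomial

/-! ### Restriction to a line -/

instance inv_charP (H : Subgroup G) : CharP (Inv H) 2 :=
  charP_of_injective_algebraMap (algebraMap (ZMod 2) (Inv H)).injective 2

theorem two_eq_zero : (2 : P) = 0 := CharP.cast_eq_zero P 2

theorem inv_two_eq_zero {H : Subgroup G} : (2 : Inv H) = 0 := CharP.cast_eq_zero (Inv H) 2

theorem poly_two_eq_zero : (2 : Polynomial (ZMod 2)) = 0 := CharP.cast_eq_zero _ 2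

/-- The substitution `a ↦ b`, `b ↦ a + b`. -/
abbrev sigma : P →ₐ[ZMod 2] P := act c3

@[simp] theorem sigma_X0 : sigma (X 0) = X 1 := by
  simp [act, c3]

@[simp] theorem sigma_X1 : sigma (X 1) = X 0 + X 1 := by
  simp [act, c3]

theorem sigma_sigma_sigma (f : P) : sigma (sigma (sigma f)) = f := by
  have h : (sigma.comp sigma).comp sigma = AlgHom.id (ZMod 2) P := by
    apply MvPolynomial.algHom_ext
    intro j
    fin_cases j
    · simp only [Fin.zero_eta, AlgHom.comp_apply, sigma_X0, sigma_X1, map_add, AlgHom.id_apply]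
      linear_combination X 1 * two_eq_zero
    · simp only [Fin.mk_one, AlgHom.comp_apply, sigma_X0, sigma_X1, map_add, AlgHom.id_apply]
      linear_combination (X 0 + X 1) * two_eq_zero
  exact DFunLike.congr_fun h f

/-- Restriction to the line `a = 0`, as a polynomial in the coordinate `b`. -/
def resP : P →ₐ[ZMod 2] Polynomial (ZMod 2) :=
  aeval ![0, Polynomial.X]

@[simp] theorem resP_X0 : resP (X 0) = 0 := by simp [resP]

@[simp] theorem resP_X1 : resP (X 1) = Polynomial.X := by simp [resP]

theorem exists_eq_X0_mul_add (f : P) :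
    ∃ (f' : P) (g : Polynomial (ZMod 2)), f = X 0 * f' + Polynomial.aeval (X 1 : P) g := by
  induction f using MvPolynomial.induction_on with
  | C c => exact ⟨0, Polynomial.C c, by simp [MvPolynomial.algebraMap_eq]⟩
  | add p q hp hq =>
    obtain ⟨p', g, rfl⟩ := hp
    obtain ⟨q', k, rfl⟩ := hq
    exact ⟨p' + q', g + k, by rw [map_add]; ring⟩
  | mul_X p i hp =>
    obtain ⟨p', g, rfl⟩ := hp
    fin_cases i
    · exact ⟨X 0 * p' + Polynomial.aeval (X 1 : P) g, 0, by simp; ring⟩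
    · exact ⟨X 1 * p', g * Polynomial.X, by simp; ring⟩

theorem resP_aeval_X1 (g : Polynomial (ZMod 2)) : resP (Polynomial.aeval (X 1 : P) g) = g := by
  rw [← Polynomial.aeval_algHom_apply, resP_X1, Polynomial.aeval_X_left_apply]

theorem X0_dvd_of_resP_eq_zero {f : P} (h : resP f = 0) : X 0 ∣ f := by
  obtain ⟨f', g, rfl⟩ := exists_eq_X0_mul_add f
  rw [map_add, map_mul, resP_X0, zero_mul, zero_add, resP_aeval_X1] at h
  simp [h]

theorem X1_dvd_of_resP_eq_zero {f : P} (h : resP (sigma (sigma f)) = 0) : X 1 ∣ f := by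
  have := map_dvd sigma (X0_dvd_of_resP_eq_zero h)
  rwa [sigma_sigma_sigma, sigma_X0] at this

theorem X0_add_X1_dvd_of_resP_eq_zero {f : P} (h : resP (sigma f) = 0) : X 0 + X 1 ∣ f := by
  have := map_dvd sigma (map_dvd sigma (X0_dvd_of_resP_eq_zero h))
  rwa [sigma_sigma_sigma, sigma_X0, sigma_X1] at this

theorem X1_mul_dvd {f : P} (h1 : resP (sigma f) = 0) (h2 : resP (sigma (sigma f)) = 0) :
    X 1 * (X 0 + X 1) ∣ f := by
  obtain ⟨k, rfl⟩ := X1_dvd_of_resP_eq_zero h2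
  refine mul_dvd_mul_left _ (X0_add_X1_dvd_of_resP_eq_zero ?_)
  simpa using h1

theorem X0_mul_dvd {f : P} (h0 : resP f = 0) (h1 : resP (sigma f) = 0) :
    X 0 * (X 0 + X 1) ∣ f := by
  obtain ⟨k, rfl⟩ := X0_dvd_of_resP_eq_zero h0
  refine mul_dvd_mul_left _ (X0_add_X1_dvd_of_resP_eq_zero ?_)
  simpa using h1

/-- The element `a²b + ab²`, the product of the three nonzero linear forms. -/
abbrev vP : P := X 0 ^ 2 * X 1 + X 0 * X 1 ^ 2

/-- The element `a² + ab + b²`. -/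
abbrev uP : P := X 0 ^ 2 + X 0 * X 1 + X 1 ^ 2

/-- A polynomial that vanishes on the three lines through the origin is a multiple of `v`. -/
theorem vP_dvd {f : P} (h0 : resP f = 0) (h1 : resP (sigma f) = 0)
    (h2 : resP (sigma (sigma f)) = 0) : vP ∣ f := by
  obtain ⟨k, rfl⟩ := X0_dvd_of_resP_eq_zero h0
  have h : X 1 * (X 0 + X 1) ∣ k := by
    apply X1_mul_dvd
    · simpa using h1
    · have : resP (X 0 + X 1) * resP (sigma (sigma k)) = 0 := by
        simpa only [map_mul, sigma_X0, sigma_X1] using h2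
      simpa using this
  have : vP = X 0 * (X 1 * (X 0 + X 1)) := by ring
  rw [this]
  exact mul_dvd_mul_left _ h

/-- Induction on homogeneous polynomials over `𝔽₂`, whose monomials have coefficient `1`. -/
theorem homogeneous_induction {motive : ℕ → P → Prop} (one : motive 0 1)
    (zero : ∀ n, motive n 0) (add : ∀ n f g, motive n f → motive n g → motive n (f + g))
    (mul_X : ∀ n f j, motive n f → motive (n + 1) (f * X j)) {f : P} {n : ℕ}
    (hf : f.IsHomogeneous n) : motive n f := by
  have hz : ∀ z : ZMod 2, z = 0 ∨ z = 1 := by decide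
  have hpow : ∀ i j : ℕ, motive (i + j) (X 0 ^ i * X 1 ^ j) := by
    intro i j
    induction j with
    | zero =>
      induction i with
      | zero => simpa using one
      | succ i ih => simpa [pow_succ] using mul_X _ _ 0 ih
    | succ j ih => simpa [pow_succ, mul_assoc, ← add_assoc] using mul_X _ _ 1 ih
  have hmon : ∀ d : Fin 2 →₀ ℕ, motive d.degree (monomial d 1) := by
    intro d
    rw [monomial_eq, Finsupp.prod_fintype _ _ (by simp), Fin.prod_univ_two, C_1, one_mul,
      Finsupp.degree_eq_sum, Fin.sum_univ_two]
    exact hpow _ _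
  rw [f.as_sum]
  refine Finset.sum_induction _ (motive n) (add n) (zero n) fun d hd => ?_
  rcases hz (coeff d f) with h | h
  · rw [h, monomial_zero]
    exact zero n
  · have := hf (mem_support_iff.mp hd)
    rw [h, ← this]
    convert hmon d using 1
    exact (DFunLike.congr_fun Finsupp.degree_eq_weight_one d).symm

/-- There is only one nonzero polynomial of degree `n` on the line. -/
theorem resP_isHomogeneous {f : P} {n : ℕ} (hf : f.IsHomogeneous n) :
    resP f = 0 ∨ resP f = Polynomial.X ^ n := by
  refine homogeneous_induction (motive := fun n f => resP f = 0 ∨ resP f = Polynomial.X ^ n)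
    ?_ ?_ ?_ ?_ hf
  · simp
  · simp
  · rintro n f g (hf | hf) (hg | hg) <;> simp only [map_add, hf, hg] <;> simp
    linear_combination Polynomial.X ^ n * poly_two_eq_zero
  · rintro n f j (hf | hf) <;> fin_cases j <;> simp [hf, pow_succ]

theorem resP_totalSq (f : P) :
    resP (totalSq f)
      = Polynomial.aeval (Polynomial.X + Polynomial.X ^ 2 : Polynomial (ZMod 2)) (resP f) := by
  have h : resP.comp totalSq
      = (Polynomial.aeval (Polynomial.X + Polynomial.X ^ 2 : Polynomial (ZMod 2))).comp resP := by
    apply MvPolynomial.algHom_ext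
    intro j
    fin_cases j <;> simp [totalSq]
  exact DFunLike.congr_fun h f

/-! ### Homogeneous components and the first Steenrod square -/

section

attribute [local instance] MvPolynomial.gradedAlgebra

theorem homogeneousComponent_mul_add {f : P} {n : ℕ} (hf : f.IsHomogeneous n) (k : ℕ) (g : P) :
    homogeneousComponent (k + n) (g * f) = homogeneousComponent k g * f := by
  have h := DirectSum.coe_decompose_mul_add_of_right_mem (homogeneousSubmodule (Fin 2) (ZMod 2))
    (i := k) (a := g) (b := f) hf
  rwa [← decomposition.decompose'_apply, ← decomposition.decompose'_apply]

theorem homogeneousComponent_mul_of_lt {f : P} {n : ℕ} (hf : f.IsHomogeneous n) {k : ℕ}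
    (hk : k < n) (g : P) : homogeneousComponent k (g * f) = 0 := by
  have h := DirectSum.coe_decompose_mul_of_right_mem_of_not_le
    (homogeneousSubmodule (Fin 2) (ZMod 2)) (a := g) (b := f) hf (not_le.mpr hk)
  rwa [← decomposition.decompose'_apply]

end

/-- The derivation of `𝔽₂[a,b]` with `a ↦ a²`, `b ↦ b²`; it is the first Steenrod square. -/
def dSq : Derivation (ZMod 2) P P := mkDerivation (ZMod 2) fun j => X j ^ 2

@[simp] theorem dSq_X (j : Fin 2) : dSq (X j) = X j ^ 2 := mkDerivation_X _ _ _

theorem dSq_sq (f : P) : dSq (f ^ 2) = 0 := by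
  rw [Derivation.leibniz_pow]
  linear_combination (exp := 1) (f * dSq f) * two_eq_zero

/-- The components of the total square of `f` in the degrees up to `n + 1`: they are those of
`Sq⁰(f) = f` and `Sq¹(f)`. -/
theorem totalSq_components {f : P} {n : ℕ} (hf : f.IsHomogeneous n) :
    (∀ k < n, homogeneousComponent k (totalSq f) = 0) ∧
    homogeneousComponent n (totalSq f) = f ∧
    homogeneousComponent (n + 1) (totalSq f) = dSq f := by
  refine homogeneous_induction (motive := fun n f =>
    (∀ k < n, homogeneousComponent k (totalSq f) = 0) ∧
    homogeneousComponent n (totalSq f) = f ∧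
    homogeneousComponent (n + 1) (totalSq f) = dSq f) ?_ ?_ ?_ ?_ hf
  · refine ⟨by simp, ?_, ?_⟩
    · rw [map_one, homogeneousComponent_eq_self (isHomogeneous_one _ _)]
    · rw [map_one, homogeneousComponent_of_mem (isHomogeneous_one _ _)]
      simp
  · simp
  · rintro n f g ⟨hf0, hf1, hf2⟩ ⟨hg0, hg1, hg2⟩
    refine ⟨fun k hk => ?_, ?_, ?_⟩
    · rw [map_add, map_add, hf0 k hk, hg0 k hk, add_zero]
    · rw [map_add, map_add, hf1, hg1]
    · rw [map_add, map_add, hf2, hg2, map_add]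
  · rintro n f j ⟨h0, h1, h2⟩
    have hX : (X j : P).IsHomogeneous 1 := isHomogeneous_X _ _
    have hX2 : (X j ^ 2 : P).IsHomogeneous 2 := isHomogeneous_X_pow _ _
    have hS : totalSq (f * X j) = totalSq f * X j + totalSq f * X j ^ 2 := by
      rw [map_mul, ← mul_add]; simp [totalSq]
    refine ⟨fun k hk => ?_, ?_, ?_⟩
    · rw [hS, map_add]
      rcases k with _ | _ | k
      · rw [homogeneousComponent_mul_of_lt hX (by omega),
          homogeneousComponent_mul_of_lt hX2 (by omega), add_zero]
      · rw [homogeneousComponent_mul_add hX 0, h0 0 (by omega),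
          homogeneousComponent_mul_of_lt hX2 (by omega), zero_mul, add_zero]
      · rw [homogeneousComponent_mul_add hX (k + 1), h0 (k + 1) (by omega),
          homogeneousComponent_mul_add hX2 k, h0 k (by omega), zero_mul, zero_mul, add_zero]
    · rw [hS, map_add, homogeneousComponent_mul_add hX n, h1]
      rcases n with _ | n
      · rw [homogeneousComponent_mul_of_lt hX2 (by omega), add_zero]
      · rw [show n + 1 + 1 = n + 2 from rfl, homogeneousComponent_mul_add hX2 n, h0 n (by omega),
          zero_mul, add_zero]
    · rw [hS, map_add, homogeneousComponent_mul_add hX (n + 1), h2,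
        show n + 1 + 1 = n + 2 from rfl, homogeneousComponent_mul_add hX2 n, h1,
        Derivation.leibniz, dSq_X, smul_eq_mul, smul_eq_mul]
      ring

theorem sq_one_eq_dSq {f : P} {n : ℕ} (hf : f.IsHomogeneous n) : sq 1 f = dSq f := by
  rcases eq_or_ne f 0 with rfl | h0
  · simp [sq]
  rw [sq, hf.totalDegree h0, Finset.sum_eq_single n]
  · rw [homogeneousComponent_eq_self hf, (totalSq_components hf).2.2]
  · intro k _ hk
    rw [homogeneousComponent_of_mem hf, if_neg hk, map_zero, map_zero]
  · simp

/-! ### Regular pairs -/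

/-- If `(p, q)` contains powers of `u` and `v`, and `u` is a non-zero-divisor modulo `v`, then `p`
is a non-zero-divisor modulo `q`. -/
theorem dvd_of_pow_mem_span {R : Type*} [CommRing R] [IsDomain R] {u v p q : R} (hu : u ≠ 0)
    (hv00 : v ≠ 0)
    (hv : ∀ x, v ∣ u * x → v ∣ x) {N M : ℕ} (hN : u ^ N ∈ Ideal.span {p, q})
    (hM : v ^ M ∈ Ideal.span {p, q}) {α β : R} (h : α * p = β * q) : q ∣ α := by
  have hv0 : ∀ N x, v ∣ u ^ N * x → v ∣ x := by
    intro N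
    induction N with
    | zero => intro x hx; simpa using hx
    | succ N ih => intro x hx; exact ih x (hv _ (by rwa [pow_succ', mul_assoc] at hx))
  obtain ⟨c, d, hcd⟩ := Ideal.mem_span_pair.mp hN
  obtain ⟨c', d', hcd'⟩ := Ideal.mem_span_pair.mp hM
  have h1 : u ^ N * α = q * (c * β + d * α) := by rw [← hcd]; linear_combination c * h
  have h2 : v ^ M * α = q * (c' * β + d' * α) := by rw [← hcd']; linear_combination c' * h
  rcases eq_or_ne q 0 with rfl | hq
  · rw [zero_mul] at h1
    simp [(mul_eq_zero.mp h1).resolve_left (pow_ne_zero _ hu)]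
  have h3 : v ^ M * (c * β + d * α) = u ^ N * (c' * β + d' * α) := by
    apply mul_left_cancel₀ hq
    linear_combination u ^ N * h2 - v ^ M * h1
  -- Powers of `v` may be cancelled against powers of `u`.
  have key : ∀ M y z, v ^ M * y = u ^ N * z → ∃ w, z = v ^ M * w := by
    intro M
    induction M with
    | zero => intro y z _; exact ⟨z, by simp⟩
    | succ M ih =>
      intro y z hyz
      obtain ⟨w, rfl⟩ := hv0 N z ⟨v ^ M * y, by rw [← hyz]; ring⟩
      obtain ⟨w', rfl⟩ := ih y w (mul_left_cancel₀ hv00 (by linear_combination hyz))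
      exact ⟨w', by ring⟩
  obtain ⟨w, hw⟩ := key M _ _ h3
  refine ⟨w, mul_left_cancel₀ (pow_ne_zero M hv00) ?_⟩
  rw [h2, hw]
  ring

/-! ### Frobenius on `𝔽₂[a,b]` -/

/-- The monomials `1, a, b, ab` span `𝔽₂[a,b]` over the subring of squares. -/
theorem exists_eq_sum_sq (f : P) : ∃ c₀ c₁ c₂ c₃ : P,
    f = c₀ ^ 2 + X 0 * c₁ ^ 2 + X 1 * c₂ ^ 2 + X 0 * X 1 * c₃ ^ 2 := by
  induction f using MvPolynomial.induction_on with
  | C c =>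
    have hz : ∀ z : ZMod 2, z ^ 2 = z := by decide
    exact ⟨C c, 0, 0, 0, by rw [← C_pow, hz]; ring⟩
  | add p q hp hq =>
    obtain ⟨c₀, c₁, c₂, c₃, rfl⟩ := hp
    obtain ⟨d₀, d₁, d₂, d₃, rfl⟩ := hq
    refine ⟨c₀ + d₀, c₁ + d₁, c₂ + d₂, c₃ + d₃, ?_⟩
    simp only [CharTwo.add_sq]
    ring
  | mul_X p i hp =>
    obtain ⟨c₀, c₁, c₂, c₃, rfl⟩ := hp
    fin_cases i
    · exact ⟨X 0 * c₁, c₀, X 0 * c₃, c₂, by simp only [Fin.zero_eta]; ring⟩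
    · exact ⟨X 1 * c₂, X 1 * c₃, c₀, c₁, by simp only [Fin.mk_one]; ring⟩

theorem pderiv_sq (i : Fin 2) (f : P) : pderiv i (f ^ 2) = 0 := by
  rw [Derivation.leibniz_pow]
  linear_combination (exp := 1) (f * pderiv i f) * two_eq_zero

/-- The monomials `1, a, b, ab` are linearly independent over the subring of squares. -/
theorem sum_sq_eq_zero {c₀ c₁ c₂ c₃ : P}
    (h : c₀ ^ 2 + X 0 * c₁ ^ 2 + X 1 * c₂ ^ 2 + X 0 * X 1 * c₃ ^ 2 = 0) :
    c₀ = 0 ∧ c₁ = 0 ∧ c₂ = 0 ∧ c₃ = 0 := by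
  have h0 := congrArg (pderiv (R := ZMod 2) (0 : Fin 2)) h
  have h1 := congrArg (pderiv (R := ZMod 2) (1 : Fin 2)) h
  simp only [map_add, map_zero, Derivation.leibniz, pderiv_sq, smul_eq_mul, pderiv_X_self,
    pderiv_X_of_ne (show (1 : Fin 2) ≠ 0 by decide),
    pderiv_X_of_ne (show (0 : Fin 2) ≠ 1 by decide),
    mul_zero, mul_one, zero_add, add_zero] at h0 h1
  have h01 := congrArg (pderiv (R := ZMod 2) (1 : Fin 2)) h0
  simp only [map_add, map_zero, Derivation.leibniz, pderiv_sq, smul_eq_mul, pderiv_X_self,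
    mul_zero, mul_one, zero_add] at h01
  have e3 : c₃ = 0 := by simpa using h01
  subst e3
  have e1 : c₁ = 0 := by simpa using h0
  have e2 : c₂ = 0 := by simpa using h1
  subst e1 e2
  exact ⟨by simpa using h, rfl, rfl, rfl⟩

/-- Frobenius is flat on `𝔽₂[a,b]`. -/
theorem mem_span_of_sq_mem {F G h : P} (hh : h ^ 2 ∈ Ideal.span {F ^ 2, G ^ 2}) :
    h ∈ Ideal.span {F, G} := by
  obtain ⟨α, β, e⟩ := Ideal.mem_span_pair.mp hh
  obtain ⟨α₀, α₁, α₂, α₃, rfl⟩ := exists_eq_sum_sq α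
  obtain ⟨β₀, β₁, β₂, β₃, rfl⟩ := exists_eq_sum_sq β
  have := (sum_sq_eq_zero (c₀ := α₀ * F + β₀ * G + h) (c₁ := α₁ * F + β₁ * G)
    (c₂ := α₂ * F + β₂ * G) (c₃ := α₃ * F + β₃ * G) (by
      simp only [CharTwo.add_sq]
      linear_combination e + h ^ 2 * two_eq_zero)).1
  exact Ideal.mem_span_pair.mpr ⟨α₀, β₀, CharTwo.add_eq_zero.mp this⟩

theorem homogeneousComponent_sq (g : P) (n : ℕ) :
    homogeneousComponent n (g ^ 2)
      = if Even n then homogeneousComponent (n / 2) g ^ 2 else 0 := by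
  conv_lhs => rw [← sum_homogeneousComponent g, CharTwo.sum_sq, map_sum]
  have h : ∀ i, homogeneousComponent n (homogeneousComponent i g ^ 2)
      = if n = i * 2 then homogeneousComponent i g ^ 2 else 0 := fun i =>
    homogeneousComponent_of_mem ((homogeneousComponent_isHomogeneous i g).pow 2)
  simp only [h]
  split_ifs with hn
  · obtain ⟨m, rfl⟩ := hn
    rw [show (m + m) / 2 = m by omega]
    by_cases hm : m ∈ Finset.range (g.totalDegree + 1)
    · rw [Finset.sum_eq_single_of_mem m hm, if_pos (by omega)]
      intro i _ hi
      rw [if_neg (by omega)]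
    · rw [homogeneousComponent_eq_zero m g (by simpa using hm)]
      refine (Finset.sum_eq_zero fun i hi => if_neg ?_).trans (by simp)
      rintro h
      exact hm (by rwa [show m = i by omega])
  · refine Finset.sum_eq_zero fun i _ => if_neg ?_
    rintro rfl
    exact hn ⟨i, by ring⟩

theorem vP_ne_zero : vP ≠ 0 := by
  have h : vP = X 0 * (X 1 * (X 0 + X 1)) := by ring
  rw [h]
  refine mul_ne_zero (X_ne_zero _) (mul_ne_zero (X_ne_zero _) fun h => ?_)
  have := congrArg resP h
  simp at this

theorem vP_isHomogeneous : (vP : P).IsHomogeneous 3 := by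
  refine IsHomogeneous.add ?_ ?_
  · simpa using (isHomogeneous_X_pow (R := ZMod 2) (0 : Fin 2) 2).mul (isHomogeneous_X _ 1)
  · simpa using (isHomogeneous_X (ZMod 2) (0 : Fin 2)).mul (isHomogeneous_X_pow 1 2)

/-- The kernel of `Sq¹` is spanned by `1` and `v` over the subring of squares. -/
theorem exists_of_dSq_eq_zero {f : P} (h : dSq f = 0) : ∃ c k : P, f = c ^ 2 + k ^ 2 * vP := by
  obtain ⟨c₀, c₁, c₂, c₃, rfl⟩ := exists_eq_sum_sq f
  simp only [map_add, Derivation.leibniz, dSq_sq, dSq_X, smul_eq_mul] at h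
  obtain ⟨h0, h1, -, -⟩ := sum_sq_eq_zero (c₀ := X 0 * c₁ + X 1 * c₂) (c₁ := X 1 * c₃)
    (c₂ := X 0 * c₃) (c₃ := 0) (by
      simp only [CharTwo.add_sq]
      linear_combination h)
  have h3 : c₃ = 0 := by simpa using h1
  subst h3
  have : X 1 ∣ c₁ := by
    have := congrArg (fun f => resP (sigma (sigma f))) h0
    apply X1_dvd_of_resP_eq_zero
    simpa [CharTwo.add_self_eq_zero] using this
  obtain ⟨k, rfl⟩ := this
  have : c₂ = X 0 * k := by
    apply mul_left_cancel₀ (X_ne_zero (R := ZMod 2) (1 : Fin 2))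
    linear_combination h0 - X 0 * X 1 * k * two_eq_zero
  subst this
  exact ⟨c₀, k, by ring⟩

theorem eq_sq_of_dSq_eq_zero {f : P} {n : ℕ} (hf : f.IsHomogeneous (n + n)) (h : dSq f = 0) :
    ∃ g : P, g.IsHomogeneous n ∧ f = g ^ 2 := by
  obtain ⟨c, k, rfl⟩ := exists_of_dSq_eq_zero h
  refine ⟨_, homogeneousComponent_isHomogeneous n c, ?_⟩
  rw [← homogeneousComponent_eq_self hf, map_add, homogeneousComponent_sq, if_pos ⟨n, rfl⟩,
    show (n + n) / 2 = n by omega]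
  by_cases hn : n + n < 3
  · rw [homogeneousComponent_mul_of_lt vP_isHomogeneous hn, add_zero]
  · obtain ⟨m, hm⟩ : ∃ m, n + n = m + 3 := ⟨n + n - 3, by omega⟩
    rw [hm, homogeneousComponent_mul_add vP_isHomogeneous, homogeneousComponent_sq,
      if_neg (by rw [Nat.not_even_iff]; omega), zero_mul, add_zero]

theorem vP_dvd_of_dSq_eq_zero {f : P} {n : ℕ} (hf : f.IsHomogeneous (n + n + 1))
    (h : dSq f = 0) : vP ∣ f := by
  obtain ⟨c, k, rfl⟩ := exists_of_dSq_eq_zero h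
  rw [← homogeneousComponent_eq_self hf, map_add, homogeneousComponent_sq,
    if_neg (by rw [Nat.not_even_iff]; omega), zero_add]
  by_cases hn : n + n + 1 < 3
  · rw [homogeneousComponent_mul_of_lt vP_isHomogeneous hn]
    exact dvd_zero _
  · obtain ⟨m, hm⟩ : ∃ m, n + n + 1 = m + 3 := ⟨n + n + 1 - 3, by omega⟩
    rw [hm, homogeneousComponent_mul_add vP_isHomogeneous]
    exact dvd_mul_left _ _

theorem dSq_dSq (f : P) : dSq (dSq f) = 0 := by
  induction f using MvPolynomial.induction_on with
  | C c => simp [← MvPolynomial.algebraMap_eq]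
  | add p q hp hq => rw [map_add, map_add, hp, hq, add_zero]
  | mul_X p i hp =>
    simp only [map_add, Derivation.leibniz, dSq_sq, dSq_X, smul_eq_mul, hp]
    linear_combination X i ^ 2 * dSq p * two_eq_zero

theorem sigma_dSq (f : P) : sigma (dSq f) = dSq (sigma f) := by
  induction f using MvPolynomial.induction_on with
  | C c => simp [← MvPolynomial.algebraMap_eq]
  | add p q hp hq => simp only [map_add, hp, hq]
  | mul_X p i hp =>
    have : sigma (X i ^ 2) = dSq (sigma (X i)) := by
      fin_cases i <;> simp [CharTwo.add_sq]
    simp only [map_add, Derivation.leibniz, dSq_X, smul_eq_mul, map_mul, hp, this]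

theorem isHomogeneous_one_cases {f : P} (hf : f.IsHomogeneous 1) :
    f = 0 ∨ f = X 0 ∨ f = X 1 ∨ f = X 0 + X 1 := by
  have := homogeneous_induction (motive := fun n f => (n = 0 → f = 0 ∨ f = 1) ∧
    (n = 1 → f = 0 ∨ f = X 0 ∨ f = X 1 ∨ f = X 0 + X 1)) ?_ ?_ ?_ ?_ hf
  · exact this.2 rfl
  · simp
  · simp
  · rintro n f g ⟨hf0, hf1⟩ ⟨hg0, hg1⟩
    refine ⟨fun hn => ?_, fun hn => ?_⟩
    · rcases hf0 hn with rfl | rfl <;> rcases hg0 hn with rfl | rfl <;>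
        simp [CharTwo.add_self_eq_zero]
    · have h2 := two_eq_zero
      rcases hf1 hn with rfl | rfl | rfl | rfl <;>
        rcases hg1 hn with rfl | rfl | rfl | rfl <;> grind
  · rintro n f j ⟨hf0, hf1⟩
    refine ⟨fun hn => absurd hn (by omega), fun hn => ?_⟩
    rcases hf0 (by omega) with rfl | rfl <;> fin_cases j <;> simp

/-- The sum over the orbit of a linear form under the rotation vanishes. -/
theorem add_sigma_add_sigma_sigma {f : P} (hf : f.IsHomogeneous 1) :
    f + sigma f + sigma (sigma f) = 0 := by
  have h2 := two_eq_zero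
  rcases isHomogeneous_one_cases hf with rfl | rfl | rfl | rfl <;> simp <;> grind

theorem dSq_of_isHomogeneous_one {f : P} (hf : f.IsHomogeneous 1) : dSq f = f ^ 2 := by
  rcases isHomogeneous_one_cases hf with rfl | rfl | rfl | rfl <;> simp [CharTwo.add_sq]

theorem eq_zero_of_dvd_isHomogeneous_one {G f : P} {e : ℕ} (he : 1 < e) (hG : G.IsHomogeneous e)
    (hf : f.IsHomogeneous 1) (h : G ∣ f) : f = 0 := by
  obtain ⟨c, rfl⟩ := h
  by_contra h0
  have h1 := hf.totalDegree h0
  rw [totalDegree_mul_of_isDomain (left_ne_zero_of_mul h0) (right_ne_zero_of_mul h0),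
    hG.totalDegree (left_ne_zero_of_mul h0)] at h1
  omega

theorem isHomogeneous_of_mul_vP {f : P} {n : ℕ} (h : (f * vP).IsHomogeneous (n + 3)) :
    f.IsHomogeneous n := by
  have h1 := homogeneousComponent_mul_add vP_isHomogeneous n f
  rw [homogeneousComponent_eq_self h] at h1
  rw [mul_right_cancel₀ vP_ne_zero h1]
  exact homogeneousComponent_isHomogeneous n f

theorem uP_ne_zero : uP ≠ 0 := by
  intro h
  have := congrArg resP h
  simp at this

theorem sigma_uP : sigma uP = uP := (u_v_invariant c3).1

theorem sigma_vP : sigma vP = vP := (u_v_invariant c3).2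

theorem resP_uP : resP uP = Polynomial.X ^ 2 := by simp

theorem resP_vP : resP vP = 0 := by simp

theorem vP_dvd_of_dvd_uP_mul (x : P) (h : vP ∣ uP * x) : vP ∣ x := by
  have h0 := map_dvd resP h
  have h1 := map_dvd resP (map_dvd sigma h)
  have h2 := map_dvd resP (map_dvd sigma (map_dvd sigma h))
  simp only [map_mul sigma, sigma_uP, sigma_vP, resP_vP, zero_dvd_iff] at h0 h1 h2
  rw [map_mul, resP_uP] at h0 h1 h2
  exact vP_dvd (by simpa using h0) (by simpa using h1) (by simpa using h2)

theorem dvd_of_pow_mem_span_P {p q : P} {N M : ℕ} (hN : uP ^ N ∈ Ideal.span {p, q})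
    (hM : vP ^ M ∈ Ideal.span {p, q}) {α β : P} (h : α * p = β * q) : q ∣ α :=
  dvd_of_pow_mem_span uP_ne_zero vP_ne_zero vP_dvd_of_dvd_uP_mul hN hM h

/-! ### Closed ideals of `𝔽₂[a,b]` with two generators in the same degree -/

/-- Elimination between the three rotates of a relation `m σG + l G = dSq G`. -/
theorem rotation_identity {R : Type*} [CommRing R] (h2 : (2 : R) = 0)
    {g g' g'' m m' m'' l l' l'' d d' d'' : R}
    (h : m * g' + l * g = d) (h' : m' * g'' + l' * g' = d') (h'' : m'' * g + l'' * g'' = d'')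
    (hd : d + d' + d'' = 0) (hg : g + g' + g'' = 0) (hm : m + m' + m'' = 0)
    (hl : l + l' + l'' = 0) : (m'' + l) * g' = (l + m' + m'' + l'') * g := by
  grind

/-- The relation obtained by applying `dSq` to `σl · σG + l G = dSq G`. -/
theorem square_zero_identity {R : Type*} [CommRing R] (h2 : (2 : R) = 0)
    {g g' g'' l l' l'' d d' : R} (h : l' * g' + l * g = d) (h' : l'' * g'' + l' * g' = d')
    (hd : l' * d' + g' * l' ^ 2 + (l * d + g * l ^ 2) = 0) (hg : g + g' + g'' = 0)
    (hl : l + l' + l'' = 0) : l' * (l' * g' + l'' * g) = 0 := by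
  grind

/-- In degree `e > 1` the coefficients of the relation `Sq¹(G) = l' σG + l G` are linear forms. The
rotates of this relation and `Sq¹ Sq¹ = 0` force them to vanish. -/
theorem dSq_eq_zero_of_closed {G : P} {e : ℕ} (he : 1 < e) (hG : G.IsHomogeneous e)
    (hrel : G + sigma G + sigma (sigma G) = 0) (hcl : totalSq G ∈ Ideal.span {sigma G, G})
    {N M : ℕ} (hN : uP ^ N ∈ Ideal.span {sigma G, G}) (hM : vP ^ M ∈ Ideal.span {sigma G, G}) :
    dSq G = 0 := by
  -- A syzygy whose first coefficient is a linear form is trivial, for reasons of degree.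
  have hzero : ∀ {α β : P}, α.IsHomogeneous 1 → α * sigma G = β * G → α = 0 := fun hα h =>
    eq_zero_of_dvd_isHomogeneous_one he hG hα (dvd_of_pow_mem_span_P hN hM h)
  obtain ⟨α, β, h⟩ := Ideal.mem_span_pair.mp hcl
  have h' := congrArg (homogeneousComponent (e + 1)) h
  rw [(totalSq_components hG).2.2, map_add, add_comm e 1, homogeneousComponent_mul_add hG,
    homogeneousComponent_mul_add (act_isHomogeneous c3 hG)] at h'
  have hl' := homogeneousComponent_isHomogeneous 1 α
  have hl := homogeneousComponent_isHomogeneous 1 β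
  generalize homogeneousComponent 1 α = l' at h' hl'
  generalize homogeneousComponent 1 β = l at h' hl
  have hs : ∀ {f : P}, f.IsHomogeneous 1 → (sigma f).IsHomogeneous 1 := fun h =>
    act_isHomogeneous c3 h
  have s1 := congrArg sigma h'
  have s2 := congrArg sigma s1
  have hrel' : dSq G + sigma (dSq G) + sigma (sigma (dSq G)) = 0 := by
    rw [sigma_dSq, sigma_dSq, ← map_add, ← map_add, hrel, map_zero]
  simp only [map_add, map_mul, sigma_sigma_sigma] at s1 s2
  have h2 := two_eq_zero
  have r1 := add_sigma_add_sigma_sigma hl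
  have r2 := add_sigma_add_sigma_sigma hl'
  have hl'' : sigma (sigma l') + l = 0 :=
    hzero ((hs (hs hl')).add hl) (rotation_identity h2 h' s1 s2 hrel' hrel r2 r1)
  have hl1 : l' = sigma l := by
    have := congrArg sigma hl''
    rw [map_add, sigma_sigma_sigma, map_zero] at this
    linear_combination this - sigma l * h2
  subst hl1
  have hdd : sigma l * (sigma l * sigma G + sigma (sigma l) * G) = 0 := by
    have := congrArg dSq h'
    simp only [map_add, Derivation.leibniz, smul_eq_mul, dSq_of_isHomogeneous_one hl,
      dSq_of_isHomogeneous_one (hs hl), dSq_dSq, ← sigma_dSq] at this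
    exact square_zero_identity h2 h' s1 this hrel r1
  have hsl : sigma l = 0 := by
    rcases mul_eq_zero.mp hdd with h | h
    · exact h
    · exact hzero (β := sigma (sigma l)) (hs hl) (by
        linear_combination h - sigma (sigma l) * G * h2)
  have hl0 : l = 0 := by
    rw [← sigma_sigma_sigma l, hsl, map_zero, map_zero]
  rw [← h', hsl, hl0]
  simp

/-- Descent along Frobenius: if `(σG, G)` is closed, then `Sq¹(G) = 0`, so `G` is a square, unless
it is linear or a multiple of `v`. The latter is excluded because a power of `u` lies in the
ideal. -/
theorem exists_eq_linear_pow (e : ℕ) (he : 0 < e) (G : P) (hG : G.IsHomogeneous e)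
    (hrel : G + sigma G + sigma (sigma G) = 0) (hcl : totalSq G ∈ Ideal.span {sigma G, G})
    {N M : ℕ} (hN : uP ^ N ∈ Ideal.span {sigma G, G}) (hM : vP ^ M ∈ Ideal.span {sigma G, G}) :
    ∃ (k : ℕ) (l : P), (l = X 0 ∨ l = X 1 ∨ l = X 0 + X 1) ∧ G = l ^ 2 ^ k := by
  induction e using Nat.strong_induction_on generalizing G with
  | _ e ih =>
    have hG0 : ∀ c, G = c * vP → False := by
      rintro c rfl
      rw [map_mul, sigma_vP] at hN
      obtain ⟨α, β, h⟩ := Ideal.mem_span_pair.mp hN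
      have := congrArg resP h
      rw [map_pow, resP_uP, map_add, map_mul, map_mul, map_mul, map_mul, resP_vP] at this
      exact pow_ne_zero N (pow_ne_zero 2 (Polynomial.X_ne_zero (R := ZMod 2)))
        (by simpa using this.symm)
    rcases Nat.lt_or_ge 1 e with he1 | he1
    · have hd := dSq_eq_zero_of_closed he1 hG hrel hcl hN hM
      obtain ⟨n, rfl | rfl⟩ := Nat.even_or_odd' e
      · rw [two_mul] at hG
        obtain ⟨g, hg, rfl⟩ := eq_sq_of_dSq_eq_zero hG hd
        rw [map_pow] at hrel hcl hN hM
        have hle : Ideal.span {sigma g ^ 2, g ^ 2} ≤ Ideal.span {sigma g, g} := by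
          rw [Ideal.span_le, Set.pair_subset_iff]
          exact ⟨Ideal.pow_mem_of_mem _ (Ideal.subset_span (by simp)) 2 (by omega),
            Ideal.pow_mem_of_mem _ (Ideal.subset_span (by simp)) 2 (by omega)⟩
        obtain ⟨k, l, hl, rfl⟩ := ih n (by omega) (by omega) g hg (by
            rw [map_pow, ← CharTwo.add_sq, ← CharTwo.add_sq] at hrel
            exact pow_eq_zero_iff (two_ne_zero) |>.mp hrel)
          (mem_span_of_sq_mem (by rwa [map_pow] at hcl)) (hle hN) (hle hM)
        exact ⟨k + 1, l, hl, by rw [← pow_mul, pow_succ]⟩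
      · rw [two_mul] at hG
        obtain ⟨c, hc⟩ := vP_dvd_of_dSq_eq_zero hG hd
        exact (hG0 c (by rw [hc, mul_comm])).elim
    · obtain rfl : e = 1 := by omega
      rcases isHomogeneous_one_cases hG with rfl | h
      · exact (hG0 0 (by simp)).elim
      · exact ⟨0, G, h, by simp⟩

/-- Multiplication by `1 + u + v` is invertible modulo an ideal containing powers of `u` and `v`. -/
theorem mem_of_one_add_mul_mem {R : Type*} [CommRing R] [CharP R 2] {I : Ideal R} {u v : R}
    {N M : ℕ} (hN : u ^ N ∈ I) (hM : v ^ M ∈ I) {h : R} (hh : (1 + u + v) * h ∈ I) : h ∈ I := by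
  obtain ⟨k, hk⟩ : ∃ k, N ≤ 2 ^ k ∧ M ≤ 2 ^ k :=
    ⟨max N M, (le_max_left _ _).trans Nat.lt_two_pow_self.le,
      (le_max_right _ _).trans Nat.lt_two_pow_self.le⟩
  have h1 : (1 + u + v) ^ 2 ^ k * h ∈ I := by
    obtain ⟨j, hj⟩ : ∃ j, 2 ^ k = j + 1 :=
      ⟨2 ^ k - 1, by have := Nat.one_le_two_pow (n := k); omega⟩
    rw [hj, pow_succ, mul_assoc]
    exact I.mul_mem_left _ hh
  rw [add_pow_char_pow, add_pow_char_pow, one_pow] at h1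
  have h2 := I.mul_mem_right h (I.pow_mem_of_pow_mem hN hk.1)
  have h3 := I.mul_mem_right h (I.pow_mem_of_pow_mem hM hk.2)
  have : h = (1 + u ^ 2 ^ k + v ^ 2 ^ k) * h - u ^ 2 ^ k * h - v ^ 2 ^ k * h := by ring
  rw [this]
  exact I.sub_mem (I.sub_mem h1 h2) h3

theorem totalSq_X (j : Fin 2) : totalSq (X j) = X j + X j ^ 2 := by simp [totalSq]

theorem totalSq_uP : totalSq uP = uP + vP + uP ^ 2 := by
  simp only [map_add, map_mul, map_pow, totalSq_X]
  linear_combination (-X 0 ^ 2 * X 1 ^ 2 - X 0 * X 1 ^ 3 + X 0 ^ 3 - X 0 ^ 3 * X 1 + X 1 ^ 3)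
    * two_eq_zero

theorem totalSq_vP : totalSq vP = (1 + uP + vP) * vP := by
  simp only [map_add, map_mul, map_pow, totalSq_X]
  linear_combination (X 0 * X 1 ^ 3 + X 0 ^ 2 * X 1 ^ 2 + X 0 ^ 3 * X 1 - X 0 ^ 3 * X 1 ^ 3)
    * two_eq_zero

theorem totalSq_mem_span {f g h : P} (hf : totalSq f ∈ Ideal.span {f, g})
    (hg : totalSq g ∈ Ideal.span {f, g}) (hh : h ∈ Ideal.span {f, g}) :
    totalSq h ∈ Ideal.span {f, g} := by
  obtain ⟨α, β, rfl⟩ := Ideal.mem_span_pair.mp hh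
  rw [map_add, map_mul, map_mul]
  exact Ideal.add_mem _ (Ideal.mul_mem_left _ _ hf) (Ideal.mul_mem_left _ _ hg)

section

variable {f g Y : P} {r : ℕ}

/-- Two invariants of consecutive degrees that are nonzero on the lines are combinations of `Y` and
`σY` for a polynomial `Y` of smaller degree. -/
theorem exists_common_quotient (hr : 0 < r) (hf : f.IsHomogeneous r)
    (hg : g.IsHomogeneous (r + 1)) (sf : sigma f = f) (sg : sigma g = g)
    (rf : resP f = Polynomial.X ^ r) (rg : resP g = Polynomial.X ^ (r + 1)) :
    ∃ Y : P, Y.IsHomogeneous (r - 1) ∧ Y + sigma Y + sigma (sigma Y) = 0 ∧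
      f = X 0 * sigma Y + X 1 * Y ∧ g = X 0 ^ 2 * sigma Y + X 1 ^ 2 * Y := by
  have h2 := two_eq_zero
  have hp2 := poly_two_eq_zero
  obtain ⟨Y, e1⟩ : X 1 * (X 0 + X 1) ∣ X 0 * f + g := by
    apply X1_mul_dvd
    · simp only [map_add, map_mul, sigma_X0, sf, sg, resP_X1, rf, rg]
      linear_combination Polynomial.X ^ (r + 1) * hp2
    · simp only [map_add, map_mul, sigma_X0, sigma_X1, sf, sg, resP_X0, resP_X1, rf, rg]
      linear_combination Polynomial.X ^ (r + 1) * hp2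
  have e2 := congrArg sigma e1
  have e3 := congrArg sigma e2
  simp only [map_add, map_mul, sigma_X0, sigma_X1, sf, sg] at e2 e3
  have h0 : (X 0 : P) ≠ 0 := X_ne_zero _
  have h1 : (X 1 : P) ≠ 0 := X_ne_zero _
  have h01 : (X 0 + X 1 : P) ≠ 0 := fun h => by simpa using congrArg resP h
  have hf' : f = X 0 * sigma Y + X 1 * Y := by
    apply mul_left_cancel₀ h01
    linear_combination e1 + e2 + (X 0 * X 1 * sigma Y + X 1 ^ 2 * sigma Y - g) * h2
  have hg' : g = X 0 ^ 2 * sigma Y + X 1 ^ 2 * Y := by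
    linear_combination e1 - X 0 * hf' - X 0 ^ 2 * sigma Y * h2
  refine ⟨Y, ?_, ?_, hf', hg'⟩
  · apply isHomogeneous_of_mul_vP
    have : Y * vP = X 0 * (X 0 * f + g) := by rw [e1]; ring
    rw [this, show r - 1 + 3 = 1 + (1 + r) by omega]
    exact (isHomogeneous_X _ _).mul (((isHomogeneous_X _ _).mul hf).add (by rwa [add_comm 1 r]))
  · apply mul_left_cancel₀ (mul_ne_zero h0 h1)
    linear_combination -e1 - e2 - e3 + hg' + (g + (X 0 + X 1) * f - X 0 * X 1 * sigma Y
      - X 1 ^ 2 * sigma Y - (X 0 ^ 2 + 3 * X 0 * X 1 + 3 * X 1 ^ 2) * sigma (sigma Y)) * h2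

/-- The ideal `(σY, Y)` is the colon ideal `(f, g) : v` in `𝔽₂[a,b]`. -/
theorem mem_span_of_mul_vP_mem (hr : f = X 0 * sigma Y + X 1 * Y)
    (hg' : g = X 0 ^ 2 * sigma Y + X 1 ^ 2 * Y) (sf : sigma f = f) (sg : sigma g = g)
    (rf : resP f = Polynomial.X ^ r) (rg : resP g = Polynomial.X ^ (r + 1)) {z : P}
    (hz : vP * z ∈ Ideal.span {f, g}) : z ∈ Ideal.span {sigma Y, Y} := by
  have hp2 := poly_two_eq_zero
  obtain ⟨α, β, h⟩ := Ideal.mem_span_pair.mp hz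
  have key : ∀ {α β z : P}, α * f + β * g = vP * z → resP α + Polynomial.X * resP β = 0 := by
    intro α β z h
    have := congrArg resP h
    rw [map_add, map_mul, map_mul, map_mul, resP_vP, rf, rg] at this
    apply mul_left_cancel₀ (pow_ne_zero r (Polynomial.X_ne_zero (R := ZMod 2)))
    linear_combination this
  have h' := congrArg sigma h
  have h'' := congrArg sigma h'
  simp only [map_add _ (_ * f), map_mul _ _ f, map_mul _ _ g, map_mul _ vP, sf, sg, sigma_vP]
    at h' h''
  have k0 := key h
  have k1 := key h'
  have k2 := key h''
  obtain ⟨A, hA⟩ : X 1 * (X 0 + X 1) ∣ α + X 0 * β := by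
    apply X1_mul_dvd
    · simpa using k1
    · simpa using k2
  obtain ⟨B, hB⟩ : X 0 * (X 0 + X 1) ∣ α + X 1 * β := by
    apply X0_mul_dvd
    · simpa using k0
    · simpa using k1
  refine Ideal.mem_span_pair.mpr ⟨A, B, mul_left_cancel₀ vP_ne_zero ?_⟩
  rw [← h, hr, hg']
  linear_combination (-X 0 * sigma Y) * hA - X 1 * Y * hB

/-- A closed ideal of the invariant ring that contains powers of `u` and `v` is not generated by two
elements of consecutive degrees both of which are nonzero on the lines. -/
theorem not_closed_of_consecutive (hr : 0 < r) (hf : f.IsHomogeneous r)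
    (hg : g.IsHomogeneous (r + 1)) (sf : sigma f = f) (sg : sigma g = g)
    (rf : resP f = Polynomial.X ^ r) (rg : resP g = Polynomial.X ^ (r + 1))
    (cf : totalSq f ∈ Ideal.span {f, g}) (cg : totalSq g ∈ Ideal.span {f, g})
    {N M : ℕ} (hN : uP ^ N ∈ Ideal.span {f, g}) (hM : vP ^ M ∈ Ideal.span {f, g}) : False := by
  obtain ⟨Y, hY, hrel, hf', hg'⟩ := exists_common_quotient hr hf hg sf sg rf rg
  have hp2 := poly_two_eq_zero
  have h2 := two_eq_zero
  have hX := Polynomial.X_ne_zero (R := ZMod 2)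
  have rY : resP Y = Polynomial.X ^ (r - 1) := by
    apply mul_left_cancel₀ hX
    rw [← pow_succ', Nat.sub_add_cancel hr, ← rf, hf']
    simp
  have hr1 : 0 < r - 1 := by
    by_contra h
    obtain rfl : r = 1 := by omega
    have rf' := congrArg (Polynomial.eval 1) rf
    have sf0 := congrArg (fun f => Polynomial.eval 1 (resP f)) sf
    have sf1 := congrArg (fun f => Polynomial.eval 1 (resP (sigma f))) sf
    rcases isHomogeneous_one_cases hf with rfl | rfl | rfl | rfl
    · simp at rf'
    · simp at rf'
    · simp at sf1
    · simp at sf0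
  have hle : Ideal.span {f, g} ≤ Ideal.span {sigma Y, Y} := by
    rw [Ideal.span_le, Set.pair_subset_iff]
    exact ⟨Ideal.mem_span_pair.mpr ⟨_, _, hf'.symm⟩, Ideal.mem_span_pair.mpr ⟨_, _, hg'.symm⟩⟩
  have hvY : vP * Y ∈ Ideal.span {f, g} := Ideal.mem_span_pair.mpr ⟨X 0 ^ 2, X 0, by
    rw [hf', hg']; linear_combination X 0 ^ 3 * sigma Y * h2⟩
  have hcl : totalSq Y ∈ Ideal.span {sigma Y, Y} := by
    have h := totalSq_mem_span cf cg hvY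
    rw [map_mul, totalSq_vP, mul_comm _ vP, mul_assoc] at h
    exact mem_of_one_add_mul_mem (hle hN) (hle hM)
      (mem_span_of_mul_vP_mem hf' hg' sf sg rf rg h)
  -- By the descent, `Y` is a power of a linear form with exponent a power of two.
  have hSY : totalSq Y = Y + Y ^ 2 := by
    obtain ⟨k, l, hl, rfl⟩ := exists_eq_linear_pow _ hr1 Y hY hrel hcl (hle hN) (hle hM)
    have : totalSq l = l + l ^ 2 := by
      rcases hl with rfl | rfl | rfl <;> simp [totalSq_X, CharTwo.add_sq]
      ring
    rw [map_pow, this, add_pow_char_pow, ← pow_mul, ← pow_mul, mul_comm]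
  have hSsY : totalSq (sigma Y) = sigma Y + sigma Y ^ 2 := by
    rw [← act_totalSq, hSY, map_add, map_pow]
  -- The total square of `f = a σY + b Y` gives a further element of `(f, g)`.
  have hmem : X 0 * sigma Y ^ 2 + X 1 * Y ^ 2 ∈ Ideal.span {f, g} := by
    have h1 : f ∈ Ideal.span {f, g} := Ideal.subset_span (by simp)
    have h3 : g ∈ Ideal.span {f, g} := Ideal.subset_span (by simp)
    have : X 0 * sigma Y ^ 2 + X 1 * Y ^ 2 = totalSq f - f - g - f * f := by
      conv_rhs => rw [hf']
      rw [map_add, map_mul, map_mul, hSY, hSsY, totalSq_X, totalSq_X, hg']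
      linear_combination X 0 * X 1 * Y * sigma Y * h2
    rw [this]
    exact Ideal.sub_mem _ (Ideal.sub_mem _ (Ideal.sub_mem _ cf h1) h3) (Ideal.mul_mem_left _ _ h1)
  obtain ⟨p, q, hpq⟩ := Ideal.mem_span_pair.mp hmem
  have hsyz : X 0 * (p + q * X 0 + sigma Y) * sigma Y = X 1 * (p + q * X 1 + Y) * Y := by
    rw [hf', hg'] at hpq
    linear_combination hpq + (X 0 * sigma Y ^ 2 - X 1 * p * Y - X 1 ^ 2 * q * Y) * h2
  obtain ⟨w, hw⟩ := dvd_of_pow_mem_span_P (hle hN) (hle hM) hsyz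
  have hY0 : Y ≠ 0 := by
    rintro rfl
    exact pow_ne_zero _ hX (by rw [← rY, map_zero])
  have hw' : X 1 * (p + q * X 1 + Y) = sigma Y * w := by
    apply mul_right_cancel₀ hY0
    rw [← hsyz, hw]; ring
  -- The syzygy between `σY` and `Y` is a multiple `w` of the trivial one, and `ab` divides `w`.
  obtain ⟨w₁, rfl⟩ : X 0 ∣ w := by
    apply X0_dvd_of_resP_eq_zero
    have := congrArg resP hw
    rw [map_mul, map_mul, resP_X0, zero_mul, rY] at this
    exact (mul_eq_zero.mp this.symm).resolve_left (pow_ne_zero _ hX)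
  obtain ⟨w₂, rfl⟩ : X 1 ∣ w₁ := by
    apply X1_dvd_of_resP_eq_zero
    have := congrArg (fun f => resP (sigma (sigma f))) hw'
    simp only [map_mul, sigma_X1, map_add, sigma_X0, sigma_sigma_sigma, rY, resP_X0, resP_X1]
      at this
    have h3 : Polynomial.X ^ (r - 1) * (Polynomial.X * resP (sigma (sigma w₁))) = 0 := by
      linear_combination -this + Polynomial.X * (resP (sigma (sigma p))
        + resP (sigma (sigma q)) * (2 * Polynomial.X) + resP (sigma (sigma Y))) * hp2
    exact (mul_eq_zero.mp ((mul_eq_zero.mp h3).resolve_left (pow_ne_zero _ hX))).resolve_left hX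
  have c1 : p + q * X 0 + sigma Y = X 1 * w₂ * Y :=
    mul_left_cancel₀ (X_ne_zero (R := ZMod 2) (0 : Fin 2)) (by linear_combination hw)
  have c2 : p + q * X 1 + Y = X 0 * w₂ * sigma Y :=
    mul_left_cancel₀ (X_ne_zero (R := ZMod 2) (1 : Fin 2)) (by linear_combination hw')
  have c3 : sigma (sigma Y) = q * (X 0 + X 1) + w₂ * f := by
    rw [hf']
    linear_combination c1 + c2 + hrel - (p + q * X 0 + q * X 1 + sigma Y + Y) * h2
  -- On the line `a + b = 0` the left side is `t^(r-1)` and the right side is divisible by `t^r`.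
  have c4 := congrArg (fun f => resP (sigma f)) c3
  simp only [sigma_sigma_sigma, map_add, map_mul, sf, rf, rY, sigma_X0, sigma_X1, resP_X0,
    resP_X1] at c4
  have c5 : Polynomial.X ^ (r - 1) * (1 - resP (sigma w₂) * Polynomial.X) = 0 := by
    have : (Polynomial.X : Polynomial (ZMod 2)) ^ r = Polynomial.X ^ (r - 1) * Polynomial.X := by
      rw [← pow_succ, Nat.sub_add_cancel hr]
    rw [this] at c4
    linear_combination c4 + resP (sigma q) * Polynomial.X * hp2
  have c6 := (mul_eq_zero.mp c5).resolve_left (pow_ne_zero _ hX)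
  simpa using congrArg (Polynomial.eval 0) c6

end

/-! ### Rings of invariants -/

theorem act_mul (g h : G) (f : P) : act (g * h) f = act g (act h f) := by
  have : act (g * h) = (act g).comp (act h) := by
    apply MvPolynomial.algHom_ext
    intro j
    simp only [act, aeval_X, AlgHom.comp_apply, Fin.sum_univ_two, map_add, map_mul,
      MvPolynomial.algHom_C, MvPolynomial.algebraMap_eq, Units.val_mul, Matrix.mul_apply]
    ring
  exact DFunLike.congr_fun this f

theorem act_one (f : P) : act 1 f = f := by
  have : act 1 = AlgHom.id (ZMod 2) P := by
    apply MvPolynomial.algHom_ext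
    intro j
    fin_cases j <;> simp [act]
  exact DFunLike.congr_fun this f

/-- The subgroup of `GL₂(𝔽₂)` that fixes a given polynomial. -/
def fixer (f : P) : Subgroup G where
  carrier := {g | act g f = f}
  mul_mem' {g h} hg hh := by
    simp only [Set.mem_ofPred_eq] at hg hh ⊢
    rw [act_mul, hh, hg]
  one_mem' := act_one f
  inv_mem' {g} hg := by
    simp only [Set.mem_ofPred_eq] at hg ⊢
    conv_lhs => rw [← hg]
    rw [← act_mul, inv_mul_cancel, act_one]

theorem mem_HA4_iff {f : P} : f ∈ HA4 ↔ sigma f = f := by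
  constructor
  · exact fun h => h c3 (Subgroup.mem_zpowers c3)
  · intro h g hg
    have : Subgroup.zpowers c3 ≤ fixer f := by
      rw [Subgroup.zpowers_le]
      exact h
    exact this hg

/-- The transposition of the two variables. -/
def swapG : G := ⟨!![0, 1; 1, 0], !![0, 1; 1, 0], by decide, by decide⟩

/-- The substitution `a ↦ b`, `b ↦ a`. -/
abbrev tau : P →ₐ[ZMod 2] P := act swapG

@[simp] theorem tau_X0 : tau (X 0) = X 1 := by simp [act, swapG]

@[simp] theorem tau_X1 : tau (X 1) = X 0 := by simp [act, swapG]

theorem tau_tau (f : P) : tau (tau f) = f := by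
  rw [← act_mul, show swapG * swapG = 1 from Units.ext (by decide), act_one]

theorem sigma_tau (f : P) : sigma (tau f) = tau (sigma (sigma f)) := by
  rw [← act_mul, ← act_mul, ← act_mul]
  congr 2
  exact Units.ext (by decide)

/-- The group `GL₂(𝔽₂)` is generated by the transposition and the rotation. -/
theorem exists_eq_swapG_pow_mul_c3_pow (g : G) : ∃ i j : ℕ, g = swapG ^ i * c3 ^ j := by
  have hd : ((g : Matrix (Fin 2) (Fin 2) (ZMod 2))).det ≠ 0 :=
    (Matrix.isUnits_det_units g).ne_zero
  rw [Matrix.det_fin_two] at hd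
  have h : (g : Matrix (Fin 2) (Fin 2) (ZMod 2)) =
    !![(g : Matrix (Fin 2) (Fin 2) (ZMod 2)) 0 0, (g : Matrix (Fin 2) (Fin 2) (ZMod 2)) 0 1;
      (g : Matrix (Fin 2) (Fin 2) (ZMod 2)) 1 0, (g : Matrix (Fin 2) (Fin 2) (ZMod 2)) 1 1] :=
    Matrix.eta_fin_two _
  suffices ∀ p q r s : ZMod 2, p * s - q * r ≠ 0 → ∃ i < 2, ∃ j < 3,
      !![p, q; r, s] = (swapG : Matrix (Fin 2) (Fin 2) (ZMod 2)) ^ i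
        * (c3 : Matrix (Fin 2) (Fin 2) (ZMod 2)) ^ j by
    obtain ⟨i, -, j, -, hij⟩ := this _ _ _ _ hd
    exact ⟨i, j, Units.ext (by rw [h, hij]; rfl)⟩
  decide

theorem mem_D2_iff {f : P} : f ∈ D2 ↔ sigma f = f ∧ tau f = f := by
  constructor
  · exact fun h => ⟨h c3 trivial, h swapG trivial⟩
  · rintro ⟨h1, h2⟩ g -
    obtain ⟨i, j, rfl⟩ := exists_eq_swapG_pow_mul_c3_pow g
    exact (fixer f).mul_mem ((fixer f).pow_mem h2 i) ((fixer f).pow_mem h1 j)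

variable {H : Subgroup G}

/-- Restriction of an invariant to the line `a = 0`. Every invariant of the rotation of order three
has the same restriction to the three lines, and the kernel is generated by `v`. -/
def res : Inv H →ₐ[ZMod 2] Polynomial (ZMod 2) := resP.comp (Inv H).val

/-- The total Steenrod square on a ring of invariants as a ring homomorphism. -/
def invS : Inv H →ₐ[ZMod 2] Inv H :=
  (totalSq.comp (Inv H).val).codRestrict (Inv H) fun f => (invTotalSq f).2

@[simp] theorem coe_u : ((u : Inv H) : P) = uP := rfl

@[simp] theorem coe_v : ((v : Inv H) : P) = vP := rfl

theorem res_apply (f : Inv H) : res f = resP f := rfl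

@[simp] theorem res_u : res (u : Inv H) = Polynomial.X ^ 2 := resP_uP

@[simp] theorem res_v : res (v : Inv H) = 0 := resP_vP

theorem res_invS (f : Inv H) : res (invS f)
    = Polynomial.aeval (Polynomial.X + Polynomial.X ^ 2 : Polynomial (ZMod 2)) (res f) :=
  resP_totalSq f

theorem invS_u : invS (u : Inv H) = u + v + u ^ 2 := Subtype.ext totalSq_uP

theorem invS_v : invS (v : Inv H) = (1 + u + v) * v := Subtype.ext totalSq_vP

theorem u_ne_zero : (u : Inv H) ≠ 0 := fun h => uP_ne_zero (congrArg Subtype.val h)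

theorem v_ne_zero : (v : Inv H) ≠ 0 := fun h => vP_ne_zero (congrArg Subtype.val h)

theorem one_add_u_add_v_ne_zero : (1 + u + v : Inv H) ≠ 0 := by
  intro h
  have := congrArg (fun f => Polynomial.eval 0 (res f)) h
  simp at this

theorem uP_isHomogeneous : (uP : P).IsHomogeneous 2 := by
  refine IsHomogeneous.add (IsHomogeneous.add (isHomogeneous_X_pow _ _) ?_)
    (isHomogeneous_X_pow _ _)
  exact (isHomogeneous_X (ZMod 2) (0 : Fin 2)).mul (isHomogeneous_X _ 1)

/-- An invariant whose restriction to the line vanishes is a multiple of `v`. -/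
theorem v_dvd_iff (hH : c3 ∈ H) {f : Inv H} : v ∣ f ↔ res f = 0 := by
  constructor
  · rintro ⟨k, rfl⟩
    rw [map_mul, res_v, zero_mul]
  · intro h
    have hs : sigma (f : P) = f := f.2 c3 hH
    obtain ⟨k, hk⟩ : vP ∣ (f : P) := by
      apply vP_dvd <;> (try simp only [hs]) <;> exact h
    refine ⟨⟨k, fun g hg => ?_⟩, Subtype.ext hk⟩
    apply mul_left_cancel₀ vP_ne_zero
    have := f.2 g hg
    rw [hk, map_mul, (u_v_invariant g).2] at this
    exact this

theorem v_dvd_of_dvd_u_mul (hH : c3 ∈ H) (f : Inv H) (h : v ∣ u * f) : v ∣ f := by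
  rw [v_dvd_iff hH] at h ⊢
  rw [map_mul, res_u] at h
  exact (mul_eq_zero.mp h).resolve_left (pow_ne_zero _ Polynomial.X_ne_zero)

theorem dvd_of_pow_mem_span_inv (hH : c3 ∈ H) {p q : Inv H} {N M : ℕ}
    (hN : u ^ N ∈ Ideal.span {p, q}) (hM : v ^ M ∈ Ideal.span {p, q}) {α β : Inv H}
    (h : α * p = β * q) : q ∣ α :=
  dvd_of_pow_mem_span u_ne_zero v_ne_zero (v_dvd_of_dvd_u_mul hH) hN hM h

/-- The homogeneous component of an invariant. -/
def comp (n : ℕ) (f : Inv H) : Inv H :=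
  ⟨homogeneousComponent n (f : P), fun g hg => by rw [act_homogeneousComponent, f.2 g hg]⟩

theorem comp_isHomogeneous (n : ℕ) (f : Inv H) : (comp n f : P).IsHomogeneous n :=
  homogeneousComponent_isHomogeneous n _

theorem eq_sum_comp (f : Inv H) :
    f = ∑ i ∈ Finset.range ((f : P).totalDegree + 1), comp i f := by
  apply Subtype.ext
  push_cast
  exact (sum_homogeneousComponent (f : P)).symm

theorem comp_add (n : ℕ) (f g : Inv H) : comp n (f + g) = comp n f + comp n g :=
  Subtype.ext (map_add _ _ _)

theorem comp_self {f : Inv H} {n : ℕ} (hf : (f : P).IsHomogeneous n) : comp n f = f :=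
  Subtype.ext (homogeneousComponent_eq_self hf)

theorem comp_of_ne {f : Inv H} {n m : ℕ} (hf : (f : P).IsHomogeneous n) (h : m ≠ n) :
    comp m f = 0 :=
  Subtype.ext ((homogeneousComponent_of_mem hf).trans (if_neg h))

theorem comp_mul_add {f : Inv H} {n : ℕ} (hf : (f : P).IsHomogeneous n) (k : ℕ) (g : Inv H) :
    comp (k + n) (g * f) = comp k g * f :=
  Subtype.ext (homogeneousComponent_mul_add hf k g)

theorem comp_mul_of_lt {f : Inv H} {n k : ℕ} (hf : (f : P).IsHomogeneous n) (hk : k < n)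
    (g : Inv H) : comp k (g * f) = 0 :=
  Subtype.ext (homogeneousComponent_mul_of_lt hf hk g)

/-- The coefficient in degree `m` of a homogeneous element with respect to a generator. -/
theorem exists_comp_mul {f : Inv H} {n : ℕ} (hf : (f : P).IsHomogeneous n) (m : ℕ) (g : Inv H) :
    ∃ k : Inv H, comp m (g * f) = k * f ∧ (k : P).IsHomogeneous (m - n) ∧ (m < n → k = 0) := by
  rcases lt_or_ge m n with h | h
  · exact ⟨0, by rw [comp_mul_of_lt hf h, zero_mul], isHomogeneous_zero _ _ _, fun _ => rfl⟩
  · obtain ⟨k, rfl⟩ := Nat.exists_eq_add_of_le' h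
    exact ⟨comp k g, comp_mul_add hf k g, by simpa using comp_isHomogeneous k g, fun h => by omega⟩

theorem exists_homogeneous_coeffs {p q h : Inv H} {m n d : ℕ} (hp : (p : P).IsHomogeneous m)
    (hq : (q : P).IsHomogeneous n) (hh : (h : P).IsHomogeneous d) (hmem : h ∈ Ideal.span {p, q}) :
    ∃ α β : Inv H, h = α * p + β * q ∧ (α : P).IsHomogeneous (d - m) ∧
      (β : P).IsHomogeneous (d - n) ∧ (d < m → α = 0) ∧ (d < n → β = 0) := by
  obtain ⟨a, b, hab⟩ := Ideal.mem_span_pair.mp hmem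
  obtain ⟨α, h1, h2, h3⟩ := exists_comp_mul hp d a
  obtain ⟨β, h4, h5, h6⟩ := exists_comp_mul hq d b
  refine ⟨α, β, ?_, h2, h5, h3, h6⟩
  rw [← h1, ← h4, ← comp_add, hab, comp_self hh]

theorem res_isHomogeneous {f : Inv H} {n : ℕ} (hf : (f : P).IsHomogeneous n) :
    res f = 0 ∨ res f = Polynomial.X ^ n := resP_isHomogeneous hf

/-- There is no invariant of degree one. -/
theorem eq_zero_of_isHomogeneous_one (hH : c3 ∈ H) {f : Inv H} (hf : (f : P).IsHomogeneous 1) :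
    f = 0 := by
  have sf := f.2 c3 hH
  have sf0 := congrArg (fun f => Polynomial.eval 1 (resP f)) sf
  have sf1 := congrArg (fun f => Polynomial.eval 1 (resP (sigma f))) sf
  rcases isHomogeneous_one_cases hf with h | h | h | h
  · exact Subtype.ext h
  all_goals
    rw [h] at sf0 sf1
    simp at sf0 sf1

/-- The only nonzero invariant of degree zero is `1`. -/
theorem eq_one_of_isHomogeneous_zero {f : Inv H} (hf : (f : P).IsHomogeneous 0) :
    f = 0 ∨ f = 1 := by
  have hz : ∀ z : ZMod 2, z = 0 ∨ z = 1 := by decide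
  have h := homogeneousComponent_eq_self hf
  rw [homogeneousComponent_zero] at h
  rcases hz (coeff 0 (f : P)) with h0 | h0 <;> rw [h0] at h
  · left; exact Subtype.ext (by rw [← h]; simp)
  · right; exact Subtype.ext (by rw [← h]; simp)

/-! ### The sequence `xₙ` -/

theorem x_one : (x 1 : Inv H) = u := rfl

theorem x_zero : (x 0 : Inv H) = 1 := rfl

/-- The degree of `xₙ`, also for `x₀ = 1`. -/
abbrev xdeg (n : ℕ) : ℕ := 2 ^ (n + 1) - 2

theorem xdeg_succ (n : ℕ) : xdeg (n + 1) = 2 + 2 * xdeg n := by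
  have := Nat.one_le_two_pow (n := n)
  simp only [xdeg, pow_succ]
  omega

theorem coe_invSq_one {f : Inv H} {n : ℕ} (hf : (f : P).IsHomogeneous n) :
    (invSq 1 f : P) = dSq f := sq_one_eq_dSq hf

theorem dSq_uP : dSq uP = vP := by
  simp only [map_add, Derivation.leibniz, dSq_sq, dSq_X, smul_eq_mul]
  ring

theorem x_properties (n : ℕ) : ((x n : Inv H) : P).IsHomogeneous (xdeg n) ∧
    invSq 1 (x (n + 1) : Inv H) = v * x n ^ 2 ∧
    (x (n + 2) : Inv H) = u * x (n + 1) ^ 2 + v ^ 2 * x n ^ 4 ∧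
    ((x (n + 1) : Inv H) : P).IsHomogeneous (xdeg (n + 1)) := by
  have hx : ∀ n, invSq 1 (x (n + 1) : Inv H) = v * x n ^ 2 →
      (x (n + 2) : Inv H) = u * x (n + 1) ^ 2 + v ^ 2 * x n ^ 4 := fun n h => by
    rw [x, h]; ring
  induction n with
  | zero =>
    have h1 : invSq 1 (x 1 : Inv H) = v * x 0 ^ 2 := by
      apply Subtype.ext
      rw [x_one, coe_invSq_one uP_isHomogeneous]
      simp [x_zero, dSq_uP]
    exact ⟨isHomogeneous_one _ _, h1, hx 0 h1, uP_isHomogeneous⟩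
  | succ n ih =>
    obtain ⟨h1, h2, h3, h4⟩ := ih
    have h5 : ((x (n + 2) : Inv H) : P).IsHomogeneous (xdeg (n + 2)) := by
      rw [h3]
      refine IsHomogeneous.add ?_ ?_
      · have := uP_isHomogeneous.mul (h4.pow 2)
        rwa [show 2 + xdeg (n + 1) * 2 = xdeg (n + 2) by rw [xdeg_succ (n + 1)]; ring] at this
      · have := (vP_isHomogeneous.pow 2).mul (h1.pow 4)
        rwa [show 3 * 2 + xdeg n * 4 = xdeg (n + 2) by
          rw [xdeg_succ (n + 1), xdeg_succ n]; ring] at this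
    have h6 : invSq 1 (x (n + 2) : Inv H) = v * x (n + 1) ^ 2 := by
      apply Subtype.ext
      rw [coe_invSq_one h5, h3]
      have : (((u * x (n + 1) ^ 2 + v ^ 2 * x n ^ 4 : Inv H)) : P)
        = uP * ((x (n + 1) : Inv H) : P) ^ 2 + (vP * ((x n : Inv H) : P) ^ 2) ^ 2 := by
        push_cast; simp only [coe_u, coe_v]; ring
      rw [this, map_add, dSq_sq, Derivation.leibniz, dSq_sq, dSq_uP]
      simp [mul_comm]
    exact ⟨h4, h6, hx _ h6, h5⟩

theorem x_isHomogeneous (n : ℕ) : ((x n : Inv H) : P).IsHomogeneous (xdeg n) := (x_properties n).1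

theorem invSq_one_x (n : ℕ) : invSq 1 (x (n + 1) : Inv H) = v * x n ^ 2 := (x_properties n).2.1

theorem x_add_two (n : ℕ) : (x (n + 2) : Inv H) = u * x (n + 1) ^ 2 + v ^ 2 * x n ^ 4 :=
  (x_properties n).2.2.1

theorem res_x (n : ℕ) : res (x n : Inv H) = Polynomial.X ^ xdeg n := by
  induction n using Nat.twoStepInduction with
  | zero => simp [x_zero]
  | one => exact res_u
  | more n _ ih =>
    rw [x_add_two, map_add, map_mul, map_mul, map_pow, map_pow, res_v, ih, res_u, xdeg_succ (n + 1)]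
    ring

theorem x_identity {R : Type*} [CommRing R] (h2 : (2 : R) = 0) {U V z A B C D : R}
    (hB : B = U * A ^ 2 + V ^ 2 * z ^ 4) (hC : C = U * B ^ 2 + V ^ 2 * A ^ 4)
    (hD : D = U * C ^ 2 + V ^ 2 * B ^ 4) :
    (U + V + U ^ 2) * (B + C + V * B ^ 2 + V * A ^ 2) ^ 2
      + V ^ 2 * (A + B + V * A ^ 2 + V * z ^ 2) ^ 4
    = (1 + U + V) * (C + D + V * C ^ 2 + V * B ^ 2) := by
  have e1 : (B + C + V * B ^ 2 + V * A ^ 2) ^ 2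
    = B ^ 2 + C ^ 2 + V ^ 2 * B ^ 4 + V ^ 2 * A ^ 4 := by grind
  have e2 : (A + B + V * A ^ 2 + V * z ^ 2) ^ 4
    = A ^ 4 + B ^ 4 + V ^ 4 * A ^ 8 + V ^ 4 * z ^ 8 := by grind
  have e3 : V ^ 4 * z ^ 8 = B ^ 2 + U ^ 2 * A ^ 4 := by grind
  have e4 : V ^ 4 * A ^ 8 = C ^ 2 + U ^ 2 * B ^ 4 := by grind
  rw [e1, e2, e3, e4]
  have e5 : V ^ 2 * A ^ 4 = C + U * B ^ 2 := by grind
  have e6 : V ^ 2 * B ^ 4 = D + U * C ^ 2 := by grind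
  grind

/-- The total square of `xₙ₊₁`, up to the factor `1 + u + v`, which is invertible modulo every ideal
that contains powers of `u` and `v`. -/
theorem one_add_mul_invS_x (n : ℕ) : (1 + u + v) * invS (x (n + 1) : Inv H)
    = x (n + 1) + x (n + 2) + v * x (n + 1) ^ 2 + v * x n ^ 2 := by
  have h2 := inv_two_eq_zero (H := H)
  have hS : ∀ n, invS (x (n + 2) : Inv H) = (u + v + u ^ 2) * invS (x (n + 1)) ^ 2
      + ((1 + u + v) * v) ^ 2 * invS (x n) ^ 4 := fun n => by
    rw [x_add_two, map_add, map_mul, map_mul, map_pow, map_pow, map_pow, invS_u, invS_v]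
  have hE := one_add_u_add_v_ne_zero (H := H)
  have hstep : ∀ n (z : Inv H), (x (n + 1) : Inv H) = u * x n ^ 2 + v ^ 2 * z ^ 4 →
      (1 + u + v) * invS (x n) = x n + x (n + 1) + v * x n ^ 2 + v * z ^ 2 →
      (1 + u + v) * invS (x (n + 1) : Inv H)
        = x (n + 1) + x (n + 2) + v * x (n + 1) ^ 2 + v * x n ^ 2 →
      (1 + u + v) * invS (x (n + 2) : Inv H)
        = x (n + 2) + x (n + 3) + v * x (n + 2) ^ 2 + v * x (n + 1) ^ 2 := by
    intro n z hz h0 h1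
    apply mul_left_cancel₀ hE
    rw [hS, ← x_identity h2 hz (x_add_two n) (x_add_two (n + 1)), ← h0, ← h1]
    ring
  have h1 : (1 + u + v) * invS (x 1 : Inv H)
      = x 1 + x 2 + v * x 1 ^ 2 + v * x 0 ^ 2 := by
    rw [x_add_two, x_one, x_zero, invS_u]
    grind
  induction n using Nat.twoStepInduction with
  | zero => exact h1
  | one => exact hstep 0 0 (by simp [x_one, x_zero]) (by simp [x_zero, x_one]) h1
  | more n ih0 ih1 => exact hstep (n + 1) (x n) (x_add_two n) ih0 ih1

/-! ### Finiteness and dimension -/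

/-- The property that restrictions of homogeneous invariants to the line may be divided: if `f`
and `g` restrict to `t^m` and `t^n` with `m ≤ n` and `n ≠ m + 1`, then some homogeneous invariant
restricts to `t^(n-m)`. -/
def HasQuotients (H : Subgroup G) : Prop :=
  ∀ (f g : Inv H) (m n : ℕ), (f : P).IsHomogeneous m → (g : P).IsHomogeneous n →
    res f = Polynomial.X ^ m → res g = Polynomial.X ^ n → m ≤ n → n ≠ m + 1 →
    ∃ z : Inv H, (z : P).IsHomogeneous (n - m) ∧ res z = Polynomial.X ^ (n - m)

theorem u_pow_properties (k : ℕ) : (((u : Inv H) ^ k : Inv H) : P).IsHomogeneous (2 * k) ∧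
    res ((u : Inv H) ^ k) = Polynomial.X ^ (2 * k) := by
  refine ⟨by simpa using uP_isHomogeneous.pow k, ?_⟩
  rw [map_pow, res_u, pow_mul]

theorem v_isHomogeneous : ((v : Inv H) : P).IsHomogeneous 3 := vP_isHomogeneous

/-- The invariant `a³ + a²b + b³` of the rotation of order three. -/
def w : HA4 := ⟨X 0 ^ 3 + X 0 ^ 2 * X 1 + X 1 ^ 3, by
  rw [mem_HA4_iff]
  simp only [map_add, map_mul, map_pow, sigma_X0, sigma_X1]
  linear_combination (X 0 ^ 2 * X 1 + 2 * X 0 * X 1 ^ 2 + X 1 ^ 3) * two_eq_zero⟩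

theorem w_isHomogeneous : (w : P).IsHomogeneous 3 :=
  ((isHomogeneous_X_pow _ _).add ((isHomogeneous_X_pow _ 2).mul (isHomogeneous_X _ 1))).add
    (isHomogeneous_X_pow _ _)

theorem res_w : res w = Polynomial.X ^ 3 := by
  simp [res_apply, w]

theorem hasQuotients_C3 : HasQuotients (Subgroup.zpowers c3) := by
  intro f g m n _ _ _ _ hmn hn
  obtain ⟨k, rfl⟩ := Nat.exists_eq_add_of_le hmn
  rw [Nat.add_sub_cancel_left]
  obtain ⟨j, rfl | rfl⟩ := Nat.even_or_odd' k
  · exact ⟨u ^ j, u_pow_properties j⟩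
  · obtain ⟨i, rfl⟩ : ∃ i, j = i + 1 := ⟨j - 1, by omega⟩
    refine ⟨u ^ i * w, ?_, ?_⟩
    · exact (u_pow_properties i).1.mul w_isHomogeneous
    · rw [map_mul, res_w, (u_pow_properties i).2]
      ring

theorem tau_w : tau (w : P) = w + vP := by
  simp only [w, map_add, map_mul, map_pow, tau_X0, tau_X1]
  linear_combination (- X 0 ^ 2 * X 1) * two_eq_zero

theorem resP_tau {f : P} (hf : f ∈ HA4) : resP (tau f) = resP f := by
  rw [mem_HA4_iff] at hf
  obtain ⟨f', g, hfg⟩ := exists_eq_X0_mul_add f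
  have key : resP (tau (sigma f)) = resP f := by
    rw [hfg]
    simp only [map_add, map_mul, sigma_X0, tau_X1, resP_X0, zero_mul, zero_add]
    rw [← Polynomial.aeval_algHom_apply, ← Polynomial.aeval_algHom_apply,
      ← Polynomial.aeval_algHom_apply, ← Polynomial.aeval_algHom_apply]
    simp
  rwa [hf] at key

/-- An element of the Dickson algebra of odd degree vanishes on the lines. -/
theorem even_of_res {f : D2} {n : ℕ} (hf : (f : P).IsHomogeneous n)
    (hr : res f = Polynomial.X ^ n) : Even n := by
  by_contra hn
  rw [Nat.not_even_iff_odd] at hn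
  obtain ⟨k, rfl⟩ := hn
  have hs := mem_D2_iff.mp f.2
  rcases k with _ | k
  · rw [eq_zero_of_isHomogeneous_one (Subgroup.mem_top c3) hf, map_zero] at hr
    exact pow_ne_zero _ Polynomial.X_ne_zero hr.symm
  · set f₁ : HA4 := ⟨f, D2_le_HA4 f.2⟩ with hf₁
    -- `f ≡ u^k w` modulo `v`; applying the transposition, which moves `w` to `w + v`, shows that
    -- `u^k` vanishes on the line.
    have hr1 : res (f₁ - u ^ k * w) = 0 := by
      rw [map_sub, map_mul, res_w, (u_pow_properties k).2]
      have : res f₁ = Polynomial.X ^ (2 * (k + 1) + 1) := hr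
      rw [this]
      ring
    obtain ⟨z, hz⟩ := (v_dvd_iff (Subgroup.mem_zpowers c3)).mpr hr1
    have hz' : (f : P) - uP ^ k * w = vP * z := congrArg Subtype.val hz
    have ht := congrArg tau hz'
    have hu : tau uP = uP := (u_v_invariant swapG).1
    have hv : tau vP = vP := (u_v_invariant swapG).2
    simp only [map_sub, map_mul, hs.2, tau_w, map_mul tau vP, map_pow tau uP, hu, hv] at ht
    have h3 : uP ^ k = z - tau z := by
      apply mul_left_cancel₀ vP_ne_zero
      linear_combination hz' - ht
    have h4 := congrArg resP h3
    rw [map_pow, resP_uP, map_sub, resP_tau z.2, sub_self] at h4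
    exact pow_ne_zero _ (pow_ne_zero 2 (Polynomial.X_ne_zero (R := ZMod 2))) h4

theorem hasQuotients_D2 : HasQuotients ⊤ := by
  intro f g m n hf hg rf rg hmn _
  obtain ⟨i, rfl⟩ := even_of_res hf rf
  obtain ⟨j, rfl⟩ := even_of_res hg rg
  rw [show j + j - (i + i) = 2 * (j - i) by omega]
  exact ⟨u ^ (j - i), u_pow_properties _⟩

/-- Modulo `v`, the power `u^L` is the square of `g`. -/
theorem exists_u_pow_mem (hH : c3 ∈ H) {I : Ideal (Inv H)} {M : ℕ} (hM : v ^ M ∈ I) {g : Inv H}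
    (hg : g ∈ I) {L : ℕ} (rg : res g = Polynomial.X ^ L) : ∃ N, (u : Inv H) ^ N ∈ I := by
  have h : res (u ^ L - g ^ 2) = 0 := by
    rw [map_sub, map_pow, map_pow, rg, res_u]
    ring
  obtain ⟨y, hy⟩ := (v_dvd_iff hH).mpr h
  have hu : u ^ L = g * g + v * y := by linear_combination hy
  obtain ⟨k, hk⟩ : ∃ k, M ≤ 2 ^ k := ⟨M, Nat.lt_two_pow_self.le⟩
  refine ⟨L * 2 ^ k, ?_⟩
  rw [pow_mul, hu, add_pow_char_pow, mul_pow, mul_pow]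
  refine I.add_mem (I.mul_mem_left _ (I.pow_mem_of_mem hg _ (by positivity)))
    (I.mul_mem_right _ (I.pow_mem_of_pow_mem hM hk))

/-- An ideal that contains powers of `u` and `v` contains everything of large degree. -/
theorem exists_degree_bound (hH : c3 ∈ H) (hQ : HasQuotients H) {I : Ideal (Inv H)} {N : ℕ}
    (hN : u ^ N ∈ I) (M : ℕ) (hM : v ^ M ∈ I) :
    ∀ n, 2 * N + 2 + 3 * M ≤ n → ∀ f : Inv H, (f : P).IsHomogeneous n → f ∈ I := by
  suffices ∀ M n, 2 * N + 2 + 3 * M ≤ n → ∀ f : Inv H, (f : P).IsHomogeneous n →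
      f ∈ Ideal.span {u ^ N, v ^ M} by
    intro n hn f hf
    have hle : Ideal.span {u ^ N, v ^ M} ≤ I := by
      rw [Ideal.span_le, Set.pair_subset_iff]
      exact ⟨hN, hM⟩
    exact hle (this M n hn f hf)
  intro M
  induction M with
  | zero =>
    intro n _ f _
    rw [Ideal.mem_span_pair]
    exact ⟨0, f, by simp⟩
  | succ M ih =>
    intro n hn f hf
    have key : ∃ z : Inv H, (z : P).IsHomogeneous (n - 2 * N) ∧ res f = res (z * u ^ N) := by
      rcases res_isHomogeneous hf with h | h
      · exact ⟨0, isHomogeneous_zero _ _ _, by simp [h]⟩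
      · obtain ⟨z, hz, rz⟩ := hQ _ _ _ _ (u_pow_properties N).1 hf (u_pow_properties N).2 h
          (by omega) (by omega)
        refine ⟨z, hz, ?_⟩
        rw [h, map_mul, rz, (u_pow_properties N).2, ← pow_add]
        congr 1; omega
    obtain ⟨z, hz, rz⟩ := key
    have h0 : res (f - z * u ^ N) = 0 := by rw [map_sub, rz, sub_self]
    obtain ⟨k, hk⟩ := (v_dvd_iff hH).mpr h0
    have hk' : ((f - z * u ^ N : Inv H) : P).IsHomogeneous (n - 3 + 3) := by
      rw [show n - 3 + 3 = n by omega]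
      refine hf.sub ?_
      have := hz.mul (u_pow_properties (H := H) N).1
      rwa [show n - 2 * N + 2 * N = n by omega] at this
    rw [hk, mul_comm] at hk'
    obtain ⟨α, β, hαβ⟩ := Ideal.mem_span_pair.mp
      (ih (n - 3) (by omega) k (isHomogeneous_of_mul_vP hk'))
    refine Ideal.mem_span_pair.mpr ⟨z + v * α, β, ?_⟩
    linear_combination v * hαβ - hk

theorem finite_quotient (hH : c3 ∈ H) (hQ : HasQuotients H) {I : Ideal (Inv H)} {N M : ℕ}
    (hN : u ^ N ∈ I) (hM : v ^ M ∈ I) : Module.Finite (ZMod 2) (Inv H ⧸ I) := by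
  have hb := exists_degree_bound hH hQ hN M hM
  set B := 2 * N + 2 + 3 * M
  let V : Submodule (ZMod 2) (Inv H) :=
    (restrictTotalDegree (Fin 2) (ZMod 2) B).comap (Inv H).val.toLinearMap
  have hV : Module.Finite (ZMod 2) V := by
    let φ : V →ₗ[ZMod 2] restrictTotalDegree (Fin 2) (ZMod 2) B :=
      ((Inv H).val.toLinearMap.comp V.subtype).codRestrict _ fun x => x.2
    refine Module.Finite.of_injective φ fun a b h => ?_
    exact Subtype.ext (Subtype.ext (congrArg
      (fun z : restrictTotalDegree (Fin 2) (ZMod 2) B => (z : P)) h))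
  refine Module.Finite.of_surjective ((Ideal.Quotient.mkₐ (ZMod 2) I).toLinearMap.comp V.subtype) ?_
  intro y
  obtain ⟨f, rfl⟩ := Ideal.Quotient.mk_surjective y
  refine ⟨⟨∑ i ∈ (Finset.range ((f : P).totalDegree + 1)).filter (· ≤ B), comp i f, ?_⟩, ?_⟩
  · refine Submodule.sum_mem _ fun i hi => ?_
    simp only [V, Submodule.mem_comap, mem_restrictTotalDegree]
    exact (comp_isHomogeneous i f).totalDegree_le.trans (Finset.mem_filter.mp hi).2
  · change Ideal.Quotient.mk I _ = Ideal.Quotient.mk I f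
    rw [eq_comm, Ideal.Quotient.eq]
    have : f - ∑ i ∈ (Finset.range ((f : P).totalDegree + 1)).filter (· ≤ B), comp i f
        = ∑ i ∈ (Finset.range ((f : P).totalDegree + 1)).filter (¬ · ≤ B), comp i f := by
      rw [sub_eq_iff_eq_add', Finset.sum_filter_add_sum_filter_not]
      exact eq_sum_comp f
    refine (congrArg (· ∈ I) this).mpr ?_
    refine I.sum_mem fun i hi => hb i ?_ _ (comp_isHomogeneous i f)
    have := (Finset.mem_filter.mp hi).2
    omega

/-- The variables are roots of `T⁴ + u T² + v T`, the product of `T - l` over all linear forms `l`,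
including zero. -/
theorem isIntegral_X (j : Fin 2) :
    IsIntegral (Inv H) (X j : P) := by
  refine ⟨Polynomial.X ^ 4 + Polynomial.C u * Polynomial.X ^ 2 + Polynomial.C v * Polynomial.X,
    by monicity!, ?_⟩
  simp only [Polynomial.eval₂_add, Polynomial.eval₂_mul, Polynomial.eval₂_C, Polynomial.eval₂_X,
    Polynomial.eval₂_pow]
  change X j ^ 4 + uP * X j ^ 2 + vP * X j = 0
  fin_cases j
  · simp only [Fin.zero_eta]
    linear_combination (X 0 ^ 4 + X 0 ^ 3 * X 1 + X 0 ^ 2 * X 1 ^ 2) * two_eq_zero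
  · simp only [Fin.mk_one]
    linear_combination (X 1 ^ 4 + X 1 ^ 3 * X 0 + X 0 ^ 2 * X 1 ^ 2) * two_eq_zero

theorem isIntegral_inv : Algebra.IsIntegral (Inv H) P := by
  refine ⟨fun f => ?_⟩
  induction f using MvPolynomial.induction_on with
  | C c => exact isIntegral_algebraMap (x := algebraMap (ZMod 2) (Inv H) c)
  | add p q hp hq => exact hp.add hq
  | mul_X p j hp => exact hp.mul (isIntegral_X j)

/-- The dimension is that of `𝔽₂[a,b]`, an integral extension of the ring of invariants. -/
theorem ringKrullDim_inv : ringKrullDim (Inv H) = 2 := by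
  have hint := isIntegral_inv (H := H)
  have hinj : Function.Injective (algebraMap (Inv H) P) := Subtype.val_injective
  have hP : ringKrullDim P = 2 := by
    rw [MvPolynomial.ringKrullDim_of_isNoetherianRing, ringKrullDim_eq_zero_of_field]
    simp
  rw [← hP]
  apply le_antisymm
  · refine iSup_le fun l => ?_
    obtain ⟨Q, -, hQ, hQl⟩ := Ideal.exists_ideal_over_prime_of_isIntegral l.head.asIdeal
      (⊥ : Ideal P) (by
        rw [← RingHom.ker_eq_comap_bot, (RingHom.injective_iff_ker_eq_bot _).mp hinj]
        exact bot_le)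
    have : Q.LiesOver l.head.asIdeal := ⟨hQl.symm⟩
    obtain ⟨L, hL, -⟩ := Ideal.exists_ltSeries_of_hasGoingUp l Q
    rw [← hL]
    exact Order.LTSeries.length_le_krullDim L
  · refine Order.krullDim_le_of_strictMono (PrimeSpectrum.comap (algebraMap (Inv H) P)) ?_
    intro p q hpq
    refine lt_of_le_of_ne (Ideal.comap_mono hpq.le) fun h => ?_
    obtain ⟨f, hf, hfp⟩ := Set.exists_of_ssubset hpq
    have := Ideal.comap_lt_comap_of_integral_mem_sdiff (R := Inv H) (I := p.asIdeal)
      (J := q.asIdeal) hpq.le ⟨hf, hfp⟩ (hint.isIntegral f)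
    exact this.ne (congrArg PrimeSpectrum.asIdeal h)

/-! ### Polynomial congruences over `𝔽₂` -/

theorem one_add_X_pow_two_pow (j : ℕ) :
    (1 + Polynomial.X : Polynomial (ZMod 2)) ^ 2 ^ j = 1 + Polynomial.X ^ 2 ^ j := by
  rw [add_pow_char_pow, one_pow]

theorem X_pow_dvd_of_dvd_mul {k n : ℕ} {q : Polynomial (ZMod 2)}
    (h : Polynomial.X ^ k ∣ (1 + Polynomial.X) ^ n * q) : Polynomial.X ^ k ∣ q := by
  have hc : IsCoprime (Polynomial.X : Polynomial (ZMod 2)) (1 + Polynomial.X) :=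
    ⟨-1, 1, by ring⟩
  exact (hc.pow).dvd_of_dvd_mul_left h

theorem X_pow_dvd_X_pow {k n : ℕ}
    (h : (Polynomial.X : Polynomial (ZMod 2)) ^ k ∣ Polynomial.X ^ n) :
    k ≤ n :=
  (pow_dvd_pow_iff Polynomial.X_ne_zero Polynomial.not_isUnit_X).mp h

/-- The order of vanishing of `(1 + t)ⁿ - 1` at `0` is a power of two dividing `n`. -/
theorem exists_two_pow_dvd_of_X_pow_dvd {k n : ℕ} (hn : 0 < n)
    (h : (Polynomial.X : Polynomial (ZMod 2)) ^ k ∣ (1 + Polynomial.X) ^ n - 1) :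
    ∃ j, 2 ^ j ∣ n ∧ k ≤ 2 ^ j := by
  obtain ⟨j, o, ho, rfl⟩ := Nat.exists_eq_two_pow_mul_odd hn.ne'
  refine ⟨j, dvd_mul_right _ _, X_pow_dvd_X_pow (n := 2 ^ j) ?_⟩
  rw [pow_mul, one_add_X_pow_two_pow] at h
  obtain ⟨c, hc⟩ := ho
  have hodd : ((o : ℕ) : Polynomial (ZMod 2)) = 1 := by
    rw [hc]; push_cast; linear_combination (c : Polynomial (ZMod 2)) * poly_two_eq_zero
  have hexp := (Polynomial.powAddExpansion (1 : Polynomial (ZMod 2)) (Polynomial.X ^ 2 ^ j) o).2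
  rw [hexp] at h
  set y := (Polynomial.powAddExpansion (1 : Polynomial (ZMod 2)) (Polynomial.X ^ 2 ^ j) o).1
  have h' : Polynomial.X ^ k ∣ (1 + y * Polynomial.X ^ 2 ^ j) * (Polynomial.X ^ 2 ^ j) := by
    convert h using 1
    rw [hodd]; ring
  have hc : IsCoprime (Polynomial.X : Polynomial (ZMod 2)) (1 + y * Polynomial.X ^ 2 ^ j) := by
    refine ⟨-y * Polynomial.X ^ (2 ^ j - 1), 1, ?_⟩
    have : (Polynomial.X : Polynomial (ZMod 2)) ^ 2 ^ j
        = Polynomial.X ^ (2 ^ j - 1) * Polynomial.X := by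
      rw [← pow_succ, Nat.sub_add_cancel Nat.one_le_two_pow]
    rw [this]; ring
  exact (hc.pow_left).dvd_of_dvd_mul_left h'

/-- A power of two that divides `2^(m+1) - i` is a proper divisor of `2^(m+1)`, hence it
divides `i`. -/
theorem two_pow_le_of_dvd_sub {i j m : ℕ} (hi : 0 < i) (him : i < 2 * 2 ^ m)
    (h : 2 ^ j ∣ 2 * 2 ^ m - i) : 2 ^ j ≤ i := by
  have h0 : 2 ^ j ≤ 2 * 2 ^ m - i := Nat.le_of_dvd (by omega) h
  have h1 : 2 ^ j < 2 ^ (m + 1) := by rw [pow_succ]; omega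
  have h2 : 2 ^ j ∣ 2 * 2 ^ m := by
    rw [← pow_succ']
    exact pow_dvd_pow _ ((Nat.pow_lt_pow_iff_right (by norm_num)).mp h1).le
  have h3 : 2 ^ j ∣ (2 * 2 ^ m - i) + i := by rwa [Nat.sub_add_cancel him.le]
  exact Nat.le_of_dvd hi ((Nat.dvd_add_right h).mp h3)

/-! ### Minimal enlargements of a colon ideal -/

/-- The coefficients of an element of `v(p, q)` in terms of `p` and `q`, restricted to the line. -/
theorem res_eq_zero_and_dvd (hH : c3 ∈ H) {p q : Inv H} {L : ℕ} (hp : res p = 0)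
    (hq : res q = Polynomial.X ^ L) {N M : ℕ} (hN : u ^ N ∈ Ideal.span {p, q})
    (hM : v ^ M ∈ Ideal.span {p, q}) {α β y : Inv H} (hy : y ∈ Ideal.span {p, q})
    (h : α * p + β * q = v * y) : res β = 0 ∧ Polynomial.X ^ L ∣ res α := by
  obtain ⟨α', β', rfl⟩ := Ideal.mem_span_pair.mp hy
  constructor
  · have := congrArg res h
    rw [map_add, map_mul, map_mul, map_mul, hp, hq, res_v] at this
    have h3 : res β * Polynomial.X ^ L = 0 := by linear_combination this
    exact (mul_eq_zero.mp h3).resolve_right (pow_ne_zero _ Polynomial.X_ne_zero)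
  · have h1 : (α - v * α') * p = (v * β' - β) * q := by linear_combination h
    have := map_dvd res (dvd_of_pow_mem_span_inv hH hN hM h1)
    rwa [hq, map_sub, map_mul, res_v, zero_mul, sub_zero] at this

theorem mem_span_triple {p q g h : Inv H} : h ∈ Ideal.span {v * p, v * q, g} ↔
    ∃ y ∈ Ideal.span {p, q}, ∃ c, h = v * y + c * g := by
  rw [Ideal.mem_span_insert]
  constructor
  · rintro ⟨a, z, hz, rfl⟩
    obtain ⟨b, c, rfl⟩ := Ideal.mem_span_pair.mp hz
    exact ⟨a * p + b * q, Ideal.mem_span_pair.mpr ⟨a, b, rfl⟩, c, by ring⟩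
  · rintro ⟨y, hy, c, rfl⟩
    obtain ⟨a, b, rfl⟩ := Ideal.mem_span_pair.mp hy
    exact ⟨a, b * (v * q) + c * g, Ideal.mem_span_pair.mpr ⟨b, c, rfl⟩, by ring⟩

theorem res_invS_of_res {r : Inv H} {s : ℕ} (hr : res r = Polynomial.X ^ s) :
    res (invS r) = Polynomial.X ^ s * (1 + Polynomial.X) ^ s := by
  rw [res_invS, hr, map_pow, Polynomial.aeval_X, ← mul_pow]
  ring

/-- A necessary condition for the ideal `v(p, q) + (αp + βq)` to be closed, in terms of the action
of the total square on `(p, q)` modulo `v(p, q)`. -/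
theorem exists_of_closed (hH : c3 ∈ H) {p q : Inv H} {L : ℕ} (hp : res p = 0)
    (hq : res q = Polynomial.X ^ L) {N M : ℕ} (hN : u ^ N ∈ Ideal.span {p, q})
    (hM : v ^ M ∈ Ideal.span {p, q}) {c A C D y₁ y₂ : Inv H}
    (hy₁ : y₁ ∈ Ideal.span {p, q}) (hy₂ : y₂ ∈ Ideal.span {p, q})
    (hSp : c * invS p = A * p + v * y₁) (hSq : c * invS q = C * p + D * q + v * y₂)
    (α β : Inv H)
    (hcl : invS (α * p + β * q) ∈ Ideal.span {v * p, v * q, α * p + β * q}) :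
    ∃ h : Polynomial (ZMod 2), res (invS β) * res D = h * res β ∧
      Polynomial.X ^ L ∣ res (invS α) * res A + res (invS β) * res C - h * res α := by
  obtain ⟨y, hy, h, hh⟩ := mem_span_triple.mp (Ideal.mul_mem_left _ c hcl)
  have key : (invS α * A + invS β * C - h * α) * p + (invS β * D - h * β) * q
      = v * (y - invS α * y₁ - invS β * y₂) := by
    rw [map_add, map_mul, map_mul] at hh
    linear_combination hh - invS α * hSp - invS β * hSq
  obtain ⟨h1, h2⟩ := res_eq_zero_and_dvd hH hp hq hN hM (Ideal.sub_mem _ (Ideal.sub_mem _ hy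
    (Ideal.mul_mem_left _ _ hy₁)) (Ideal.mul_mem_left _ _ hy₂)) key
  refine ⟨res h, ?_, ?_⟩
  · rw [map_sub, map_mul, map_mul] at h1
    linear_combination h1
  · simpa only [map_sub, map_add, map_mul] using h2

/-! ### The total square on the listed generators -/

/-- The first generator `vⁱ xₙ^(2e)` with `e = 2^m`. -/
def genP (i m n : ℕ) : Inv H := v ^ i * x n ^ (2 * 2 ^ m)

/-- The second generator `xₙ₊₁^e` with `e = 2^m`. -/
def genQ (m n : ℕ) : Inv H := x (n + 1) ^ 2 ^ m

theorem res_genP {i m n : ℕ} (hi : 0 < i) : res (genP i m n : Inv H) = 0 := by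
  rw [genP, map_mul, map_pow, res_v, zero_pow hi.ne', zero_mul]

theorem res_genQ (m n : ℕ) : res (genQ m n : Inv H) = Polynomial.X ^ (xdeg (n + 1) * 2 ^ m) := by
  rw [genQ, map_pow, res_x, pow_mul]

theorem genP_isHomogeneous (i m n : ℕ) :
    ((genP i m n : Inv H) : P).IsHomogeneous (3 * i + xdeg n * (2 * 2 ^ m)) :=
  (v_isHomogeneous.pow i).mul ((x_isHomogeneous n).pow _)

theorem genQ_isHomogeneous (m n : ℕ) :
    ((genQ m n : Inv H) : P).IsHomogeneous (xdeg (n + 1) * 2 ^ m) :=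
  (x_isHomogeneous (n + 1)).pow _

/-- The square of `one_add_mul_invS_x`, simplified by means of the recursion; unlike the former it
also holds for `x₀ = 1`. -/
theorem sq_one_add_mul_invS_x (n : ℕ) : (1 + u + v) ^ 2 * invS (x n : Inv H) ^ 2
    = x n ^ 2 + x (n + 1) ^ 2 + v ^ 2 * x n ^ 4 + x (n + 1) + u * x n ^ 2 := by
  have h2 := inv_two_eq_zero (H := H)
  rcases n with _ | n
  · rw [x_zero, map_one, zero_add, x_one, CharTwo.add_sq, CharTwo.add_sq]
    linear_combination -u * h2
  · rw [← mul_pow, one_add_mul_invS_x]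
    simp only [CharTwo.add_sq]
    rw [x_add_two]
    linear_combination (-u * x (n + 1) ^ 2) * h2

theorem invS_v_pow (i : ℕ) : invS ((v : Inv H) ^ i) = (1 + u + v) ^ i * v ^ i := by
  rw [map_pow, invS_v, mul_pow]

/-- The total square of the first generator, as a combination of the two generators. -/
theorem one_add_pow_mul_invS_genP (i m n : ℕ) :
    (1 + u + v) ^ (2 * 2 ^ m) * invS (genP i m n : Inv H)
    = (1 + u + v) ^ i * (1 + u ^ 2 ^ m + v ^ (2 * 2 ^ m) * x n ^ (2 * 2 ^ m)) * genP i m n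
      + (1 + u + v) ^ i * v ^ i * (1 + genQ m n) * genQ m n := by
  have h := congrArg (· ^ 2 ^ m) (sq_one_add_mul_invS_x (H := H) n)
  simp only [add_pow_char_pow, mul_pow, ← pow_mul] at h
  rw [genP, map_mul, invS_v_pow, map_pow]
  rw [genQ]
  rw [show x n ^ (4 * 2 ^ m) = (x n ^ (2 * 2 ^ m) : Inv H) ^ 2 by rw [← pow_mul]; ring_nf,
    show x (n + 1) ^ (2 * 2 ^ m) = (x (n + 1) ^ (2 ^ m) : Inv H) ^ 2 by rw [← pow_mul]; ring_nf]
    at h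
  linear_combination (1 + u + v) ^ i * v ^ i * h

/-- The total square of the second generator; the last summand is a multiple of the first generator
when `i ≤ e`. -/
theorem one_add_pow_mul_invS_genQ (m n : ℕ) :
    (1 + u + v) ^ 2 ^ m * invS (genQ m n : Inv H)
    = (1 + u ^ 2 ^ m * genQ m n + v ^ 2 ^ m * genQ m n) * genQ m n
      + (1 + v ^ 2 ^ m * x n ^ (2 * 2 ^ m)) * (v ^ 2 ^ m * x n ^ (2 * 2 ^ m)) := by
  have h := congrArg (· ^ 2 ^ m) (one_add_mul_invS_x (H := H) n)
  simp only [mul_pow] at h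
  rw [genQ, map_pow, h, x_add_two]
  simp only [add_pow_char_pow, mul_pow, ← pow_mul]
  rw [show x n ^ (4 * 2 ^ m) = (x n ^ (2 * 2 ^ m) : Inv H) ^ 2 by rw [← pow_mul]; ring_nf,
    show x (n + 1) ^ (2 * 2 ^ m) = (x (n + 1) ^ (2 ^ m) : Inv H) ^ 2 by rw [← pow_mul]; ring_nf,
    show v ^ (2 * 2 ^ m) = (v ^ (2 ^ m) : Inv H) ^ 2 by rw [← pow_mul]; ring_nf]
  ring

/-- The relation `xₙ₊₂^e = u^e xₙ₊₁^(2e) + v^(2e) xₙ^(4e)` in terms of the generators. -/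
theorem genQ_succ (m n : ℕ) : (genQ m (n + 1) : Inv H)
    = genP (2 ^ (m + 1)) (m + 1) n + u ^ 2 ^ m * genP 0 m (n + 1) := by
  rw [genQ, x_add_two, add_pow_char_pow, genP, genP]
  ring

theorem genP_zero (m n : ℕ) : (genP 0 m (n + 1) : Inv H) = genQ (m + 1) n := by
  rw [genP, genQ, pow_zero, one_mul, ← pow_succ']

theorem xdeg_succ_mul (m n : ℕ) : xdeg (n + 1) * 2 ^ m + 2 * 2 ^ m = 2 ^ (n + 2 + m) := by
  have h : xdeg (n + 1) + 2 = 2 ^ (n + 2) := by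
    have := Nat.one_le_two_pow (n := n)
    simp only [xdeg, pow_succ]
    omega
  rw [← add_mul, h, ← pow_add]

theorem two_mul_le_xdeg_mul (m n : ℕ) : 2 * 2 ^ m ≤ xdeg (n + 1) * 2 ^ m := by
  apply Nat.mul_le_mul_right
  rw [xdeg_succ]
  omega

theorem res_one_add_u_add_v : res (1 + u + v : Inv H) = (1 + Polynomial.X) ^ 2 := by
  rw [map_add, map_add, map_one, res_u, res_v, CharTwo.add_sq]
  ring

/-! ### Enlargements of the ideals `(vⁱ xₙ^(2e), xₙ₊₁^e)` -/

/-- The conditions of `exists_of_closed` for the ideals `(vⁱ xₙ^(2e), xₙ₊₁^e)`. -/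
theorem exists_of_closed_genP_genQ (hH : c3 ∈ H) {i m n : ℕ} (hi : 0 < i) (him : i ≤ 2 ^ m)
    {N M : ℕ} (hN : u ^ N ∈ Ideal.span {(genP i m n : Inv H), genQ m n})
    (hM : v ^ M ∈ Ideal.span {(genP i m n : Inv H), genQ m n}) (α β : Inv H)
    (hcl : invS (α * genP i m n + β * genQ m n) ∈
      Ideal.span {v * genP i m n, v * genQ m n, α * genP i m n + β * genQ m n}) :
    ∃ h : Polynomial (ZMod 2),
      res (invS β) * ((1 + Polynomial.X) ^ (2 * 2 ^ m) * (1 + Polynomial.X) ^ 2 ^ (n + 2 + m))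
        = h * res β ∧
      Polynomial.X ^ (xdeg (n + 1) * 2 ^ m) ∣
        res (invS α) * ((1 + Polynomial.X) ^ (2 * 2 ^ m) * (1 + Polynomial.X) ^ (2 * i))
        + res (invS β) * ((1 + Polynomial.X) ^ (2 * 2 ^ m) * (if i = 2 ^ m then 1 else 0))
        - h * res α := by
  obtain ⟨j, hj⟩ := Nat.exists_eq_add_of_le him
  obtain ⟨i', rfl⟩ : ∃ i', i = i' + 1 := ⟨i - 1, by omega⟩
  have hSp := one_add_pow_mul_invS_genP (H := H) (i' + 1) m n
  have hSq := one_add_pow_mul_invS_genQ (H := H) m n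
  have h1 : (1 + u + v) ^ (2 * 2 ^ m) * invS (genP (i' + 1) m n : Inv H)
      = ((1 + u + v) ^ (i' + 1) * (1 + u ^ 2 ^ m + v ^ (2 * 2 ^ m) * x n ^ (2 * 2 ^ m)))
        * genP (i' + 1) m n
        + v * (((1 + u + v) ^ (i' + 1) * v ^ i' * (1 + genQ m n)) * genQ m n) := by
    rw [hSp]; ring
  have h2 : (1 + u + v) ^ (2 * 2 ^ m) * invS (genQ m n : Inv H)
      = ((1 + u + v) ^ 2 ^ m * (1 + v ^ 2 ^ m * x n ^ (2 * 2 ^ m)) * v ^ j) * genP (i' + 1) m n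
        + ((1 + u + v) ^ 2 ^ m * (1 + u ^ 2 ^ m * genQ m n + v ^ 2 ^ m * genQ m n)) * genQ m n
        + v * 0 := by
    rw [two_mul, pow_add, mul_assoc, hSq, genP]
    have hv : (v : Inv H) ^ 2 ^ m = v ^ j * v ^ (i' + 1) := by rw [hj, ← pow_add, add_comm]
    linear_combination (1 + u + v) ^ 2 ^ m * (1 + v ^ 2 ^ m * x n ^ (2 * 2 ^ m))
      * x n ^ (2 * 2 ^ m) * hv
  obtain ⟨h, e1, e2⟩ := exists_of_closed hH (res_genP (Nat.succ_pos i')) (res_genQ m n) hN hM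
    (Ideal.mul_mem_left _ _ (Ideal.subset_span (by simp))) (Ideal.zero_mem _) h1 h2 α β hcl
  have hE := res_one_add_u_add_v (H := H)
  have r1 : res ((1 + u + v) ^ (i' + 1)
      * (1 + u ^ 2 ^ m + v ^ (2 * 2 ^ m) * x n ^ (2 * 2 ^ m)) : Inv H)
      = (1 + Polynomial.X) ^ (2 * 2 ^ m) * (1 + Polynomial.X) ^ (2 * (i' + 1)) := by
    rw [map_mul, map_pow, hE, map_add, map_add, map_mul, map_pow, map_pow, res_v,
      zero_pow (by positivity), map_one, res_u, ← pow_mul, ← pow_mul, ← pow_succ',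
      one_add_X_pow_two_pow]
    ring
  have r2 : res ((1 + u + v) ^ 2 ^ m * (1 + u ^ 2 ^ m * genQ m n + v ^ 2 ^ m * genQ m n) : Inv H)
      = (1 + Polynomial.X) ^ (2 * 2 ^ m) * (1 + Polynomial.X) ^ (2 ^ (n + 2 + m)) := by
    rw [map_mul, map_pow, hE, map_add, map_add, map_mul, map_mul, map_pow, map_pow, res_v,
      zero_pow (by positivity), map_one, res_u, ← pow_mul, ← pow_mul, res_genQ,
      one_add_X_pow_two_pow, ← xdeg_succ_mul]
    ring
  have r3 : res ((1 + u + v) ^ 2 ^ m * (1 + v ^ 2 ^ m * x n ^ (2 * 2 ^ m)) * v ^ j : Inv H)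
      = (1 + Polynomial.X) ^ (2 * 2 ^ m) * (if i' + 1 = 2 ^ m then 1 else 0) := by
    rw [map_mul, map_mul, map_pow, hE, map_add, map_mul, map_pow _ v, map_pow _ v, res_v,
      zero_pow (by positivity), map_one, ← pow_mul]
    rcases Nat.eq_zero_or_pos j with rfl | hj0
    · rw [if_pos (by omega)]; ring
    · rw [if_neg (by omega), zero_pow hj0.ne']; ring
  rw [r2] at e1
  rw [r1, r3] at e2
  exact ⟨h, e1, e2⟩

section

variable {i m n : ℕ} {N M : ℕ}

/-- The ideal `(vⁱ⁺¹ xₙ^(2e), xₙ₊₁^e)` is not closed for `i = e`. -/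
theorem lt_of_closed_genQ (hH : c3 ∈ H) (hi : 0 < i) (him : i ≤ 2 ^ m)
    (hN : u ^ N ∈ Ideal.span {(genP i m n : Inv H), genQ m n})
    (hM : v ^ M ∈ Ideal.span {(genP i m n : Inv H), genQ m n})
    (hcl : invS (genQ m n : Inv H) ∈ Ideal.span {v * genP i m n, v * genQ m n, genQ m n}) :
    i < 2 ^ m := by
  by_contra hlt
  obtain ⟨h, e1, e2⟩ := exists_of_closed_genP_genQ hH hi him hN hM 0 1 (by simpa using hcl)
  rw [if_pos (by omega), map_one, map_one, map_zero, map_zero] at e2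
  have h1 : (Polynomial.X : Polynomial (ZMod 2)) ^ (xdeg (n + 1) * 2 ^ m) ∣ 1 :=
    X_pow_dvd_of_dvd_mul (n := 2 * 2 ^ m) (by convert e2 using 1; ring)
  rw [← pow_zero Polynomial.X] at h1
  have := X_pow_dvd_X_pow h1
  have := two_mul_le_xdeg_mul m n
  have := Nat.one_le_two_pow (n := m)
  omega

/-- No ideal `v(p, q) + (q + rp)` with `r` nonzero on the line is closed. -/
theorem not_closed_genQ_add (hH : c3 ∈ H) (hi : 0 < i) (him : i ≤ 2 ^ m)
    (hN : u ^ N ∈ Ideal.span {(genP i m n : Inv H), genQ m n})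
    (hM : v ^ M ∈ Ideal.span {(genP i m n : Inv H), genQ m n}) {r : Inv H} {s : ℕ}
    (hr : res r = Polynomial.X ^ s) (hs : s + 3 * i = 2 * 2 ^ m)
    (hcl : invS (genQ m n + r * genP i m n) ∈
      Ideal.span {v * genP i m n, v * genQ m n, genQ m n + r * genP i m n}) : False := by
  obtain ⟨h, e1, e2⟩ := exists_of_closed_genP_genQ hH hi him hN hM r 1
    (by simpa [add_comm] using hcl)
  have hL := two_mul_le_xdeg_mul m n
  have hL2 := xdeg_succ_mul m n
  set L := xdeg (n + 1) * 2 ^ m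
  rw [map_one, map_one, one_mul, mul_one] at e1
  rw [if_neg (by omega), res_invS_of_res hr, ← e1, hr, mul_zero, mul_zero, add_zero,
    one_add_X_pow_two_pow, ← hL2] at e2
  obtain ⟨d, hd⟩ := Nat.exists_eq_add_of_le (show s ≤ L by omega)
  have h1 : (Polynomial.X : Polynomial (ZMod 2)) ^ d ∣ (1 + Polynomial.X) ^ (2 * 2 ^ m)
      * ((1 + Polynomial.X) ^ (2 * 2 ^ m - i) - 1) := by
    have h2 : (Polynomial.X : Polynomial (ZMod 2)) ^ d ∣ Polynomial.X ^ (L + 2 * 2 ^ m) :=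
      pow_dvd_pow _ (by omega)
    rw [hd, pow_add] at e2
    have h3 : (Polynomial.X : Polynomial (ZMod 2)) ^ s * Polynomial.X ^ d ∣ Polynomial.X ^ s *
        ((1 + Polynomial.X) ^ s * ((1 + Polynomial.X) ^ (2 * 2 ^ m) * (1 + Polynomial.X) ^ (2 * i))
        - (1 + Polynomial.X) ^ (2 * 2 ^ m) * (1 + Polynomial.X ^ (s + d + 2 * 2 ^ m))) := by
      convert e2 using 1; ring
    have h4 := (mul_dvd_mul_iff_left (pow_ne_zero s Polynomial.X_ne_zero)).mp h3
    have h5 := dvd_add h4 (Dvd.dvd.mul_left h2 ((1 + Polynomial.X) ^ (2 * 2 ^ m)))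
    convert h5 using 1
    rw [show 2 * 2 ^ m - i = s + 2 * i by omega, hd]
    ring
  obtain ⟨j, hj1, hj2⟩ := exists_two_pow_dvd_of_X_pow_dvd (by omega) (X_pow_dvd_of_dvd_mul h1)
  have := two_pow_le_of_dvd_sub hi (by omega) hj1
  omega

/-- If an ideal `v(p, q) + (p + rq)` with `r` nonzero on the line is closed, then `i = e`. -/
theorem eq_of_closed_genP_add (hH : c3 ∈ H) (hi : 0 < i) (him : i ≤ 2 ^ m)
    (hN : u ^ N ∈ Ideal.span {(genP i m n : Inv H), genQ m n})
    (hM : v ^ M ∈ Ideal.span {(genP i m n : Inv H), genQ m n}) {r : Inv H} {s : ℕ}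
    (hr : res r = Polynomial.X ^ s) (hs : s + 2 * 2 ^ m = 3 * i)
    (hcl : invS (genP i m n + r * genQ m n) ∈
      Ideal.span {v * genP i m n, v * genQ m n, genP i m n + r * genQ m n}) : i = 2 ^ m := by
  by_contra hne
  obtain ⟨h, e1, e2⟩ := exists_of_closed_genP_genQ hH hi him hN hM 1 r (by simpa using hcl)
  have hL := two_mul_le_xdeg_mul m n
  have hL2 := xdeg_succ_mul m n
  set L := xdeg (n + 1) * 2 ^ m
  rw [res_invS_of_res hr, hr, mul_assoc, mul_comm] at e1
  have e3 := mul_right_cancel₀ (pow_ne_zero s Polynomial.X_ne_zero)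
    ((show _ = h * Polynomial.X ^ s from e1))
  rw [if_neg hne, map_one, map_one, ← e3, mul_zero, mul_zero, add_zero,
    one_add_X_pow_two_pow, ← hL2] at e2
  have h1 : (Polynomial.X : Polynomial (ZMod 2)) ^ L ∣ (1 + Polynomial.X) ^ (2 * 2 ^ m + s)
      * ((1 + Polynomial.X) ^ (2 * 2 ^ m - i) - 1) := by
    have h2 : (Polynomial.X : Polynomial (ZMod 2)) ^ L ∣ Polynomial.X ^ (L + 2 * 2 ^ m) :=
      pow_dvd_pow _ (by omega)
    have h5 := dvd_add e2 (Dvd.dvd.mul_left h2 ((1 + Polynomial.X) ^ (2 * 2 ^ m + s)))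
    convert h5 using 1
    have h6 : (1 + Polynomial.X : Polynomial (ZMod 2)) ^ (2 * i)
      = (1 + Polynomial.X) ^ s * (1 + Polynomial.X) ^ (2 * 2 ^ m - i) := by
      rw [← pow_add]; congr 1; omega
    rw [h6]
    ring
  obtain ⟨j, hj1, hj2⟩ := exists_two_pow_dvd_of_X_pow_dvd (by omega) (X_pow_dvd_of_dvd_mul h1)
  have := two_pow_le_of_dvd_sub hi (by omega) hj1
  omega

end

/-! ### Enlargements of the fibered ideals -/

theorem v_pow_mem_span_fibered (k l : ℕ) : (v : Inv H) ^ k ∈ Ideal.span {(v : Inv H) ^ k, u ^ l} :=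
  Ideal.subset_span (by simp)

theorem u_pow_mem_span_fibered (k l : ℕ) : (u : Inv H) ^ l ∈ Ideal.span {(v : Inv H) ^ k, u ^ l} :=
  Ideal.subset_span (by simp)

/-- The conditions of `exists_of_closed` for the ideals `(v^k, u^l)`. -/
theorem exists_of_closed_fibered (hH : c3 ∈ H) {k t o : ℕ} (ho : Odd o) (hk : 0 < k)
    (hkt : k ≤ 2 ^ t) (α β : Inv H)
    (hcl : invS (α * v ^ k + β * u ^ (2 ^ t * o)) ∈
      Ideal.span {v * v ^ k, v * u ^ (2 ^ t * o), α * v ^ k + β * u ^ (2 ^ t * o)}) :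
    ∃ h : Polynomial (ZMod 2),
      res (invS β) * (1 + Polynomial.X) ^ (2 * (2 ^ t * o)) = h * res β ∧
      Polynomial.X ^ (2 * (2 ^ t * o)) ∣ res (invS α) * (1 + Polynomial.X) ^ (2 * k)
        + res (invS β) * (if k = 2 ^ t then
            (Polynomial.X * (1 + Polynomial.X)) ^ (2 * 2 ^ t * (o - 1)) else 0) - h * res α := by
  obtain ⟨j, hj⟩ := Nat.exists_eq_add_of_le hkt
  have hodd : ((o : ℕ) : Inv H) = 1 := by
    obtain ⟨c, hc⟩ := ho
    rw [hc]; push_cast; linear_combination (c : Inv H) * inv_two_eq_zero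
  have h1 : 1 * invS ((v : Inv H) ^ k) = (1 + u + v) ^ k * v ^ k + v * 0 := by
    rw [invS_v_pow]; ring
  obtain ⟨y, hy⟩ := Polynomial.powAddExpansion (u ^ 2 ^ t * (1 + u ^ 2 ^ t) : Inv H) (v ^ 2 ^ t) o
  have h2 : 1 * invS ((u : Inv H) ^ (2 ^ t * o))
      = (v ^ j * ((u ^ 2 ^ t * (1 + u ^ 2 ^ t)) ^ (o - 1) + y * v ^ 2 ^ t)) * v ^ k
        + (1 + u ^ 2 ^ t) ^ o * u ^ (2 ^ t * o) + v * 0 := by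
    have hS : (u + v + u ^ 2 : Inv H) ^ 2 ^ t = u ^ 2 ^ t * (1 + u ^ 2 ^ t) + v ^ 2 ^ t := by
      rw [add_pow_char_pow, add_pow_char_pow]; ring
    have hv : (v : Inv H) ^ 2 ^ t = v ^ j * v ^ k := by rw [hj, ← pow_add, add_comm]
    rw [one_mul, map_pow, invS_u, pow_mul, hS, hy, hodd, mul_pow, pow_mul]
    linear_combination ((u ^ 2 ^ t * (1 + u ^ 2 ^ t)) ^ (o - 1) + y * v ^ 2 ^ t) * hv
  have hq : res ((u : Inv H) ^ (2 ^ t * o)) = Polynomial.X ^ (2 * (2 ^ t * o)) :=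
    (u_pow_properties _).2
  have hp : res ((v : Inv H) ^ k) = 0 := by rw [map_pow, res_v, zero_pow hk.ne']
  obtain ⟨h, e1, e2⟩ := exists_of_closed hH hp hq (u_pow_mem_span_fibered _ _)
    (v_pow_mem_span_fibered _ _) (Ideal.zero_mem _) (Ideal.zero_mem _) h1 h2 α β hcl
  have hE := res_one_add_u_add_v (H := H)
  have h1u : res (1 + u ^ 2 ^ t : Inv H) = (1 + Polynomial.X) ^ (2 * 2 ^ t) := by
    rw [map_add, map_one, map_pow, res_u, ← pow_mul, ← pow_succ', one_add_X_pow_two_pow]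
  have r1 : res ((1 + u + v : Inv H) ^ k) = (1 + Polynomial.X) ^ (2 * k) := by
    rw [map_pow, hE, pow_mul]
  have r2 : res ((1 + u ^ 2 ^ t : Inv H) ^ o) = (1 + Polynomial.X) ^ (2 * (2 ^ t * o)) := by
    rw [map_pow, h1u]; ring
  have r3 : res (v ^ j * ((u ^ 2 ^ t * (1 + u ^ 2 ^ t)) ^ (o - 1) + y * v ^ 2 ^ t) : Inv H)
      = if k = 2 ^ t then (Polynomial.X * (1 + Polynomial.X)) ^ (2 * 2 ^ t * (o - 1)) else 0 := by
    rcases Nat.eq_zero_or_pos j with rfl | hj0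
    · rw [if_pos (by omega), pow_zero, one_mul, map_add, map_pow, map_mul, h1u, map_mul, map_pow,
        map_pow, res_v, zero_pow (by positivity), mul_zero, add_zero, res_u, ← pow_mul, ← mul_pow,
        ← pow_mul]
    · rw [if_neg (by omega), map_mul, map_pow, res_v, zero_pow hj0.ne', zero_mul]
  rw [r2] at e1
  rw [r1, r3] at e2
  exact ⟨h, e1, e2⟩

theorem lt_of_closed_fibered (hH : c3 ∈ H) {k t o : ℕ} (ho : Odd o) (hk : 0 < k)
    (hkt : k ≤ 2 ^ t) (hcl : invS ((u : Inv H) ^ (2 ^ t * o)) ∈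
      Ideal.span {v * v ^ k, v * u ^ (2 ^ t * o), u ^ (2 ^ t * o)}) : k < 2 ^ t := by
  by_contra hlt
  obtain ⟨h, e1, e2⟩ := exists_of_closed_fibered hH ho hk hkt 0 1 (by simpa using hcl)
  rw [if_pos (by omega), map_one, map_one, map_zero, map_zero, mul_pow] at e2
  have h1 := X_pow_dvd_X_pow (X_pow_dvd_of_dvd_mul (n := 2 * 2 ^ t * (o - 1))
    (q := Polynomial.X ^ (2 * 2 ^ t * (o - 1))) (by convert e2 using 1; ring))
  obtain ⟨c, rfl⟩ := ho
  have := Nat.one_le_two_pow (n := t)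
  rw [Nat.add_sub_cancel] at h1
  nlinarith

/-- No ideal `v(p, q) + (q + rp)` with `p = v^k`, `q = u^l` and `res r` nonzero is closed. -/
theorem not_closed_fibered_add (hH : c3 ∈ H) {k t o : ℕ} (ho : Odd o) (hk : 0 < k)
    (hkt : k ≤ 2 ^ t) {r : Inv H} {s : ℕ} (hr : res r = Polynomial.X ^ s)
    (hs : s + 3 * k = 2 * (2 ^ t * o)) (hcl : invS (u ^ (2 ^ t * o) + r * v ^ k) ∈
      Ideal.span {v * v ^ k, v * u ^ (2 ^ t * o), u ^ (2 ^ t * o) + r * v ^ k}) : False := by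
  obtain ⟨h, e1, e2⟩ := exists_of_closed_fibered hH ho hk hkt r 1 (by simpa [add_comm] using hcl)
  rw [map_one, map_one, one_mul, mul_one] at e1
  rw [res_invS_of_res hr, ← e1, hr, map_one, map_one, one_mul, ← hs, pow_add _ s] at e2
  rcases eq_or_lt_of_le hkt with rfl | hlt
  · have ho' : 2 * 2 ^ t * (o - 1) = s + 2 ^ t := by
      obtain ⟨c, rfl⟩ := ho
      rw [Nat.add_sub_cancel]
      have : s + 3 * 2 ^ t = 2 * 2 ^ t * (2 * c) + 2 * 2 ^ t := by rw [hs]; ring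
      omega
    rw [if_pos rfl, ho', mul_pow Polynomial.X] at e2
    have h3 : (Polynomial.X : Polynomial (ZMod 2)) ^ s * Polynomial.X ^ (3 * 2 ^ t)
        ∣ Polynomial.X ^ s * ((1 + Polynomial.X) ^ (s + 2 ^ t) * Polynomial.X ^ (2 * 2 ^ t)) := by
      convert e2 using 1
      have h5 := one_add_X_pow_two_pow t
      have h6 : (1 + Polynomial.X : Polynomial (ZMod 2)) ^ (s + 3 * 2 ^ t)
        = (1 + Polynomial.X) ^ (s + 2 ^ t) * (1 + Polynomial.X ^ 2 ^ t) ^ 2 := by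
        rw [← h5]; ring
      have h7 : (1 + Polynomial.X : Polynomial (ZMod 2)) ^ s * (1 + Polynomial.X) ^ (2 * 2 ^ t)
        = (1 + Polynomial.X) ^ (s + 2 ^ t) * (1 + Polynomial.X ^ 2 ^ t) := by
        rw [← h5]; ring
      rw [h6, mul_assoc (Polynomial.X ^ s), h7]
      linear_combination Polynomial.X ^ s * (1 + Polynomial.X) ^ (s + 2 ^ t)
        * Polynomial.X ^ (2 * 2 ^ t) * poly_two_eq_zero
    have h4 := X_pow_dvd_X_pow (X_pow_dvd_of_dvd_mul
      ((mul_dvd_mul_iff_left (pow_ne_zero s Polynomial.X_ne_zero)).mp h3))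
    omega
  · rw [if_neg hlt.ne, add_zero] at e2
    have h3 : (Polynomial.X : Polynomial (ZMod 2)) ^ s * Polynomial.X ^ (3 * k)
        ∣ Polynomial.X ^ s * ((1 + Polynomial.X) ^ (s + 2 * k) * ((1 + Polynomial.X) ^ k - 1)) := by
      convert e2 using 1
      linear_combination -Polynomial.X ^ s * ((1 + Polynomial.X) ^ (s + 2 * k)
       - (1 + Polynomial.X) ^ (s + 3 * k)) * poly_two_eq_zero
    obtain ⟨j, hj1, hj2⟩ := exists_two_pow_dvd_of_X_pow_dvd hk (X_pow_dvd_of_dvd_mul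
      ((mul_dvd_mul_iff_left (pow_ne_zero s Polynomial.X_ne_zero)).mp h3))
    have := Nat.le_of_dvd hk hj1
    omega

/-! ### Descent along division by `v` -/

theorem coeff_one_res (hH : c3 ∈ H) (f : Inv H) : (res f).coeff 1 = 0 := by
  rw [eq_sum_comp f, map_sum, Polynomial.finsetSum_coeff]
  refine Finset.sum_eq_zero fun i _ => ?_
  by_cases hi : i = 1
  · subst hi
    rw [eq_zero_of_isHomogeneous_one hH (comp_isHomogeneous 1 f), map_zero, Polynomial.coeff_zero]
  · rcases res_isHomogeneous (comp_isHomogeneous i f) with h | h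
    · rw [h, Polynomial.coeff_zero]
    · rw [h, Polynomial.coeff_X_pow, if_neg (Ne.symm hi)]

/-- The second generator of a closed ideal `(v f, g)` has even degree, because there is no
invariant of degree one. -/
theorem even_of_closed (hH : c3 ∈ H) {f g : Inv H} {L : ℕ} (rg : res g = Polynomial.X ^ L)
    (hcl : invS g ∈ Ideal.span {v * f, g}) : Even L := by
  obtain ⟨a, b, hab⟩ := Ideal.mem_span_pair.mp hcl
  have h := congrArg res hab
  rw [map_add, map_mul, map_mul, map_mul, res_v, zero_mul, mul_zero, zero_add,
    res_invS_of_res rg, rg, mul_comm] at h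
  have h1 := mul_left_cancel₀ (pow_ne_zero L Polynomial.X_ne_zero) h
  have h2 := coeff_one_res hH b
  rw [h1, Polynomial.coeff_one_add_X_pow, Nat.choose_one_right] at h2
  exact (ZMod.natCast_eq_zero_iff_even).mp h2

theorem coeff_zero_of_isHomogeneous {f : P} {n : ℕ} (hn : 0 < n) (hf : f.IsHomogeneous n) :
    constantCoeff f = 0 := by
  by_contra h
  have := hf (d := 0) h
  simp at this
  omega

theorem eq_one_of_constantCoeff_ne_zero {f : Inv H} {n : ℕ} (hf : (f : P).IsHomogeneous n)
    (h : constantCoeff (f : P) ≠ 0) : n = 0 ∧ f = 1 := by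
  obtain rfl : n = 0 := by
    by_contra hn
    exact h (coeff_zero_of_isHomogeneous (Nat.pos_of_ne_zero hn) hf)
  refine ⟨rfl, (eq_one_of_isHomogeneous_zero hf).resolve_left ?_⟩
  rintro rfl
  simp at h

theorem one_notMem_span {f g : Inv H} {m n : ℕ} (hm : 0 < m) (hn : 0 < n)
    (hf : (f : P).IsHomogeneous m) (hg : (g : P).IsHomogeneous n) : 1 ∉ Ideal.span {f, g} := by
  intro h
  obtain ⟨a, b, hab⟩ := Ideal.mem_span_pair.mp h
  have := congrArg (fun f : Inv H => constantCoeff (f : P)) hab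
  simp [coeff_zero_of_isHomogeneous hm hf, coeff_zero_of_isHomogeneous hn hg] at this

theorem isHomogeneous_of_v_mul {f : Inv H} {n : ℕ} (h : ((v * f : Inv H) : P).IsHomogeneous n)
    (hf : f ≠ 0) : ∃ k, n = k + 3 ∧ (f : P).IsHomogeneous k := by
  rw [mul_comm] at h
  rcases lt_or_ge n 3 with hn | hn
  · have := comp_mul_of_lt v_isHomogeneous hn f
    rw [comp_self h] at this
    exact absurd ((mul_eq_zero.mp this).resolve_right v_ne_zero) hf
  · obtain ⟨k, rfl⟩ := Nat.exists_eq_add_of_le' hn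
    exact ⟨k, rfl, isHomogeneous_of_mul_vP h⟩

theorem coe_mem_span {f g h : Inv H} (hh : h ∈ Ideal.span {f, g}) :
    (h : P) ∈ Ideal.span {(f : P), (g : P)} := by
  obtain ⟨a, b, rfl⟩ := Ideal.mem_span_pair.mp hh
  exact Ideal.mem_span_pair.mpr ⟨a, b, rfl⟩

/-- A closed parameter ideal has a generator that is divisible by `v`. -/
theorem exists_good_generators (hH : c3 ∈ H) (hQ : HasQuotients H) {f g : Inv H} {m n N M : ℕ}
    (hm : 0 < m) (hn : 0 < n) (hf : (f : P).IsHomogeneous m) (hg : (g : P).IsHomogeneous n)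
    (hN : u ^ N ∈ Ideal.span {f, g}) (hM : v ^ M ∈ Ideal.span {f, g})
    (hcl : ∀ h ∈ Ideal.span {f, g}, invS h ∈ Ideal.span {f, g}) :
    ∃ (f' g' : Inv H) (d L : ℕ), 0 < L ∧ ((v * f' : Inv H) : P).IsHomogeneous d ∧
      (g' : P).IsHomogeneous L ∧ res g' = Polynomial.X ^ L ∧
      Ideal.span {f, g} = Ideal.span {v * f', g'} := by
  wlog hmn : m ≤ n generalizing f g m n
  · rw [Set.pair_comm] at hN hM hcl ⊢
    exact this hn hm hg hf hN hM hcl (by omega)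
  rcases res_isHomogeneous hf with rf | rf
  · obtain ⟨f', rfl⟩ := (v_dvd_iff hH).mpr rf
    rcases res_isHomogeneous hg with rg | rg
    · obtain ⟨a, b, hab⟩ := Ideal.mem_span_pair.mp hN
      have := congrArg res hab
      rw [map_add, map_mul _ a (v * f'), map_mul _ b g, rf, rg, mul_zero, mul_zero, add_zero,
        map_pow, res_u] at this
      exact absurd this.symm (pow_ne_zero _ (pow_ne_zero _ Polynomial.X_ne_zero))
    · exact ⟨f', g, m, n, hn, hf, hg, rg, rfl⟩
  · rcases res_isHomogeneous hg with rg | rg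
    · obtain ⟨g', rfl⟩ := (v_dvd_iff hH).mpr rg
      exact ⟨g', f, n, m, hm, hg, hf, rf, by rw [Set.pair_comm]⟩
    · by_cases hnm : n = m + 1
      · subst hnm
        exact (not_closed_of_consecutive hm hf hg (f.2 c3 hH) (g.2 c3 hH) rf rg
          (coe_mem_span (hcl f (Ideal.subset_span (by simp))))
          (coe_mem_span (hcl g (Ideal.subset_span (by simp))))
          (coe_mem_span hN) (coe_mem_span hM)).elim
      · obtain ⟨z, hz, rz⟩ := hQ f g m n hf hg rf rg hmn hnm
        have h0 : res (g - z * f) = 0 := by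
          rw [map_sub, map_mul, rz, rf, rg, ← pow_add, Nat.sub_add_cancel hmn, sub_self]
        obtain ⟨g', hg'⟩ := (v_dvd_iff hH).mpr h0
        refine ⟨g', f, n, m, hm, ?_, hf, rf, ?_⟩
        · rw [← hg']
          refine hg.sub ?_
          have := hz.mul hf
          rwa [Nat.sub_add_cancel hmn] at this
        · rw [← hg', Set.pair_comm f g]
          refine (Ideal.span_pair_add_mul_right (x := g) (y := f) (z := -z)).symm.trans ?_
          congr 2; ring

/-- The ideal `(f, g)` is the colon ideal `(vf, g) : v`. -/
theorem mem_of_v_mul_mem (hH : c3 ∈ H) {f g h : Inv H} {L : ℕ} (rg : res g = Polynomial.X ^ L)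
    (hh : v * h ∈ Ideal.span {v * f, g}) : h ∈ Ideal.span {f, g} := by
  obtain ⟨a, b, hab⟩ := Ideal.mem_span_pair.mp hh
  have h1 := congrArg res hab
  rw [map_add, map_mul, map_mul, map_mul, map_mul, res_v, zero_mul, mul_zero, zero_mul, zero_add,
    rg] at h1
  obtain ⟨b', rfl⟩ := (v_dvd_iff hH).mpr
    ((mul_eq_zero.mp h1).resolve_right (pow_ne_zero _ Polynomial.X_ne_zero))
  refine Ideal.mem_span_pair.mpr ⟨a, b', mul_left_cancel₀ v_ne_zero ?_⟩
  rw [← hab]; ring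

theorem span_v_mul_le (f g : Inv H) : Ideal.span {v * f, g} ≤ Ideal.span {f, g} := by
  rw [Ideal.span_le, Set.pair_subset_iff]
  exact ⟨Ideal.mul_mem_left _ _ (Ideal.subset_span (by simp)), Ideal.subset_span (by simp)⟩

/-- Closedness passes from `(v f, g)` to the colon ideal `(f, g)`. -/
theorem closed_of_closed_v_mul (hH : c3 ∈ H) {f g : Inv H} {L N M : ℕ}
    (rg : res g = Polynomial.X ^ L) (hN : u ^ N ∈ Ideal.span {v * f, g})
    (hM : v ^ M ∈ Ideal.span {v * f, g})
    (hcl : ∀ h ∈ Ideal.span {v * f, g}, invS h ∈ Ideal.span {v * f, g}) :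
    ∀ h ∈ Ideal.span {f, g}, invS h ∈ Ideal.span {f, g} := by
  intro h hh
  apply mem_of_v_mul_mem hH rg
  apply mem_of_one_add_mul_mem hN hM
  rw [← mul_assoc, ← invS_v, ← map_mul]
  apply hcl
  obtain ⟨a, b, rfl⟩ := Ideal.mem_span_pair.mp hh
  exact Ideal.mem_span_pair.mpr ⟨a, v * b, by ring⟩

theorem span_v_mul_eq_of_span_eq {f g p q : Inv H} (h : Ideal.span {f, g} = Ideal.span {p, q}) :
    Ideal.span {v * f, g} = Ideal.span {v * p, v * q, g} := by
  ext z
  rw [mem_span_triple, ← h]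
  constructor
  · intro hz
    obtain ⟨a, b, rfl⟩ := Ideal.mem_span_pair.mp hz
    exact ⟨a * f, Ideal.mul_mem_left _ _ (Ideal.subset_span (by simp)), b, by ring⟩
  · rintro ⟨y, hy, c, rfl⟩
    obtain ⟨a, b, rfl⟩ := Ideal.mem_span_pair.mp hy
    exact Ideal.mem_span_pair.mpr ⟨a, v * b + c, by ring⟩

/-- A generator of an ideal generated by two elements of positive degree that contains powers of
`u` and `v` is a combination of any other two generators in which one coefficient is a unit. -/
theorem constantCoeff_ne_zero_or (hH : c3 ∈ H) {f g p q α β : Inv H} {dp dq N M : ℕ}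
    (hdp : 0 < dp) (hdq : 0 < dq) (hp : (p : P).IsHomogeneous dp) (hq : (q : P).IsHomogeneous dq)
    (hN : u ^ N ∈ Ideal.span {p, q}) (hM : v ^ M ∈ Ideal.span {p, q})
    (h : Ideal.span {f, g} = Ideal.span {p, q}) (hg : g = α * p + β * q) :
    constantCoeff (α : P) ≠ 0 ∨ constantCoeff (β : P) ≠ 0 := by
  by_contra! hc
  obtain ⟨hα, hβ⟩ := hc
  obtain ⟨γ, δ, hf⟩ := Ideal.mem_span_pair.mp
    (h ▸ Ideal.subset_span (by simp) : f ∈ Ideal.span {p, q})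
  obtain ⟨a, b, hab⟩ := Ideal.mem_span_pair.mp
    (h ▸ Ideal.subset_span (by simp) : p ∈ Ideal.span {f, g})
  obtain ⟨c, d, hcd⟩ := Ideal.mem_span_pair.mp
    (h ▸ Ideal.subset_span (by simp) : q ∈ Ideal.span {f, g})
  have hN' := hN
  have hM' := hM
  rw [Set.pair_comm] at hN' hM'
  have e1 : (1 - a * γ - b * α) * p = (a * δ + b * β) * q := by
    rw [← hf, hg] at hab
    linear_combination -hab
  have e2 : (1 - c * δ - d * β) * q = (c * γ + d * α) * p := by
    rw [← hf, hg] at hcd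
    linear_combination -hcd
  have hp0 := coeff_zero_of_isHomogeneous hdp hp
  have hq0 := coeff_zero_of_isHomogeneous hdq hq
  obtain ⟨z₁, h1⟩ := dvd_of_pow_mem_span_inv hH hN hM e1
  obtain ⟨z₂, h2⟩ := dvd_of_pow_mem_span_inv hH hN' hM' e2
  obtain ⟨z₃, h3⟩ := dvd_of_pow_mem_span_inv hH hN' hM' e1.symm
  -- The constant coefficients of `aγ` and `cδ` are `1`, but that of `aδ` is `0`.
  have k1 := congrArg (fun f : Inv H => constantCoeff (f : P)) h1
  have k2 := congrArg (fun f : Inv H => constantCoeff (f : P)) h2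
  have k3 := congrArg (fun f : Inv H => constantCoeff (f : P)) h3
  push_cast at k1 k2 k3
  simp only [map_sub, map_add, map_mul, map_one, hα, hβ, hp0, hq0, mul_zero, zero_mul, sub_zero,
    add_zero, sub_eq_zero] at k1 k2 k3
  rcases mul_eq_zero.mp k3 with h0 | h0
  · rw [h0, zero_mul] at k1; exact one_ne_zero k1
  · rw [h0, mul_zero] at k2; exact one_ne_zero k2

theorem span_triple_congr {p q g g' c : Inv H} (h : g' = g + v * (c * p)) :
    Ideal.span {v * p, v * q, g'} = Ideal.span {v * p, v * q, g} := by
  have hp : ∀ z : Inv H, z * p ∈ Ideal.span {p, q} := fun z =>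
    Ideal.mul_mem_left _ _ (Ideal.subset_span (by simp))
  ext z
  rw [mem_span_triple, mem_span_triple]
  constructor
  · rintro ⟨y, hy, d, rfl⟩
    exact ⟨y + d * c * p, Ideal.add_mem _ hy (hp _), d, by rw [h]; ring⟩
  · rintro ⟨y, hy, d, rfl⟩
    exact ⟨y - d * c * p, Ideal.sub_mem _ hy (hp _), d, by rw [h]; ring⟩

/-- The ideals `(v f, g)` with prescribed colon ideal `(f, g) = (p, q)`. -/
theorem span_v_mul_cases (hH : c3 ∈ H) {f g p q : Inv H} {dp dq L N M : ℕ}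
    (hdp : 0 < dp) (hdq : 0 < dq) (hp : (p : P).IsHomogeneous dp) (hq : (q : P).IsHomogeneous dq)
    (rp : res p = 0) (rq : res q = Polynomial.X ^ dq)
    (hN : u ^ N ∈ Ideal.span {p, q}) (hM : v ^ M ∈ Ideal.span {p, q})
    (hg : (g : P).IsHomogeneous L) (rg : res g = Polynomial.X ^ L)
    (h : Ideal.span {f, g} = Ideal.span {p, q}) :
    Ideal.span {v * f, g} = Ideal.span {v * p, v * q, q} ∨
    (∃ r : Inv H, dp ≤ dq ∧ (r : P).IsHomogeneous (dq - dp) ∧ res r = Polynomial.X ^ (dq - dp) ∧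
      Ideal.span {v * f, g} = Ideal.span {v * p, v * q, q + r * p}) ∨
    (∃ r : Inv H, dq ≤ dp ∧ (r : P).IsHomogeneous (dp - dq) ∧ res r = Polynomial.X ^ (dp - dq) ∧
      Ideal.span {v * f, g} = Ideal.span {v * p, v * q, p + r * q}) := by
  rw [span_v_mul_eq_of_span_eq h]
  obtain ⟨α, β, hαβ, hα, hβ, hα0, hβ0⟩ := exists_homogeneous_coeffs hp hq hg
    (h ▸ Ideal.subset_span (by simp) : g ∈ Ideal.span {p, q})
  rcases constantCoeff_ne_zero_or hH hdp hdq hp hq hN hM h hαβ with h0 | h0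
  · obtain ⟨h1, rfl⟩ := eq_one_of_constantCoeff_ne_zero hα h0
    have hL : dp ≤ L := not_lt.mp fun h => one_ne_zero (hα0 h)
    obtain rfl : L = dp := by omega
    have hr := congrArg res hαβ
    rw [map_add, map_mul, map_mul, rp, mul_zero, zero_add, rg, rq] at hr
    have hβ' : β ≠ 0 := by
      rintro rfl
      rw [map_zero, zero_mul] at hr
      exact pow_ne_zero _ Polynomial.X_ne_zero hr
    have hle : dq ≤ L := not_lt.mp fun h => hβ' (hβ0 h)
    refine Or.inr (Or.inr ⟨β, hle, hβ, ?_, by rw [hαβ, one_mul]⟩)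
    refine (res_isHomogeneous hβ).resolve_left fun h => ?_
    rw [h, zero_mul] at hr
    exact pow_ne_zero _ Polynomial.X_ne_zero hr
  · obtain ⟨h1, rfl⟩ := eq_one_of_constantCoeff_ne_zero hβ h0
    have hL : dq ≤ L := not_lt.mp fun h => one_ne_zero (hβ0 h)
    obtain rfl : L = dq := by omega
    rcases res_isHomogeneous hα with h2 | h2
    · obtain ⟨α', rfl⟩ := (v_dvd_iff hH).mpr h2
      left
      exact span_triple_congr (c := α') (by rw [hαβ]; ring)
    · have hα' : α ≠ 0 := by
        rintro rfl
        rw [map_zero] at h2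
        exact pow_ne_zero _ Polynomial.X_ne_zero h2.symm
      exact Or.inr (Or.inl ⟨α, not_lt.mp fun h => hα' (hα0 h), hα, h2,
        by rw [hαβ, one_mul, add_comm]⟩)

/-! ### Classification -/

/-- The ideals that occur in the classification: `(v^k, u^l)` with `l = 2^t o`, `o` odd and
`1 ≤ k ≤ 2^t`, or `(vⁱ xₙ^(2e), xₙ₊₁^e)` with `e = 2^m` and `1 ≤ i ≤ e`. The two families overlap
in the ideals with `n = 0` and `o = 1`. -/
def IsListed (J : Ideal (Inv H)) : Prop :=
  (∃ k t o : ℕ, Odd o ∧ 0 < k ∧ k ≤ 2 ^ t ∧ J = Ideal.span {v ^ k, u ^ (2 ^ t * o)}) ∨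
  ∃ i m n : ℕ, 0 < i ∧ i ≤ 2 ^ m ∧ J = Ideal.span {genP i m n, genQ m n}

theorem span_v_mul_triple_eq_pair (p q g : Inv H) (hq : v * q ∈ Ideal.span {v * p, g}) :
    Ideal.span {v * p, v * q, g} = Ideal.span {v * p, g} := by
  apply le_antisymm
  · rw [Ideal.span_le]
    rintro z (rfl | rfl | rfl)
    · exact Ideal.subset_span (by simp)
    · exact hq
    · exact Ideal.subset_span (by simp)
  · apply Ideal.span_mono
    intro z hz
    rcases hz with rfl | rfl <;> simp

theorem v_mul_genP (i m n : ℕ) : (v * genP i m n : Inv H) = genP (i + 1) m n := by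
  rw [genP, genP]; ring

/-- For `i = e = 2^(m+1)`, the ideal `v(p, q) + (p + rq)` is the first one of the next series. -/
theorem span_genP_add_eq (hH : c3 ∈ H) {m n : ℕ} {r : Inv H}
    (hr : res r = Polynomial.X ^ 2 ^ (m + 1)) :
    Ideal.span {v * genP (2 ^ (m + 1)) (m + 1) n, v * genQ (m + 1) n,
      genP (2 ^ (m + 1)) (m + 1) n + r * genQ (m + 1) n}
    = Ideal.span {(genP 1 m (n + 1) : Inv H), genQ m (n + 1)} := by
  have h0 : res (r - u ^ 2 ^ m) = 0 := by
    rw [map_sub, map_pow, res_u, hr, ← pow_mul, ← pow_succ', sub_self]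
  obtain ⟨r', hr'⟩ := (v_dvd_iff hH).mpr h0
  have hP : (genP 1 m (n + 1) : Inv H) = v * genQ (m + 1) n := by
    rw [genP, genQ, pow_one, ← pow_succ']
  have hQ : (genQ m (n + 1) : Inv H)
      = genP (2 ^ (m + 1)) (m + 1) n + u ^ 2 ^ m * genQ (m + 1) n := by
    rw [genQ_succ, genP_zero]
  have e1 : v * genP (2 ^ (m + 1)) (m + 1) n
      = v * genQ m (n + 1) - u ^ 2 ^ m * (genP 1 m (n + 1) : Inv H) := by
    rw [hQ, hP]; ring
  have e2 : genP (2 ^ (m + 1)) (m + 1) n + r * genQ (m + 1) n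
      = genQ m (n + 1) + r' * (genP 1 m (n + 1) : Inv H) := by
    rw [hQ, hP]; linear_combination genQ (m + 1) n * hr'
  rw [e1, e2, ← hP]
  generalize (genP 1 m (n + 1) : Inv H) = p
  generalize (genQ m (n + 1) : Inv H) = q
  have hp : p ∈ Ideal.span {v * q - u ^ 2 ^ m * p, p, q + r' * p} := Ideal.subset_span (by simp)
  apply le_antisymm
  · rw [Ideal.span_le]
    rintro z (rfl | rfl | rfl)
    · exact Ideal.mem_span_pair.mpr ⟨-u ^ 2 ^ m, v, by ring⟩
    · exact Ideal.subset_span (by simp)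
    · exact Ideal.mem_span_pair.mpr ⟨r', 1, by ring⟩
  · rw [Ideal.span_le, Set.pair_subset_iff]
    refine ⟨hp, ?_⟩
    have : q + r' * p - r' * p ∈ Ideal.span {v * q - u ^ 2 ^ m * p, p, q + r' * p} :=
      Ideal.sub_mem _ (Ideal.subset_span (by simp)) (Ideal.mul_mem_left _ _ hp)
    simpa using this

/-- The inductive step when the colon ideal by `v` is `(vⁱ xₙ^(2e), xₙ₊₁^e)`. -/
theorem isListed_step_gen (hH : c3 ∈ H) {f g : Inv H} {L i m n N M : ℕ}
    (hi : 0 < i) (him : i ≤ 2 ^ m)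
    (hN : u ^ N ∈ Ideal.span {(genP i m n : Inv H), genQ m n})
    (hM : v ^ M ∈ Ideal.span {(genP i m n : Inv H), genQ m n})
    (hg : (g : P).IsHomogeneous L) (rg : res g = Polynomial.X ^ L)
    (h : Ideal.span {f, g} = Ideal.span {genP i m n, genQ m n})
    (hcl : ∀ h ∈ Ideal.span {v * f, g}, invS h ∈ Ideal.span {v * f, g}) :
    IsListed (Ideal.span {v * f, g}) := by
  have hdp : 0 < 3 * i + xdeg n * (2 * 2 ^ m) := by omega
  have hdeg := xdeg_succ n
  have hdq : 0 < xdeg (n + 1) * 2 ^ m := Nat.mul_pos (by omega) (by positivity)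
  have hdd : xdeg (n + 1) * 2 ^ m = 2 * 2 ^ m + xdeg n * (2 * 2 ^ m) := by rw [hdeg]; ring
  rcases span_v_mul_cases hH hdp hdq (genP_isHomogeneous i m n) (genQ_isHomogeneous m n)
    (res_genP hi) (res_genQ m n) hN hM hg rg h with h1 | ⟨r, hle, -, rr, h1⟩ | ⟨r, hle, hr, rr, h1⟩
  · rw [h1] at hcl ⊢
    have hlt := lt_of_closed_genQ hH hi him hN hM (hcl _ (Ideal.subset_span (by simp)))
    refine Or.inr ⟨i + 1, m, n, by omega, hlt, ?_⟩
    rw [span_v_mul_triple_eq_pair _ _ _ (Ideal.mul_mem_left _ _ (Ideal.subset_span (by simp))),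
      v_mul_genP]
  · rw [h1] at hcl
    exact (not_closed_genQ_add hH hi him hN hM rr (by omega)
      (hcl _ (Ideal.subset_span (by simp)))).elim
  · rw [h1] at hcl ⊢
    obtain rfl := eq_of_closed_genP_add hH hi him hN hM rr (by omega)
      (hcl _ (Ideal.subset_span (by simp)))
    rw [show 3 * 2 ^ m + xdeg n * (2 * 2 ^ m) - xdeg (n + 1) * 2 ^ m = 2 ^ m by omega] at hr rr
    -- Here `r` has degree `e`, and `e ≠ 1` because there is no invariant of degree one.
    rcases m with _ | m
    · rw [eq_zero_of_isHomogeneous_one hH hr, map_zero] at rr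
      exact absurd rr.symm (pow_ne_zero _ Polynomial.X_ne_zero)
    · exact Or.inr ⟨1, m, n + 1, one_pos, Nat.one_le_two_pow, span_genP_add_eq hH rr⟩

/-- The inductive step when the colon ideal by `v` is `(v^k, u^l)` and `l` is not a power of two. -/
theorem isListed_step_fibered (hH : c3 ∈ H) {f g : Inv H} {L k t o : ℕ}
    (ho : Odd o) (ho1 : o ≠ 1) (hk : 0 < k) (hkt : k ≤ 2 ^ t)
    (hg : (g : P).IsHomogeneous L) (rg : res g = Polynomial.X ^ L)
    (h : Ideal.span {f, g} = Ideal.span {v ^ k, u ^ (2 ^ t * o)})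
    (hcl : ∀ h ∈ Ideal.span {v * f, g}, invS h ∈ Ideal.span {v * f, g}) :
    IsListed (Ideal.span {v * f, g}) := by
  have ho3 : 3 ≤ o := by obtain ⟨c, rfl⟩ := ho; omega
  have hlt : 3 * 2 ^ t ≤ 2 ^ t * o := by rw [mul_comm]; exact Nat.mul_le_mul_left _ ho3
  rcases span_v_mul_cases hH (by omega) (by omega) (v_isHomogeneous.pow k)
    (u_pow_properties _).1 (by rw [map_pow, res_v, zero_pow hk.ne']) (u_pow_properties _).2
    (u_pow_mem_span_fibered _ _) (v_pow_mem_span_fibered _ _) hg rg h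
    with h1 | ⟨r, hle, -, rr, h1⟩ | ⟨r, hle, hr, rr, h1⟩
  · rw [h1] at hcl ⊢
    have hlt := lt_of_closed_fibered hH ho hk hkt (hcl _ (Ideal.subset_span (by simp)))
    refine Or.inl ⟨k + 1, t, o, ho, by omega, hlt, ?_⟩
    rw [span_v_mul_triple_eq_pair _ _ _ (Ideal.mul_mem_left _ _ (Ideal.subset_span (by simp))),
      ← pow_succ']
  · rw [h1] at hcl
    exact (not_closed_fibered_add hH ho hk hkt rr (by omega)
      (hcl _ (Ideal.subset_span (by simp)))).elim
  · omega

/-- The ideals of the classification whose colon ideal by `v` is the unit ideal. -/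
theorem isListed_span_v (hH : c3 ∈ H) {g : Inv H} {L : ℕ} (hL : 0 < L)
    (rg : res g = Polynomial.X ^ L) (hcl : invS g ∈ Ideal.span {v * 1, g}) :
    IsListed (Ideal.span {v * 1, g}) := by
  obtain ⟨l, rfl⟩ := even_of_closed hH rg hcl
  obtain ⟨t, o, ho, rfl⟩ := Nat.exists_eq_two_pow_mul_odd (show l ≠ 0 by omega)
  refine Or.inl ⟨1, t, o, ho, one_pos, Nat.one_le_two_pow, ?_⟩
  have h0 : res (g - u ^ (2 ^ t * o)) = 0 := by
    rw [map_sub, map_pow, res_u, rg, ← pow_mul, ← two_mul, sub_self]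
  obtain ⟨y, hy⟩ := (v_dvd_iff hH).mpr h0
  rw [mul_one, pow_one, ← Ideal.span_pair_add_mul_left (x := v) (y := u ^ (2 ^ t * o)) y]
  congr 2
  rw [Set.singleton_eq_singleton_iff]
  linear_combination hy

/-- Every closed parameter ideal is on the list, by induction on a power of `v` that it contains. -/
theorem isListed_of_closed (hH : c3 ∈ H) (hQ : HasQuotients H) {N : ℕ} (M : ℕ) :
    ∀ (f g : Inv H) (m n : ℕ), 0 < m → 0 < n → (f : P).IsHomogeneous m → (g : P).IsHomogeneous n →
      u ^ N ∈ Ideal.span {f, g} → v ^ M ∈ Ideal.span {f, g} →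
      (∀ h ∈ Ideal.span {f, g}, invS h ∈ Ideal.span {f, g}) → IsListed (Ideal.span {f, g}) := by
  induction M with
  | zero =>
    intro f g m n hm hn hf hg _ hM _
    exact absurd (by simpa using hM) (one_notMem_span hm hn hf hg)
  | succ M ih =>
    intro f₀ g₀ m n hm hn hf₀ hg₀ hN hM hcl
    obtain ⟨f, g, d, L, hL, hf, hg, rg, hfg⟩ :=
      exists_good_generators hH hQ hm hn hf₀ hg₀ hN hM hcl
    have h1 : (1 : Inv H) ∉ Ideal.span {v * f, g} := hfg ▸ one_notMem_span hm hn hf₀ hg₀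
    rw [hfg] at hN hM hcl ⊢
    clear hfg
    -- A single generator cannot have powers of both `u` and `v` among its multiples.
    have hf0 : f ≠ 0 := by
      rintro rfl
      obtain ⟨c, hc⟩ := dvd_of_pow_mem_span_inv hH hN hM (α := 1) (β := 0) (by simp)
      exact h1 (Ideal.mem_span_pair.mpr ⟨0, c, by rw [hc]; ring⟩)
    obtain ⟨k, rfl, hk⟩ := isHomogeneous_of_v_mul hf hf0
    rcases Nat.eq_zero_or_pos k with rfl | hk0
    · obtain rfl := (eq_one_of_isHomogeneous_zero hk).resolve_left hf0
      exact isListed_span_v hH hL rg (hcl _ (Ideal.subset_span (by simp)))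
    · have hN' := span_v_mul_le f g hN
      have hM' : v ^ M ∈ Ideal.span {f, g} := mem_of_v_mul_mem hH rg (by rwa [← pow_succ'])
      have hcl' := closed_of_closed_v_mul hH rg hN hM hcl
      rcases ih f g k L hk0 hL hk hg hN' hM' hcl' with ⟨k, t, o, ho, hk, hkt, h⟩ |
        ⟨i, m, n, hi, him, h⟩
      · -- For `o = 1` the fibered ideal is the case `n = 0` of the second family.
        by_cases ho1 : o = 1
        · subst ho1
          have h2 : Ideal.span {f, g} = Ideal.span {genP k t 0, genQ t 0} := by
            rw [h, genP, genQ, x_zero, one_pow, mul_one, mul_one]; rfl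
          rw [h2] at hN' hM'
          exact isListed_step_gen hH hk hkt hN' hM' hg rg h2 hcl
        · exact isListed_step_fibered hH ho ho1 hk hkt hg rg h hcl
      · rw [h] at hN' hM'
        exact isListed_step_gen hH hi him hN' hM' hg rg h hcl

/-! ### Parameter ideals -/

theorem comp_mem_span {f g h : Inv H} {m n : ℕ} (hf : (f : P).IsHomogeneous m)
    (hg : (g : P).IsHomogeneous n) (hh : h ∈ Ideal.span {f, g}) (d : ℕ) :
    comp d h ∈ Ideal.span {f, g} := by
  obtain ⟨a, b, rfl⟩ := Ideal.mem_span_pair.mp hh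
  obtain ⟨α, h1, -⟩ := exists_comp_mul hf d a
  obtain ⟨β, h2, -⟩ := exists_comp_mul hg d b
  rw [comp_add, h1, h2]
  exact Ideal.mem_span_pair.mpr ⟨α, β, rfl⟩

/-- A quotient that is finite over `𝔽₂` is a finite set, so two powers of `y` become equal in it;
their difference lies in the ideal, hence so do its homogeneous components. -/
theorem exists_pow_mem_of_finite {f g y : Inv H} {m n d : ℕ} (hf : (f : P).IsHomogeneous m)
    (hg : (g : P).IsHomogeneous n) (hd : 0 < d) (hy : (y : P).IsHomogeneous d)
    (hfin : Module.Finite (ZMod 2) (Inv H ⧸ Ideal.span {f, g})) :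
    ∃ N, y ^ N ∈ Ideal.span {f, g} := by
  have : Finite (Inv H ⧸ Ideal.span {f, g}) := Module.finite_of_finite (ZMod 2)
  obtain ⟨i, j, hij, h⟩ := Finite.exists_ne_map_eq_of_infinite
    fun i : ℕ => Ideal.Quotient.mk (Ideal.span {f, g}) (y ^ i)
  have h1 := comp_mem_span hf hg (Ideal.Quotient.eq.mp h) (d * i)
  have hne : d * i ≠ d * j := fun h => hij (Nat.eq_of_mul_eq_mul_left hd h)
  have hp : ∀ k, ((y ^ k : Inv H) : P).IsHomogeneous (d * k) := fun k => hy.pow k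
  rw [CharTwo.sub_eq_add, comp_add, comp_self (hp i), comp_of_ne (hp j) hne, add_zero] at h1
  exact ⟨i, h1⟩

theorem exists_generators {J : Ideal (Inv H)} (hJ : IsParameterIdeal J) :
    ∃ (f g : Inv H) (m n N M : ℕ), 0 < m ∧ 0 < n ∧ (f : P).IsHomogeneous m ∧
      (g : P).IsHomogeneous n ∧ J = Ideal.span {f, g} ∧ u ^ N ∈ J ∧ v ^ M ∈ J := by
  obtain ⟨d, t, hd, ht, hspan, hfin⟩ := hJ
  rw [ringKrullDim_inv] at hd
  obtain rfl : 2 = d := by exact_mod_cast hd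
  obtain ⟨m, hm, hf⟩ := ht 0
  obtain ⟨n, hn, hg⟩ := ht 1
  have h : J = Ideal.span {t 0, t 1} := by
    rw [hspan]
    congr 1
    ext z
    simp [Fin.exists_fin_two, eq_comm]
  rw [h] at hfin
  obtain ⟨N, hN⟩ := exists_pow_mem_of_finite (y := u) hf hg two_pos uP_isHomogeneous hfin
  obtain ⟨M, hM⟩ := exists_pow_mem_of_finite (y := v) hf hg three_pos v_isHomogeneous hfin
  exact ⟨t 0, t 1, m, n, N, M, hm, hn, hf, hg, h, h ▸ hN, h ▸ hM⟩

theorem isParameterIdeal_span (hH : c3 ∈ H) (hQ : HasQuotients H) {f g : Inv H} {m n N M : ℕ}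
    (hm : 0 < m) (hn : 0 < n) (hf : (f : P).IsHomogeneous m) (hg : (g : P).IsHomogeneous n)
    (hN : u ^ N ∈ Ideal.span {f, g}) (hM : v ^ M ∈ Ideal.span {f, g}) :
    IsParameterIdeal (Ideal.span {f, g}) := by
  refine ⟨2, ![f, g], ringKrullDim_inv, ?_, ?_, finite_quotient hH hQ hN hM⟩
  · rw [Fin.forall_fin_two]
    exact ⟨⟨m, hm, hf⟩, ⟨n, hn, hg⟩⟩
  · rw [Matrix.range_cons, Matrix.range_cons, Matrix.range_empty, Set.union_empty]
    rfl

theorem closed_span {f g : Inv H} (hf : invS f ∈ Ideal.span {f, g})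
    (hg : invS g ∈ Ideal.span {f, g}) : ∀ h ∈ Ideal.span {f, g}, invS h ∈ Ideal.span {f, g} := by
  intro h hh
  obtain ⟨a, b, rfl⟩ := Ideal.mem_span_pair.mp hh
  rw [map_add, map_mul, map_mul]
  exact Ideal.add_mem _ (Ideal.mul_mem_left _ _ hf) (Ideal.mul_mem_left _ _ hg)

theorem mem_of_one_add_pow_mul_mem {I : Ideal (Inv H)} {N M : ℕ} (hN : u ^ N ∈ I)
    (hM : v ^ M ∈ I) (k : ℕ) {h : Inv H} (hh : (1 + u + v) ^ k * h ∈ I) : h ∈ I := by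
  induction k with
  | zero => simpa using hh
  | succ k ih => exact ih (mem_of_one_add_mul_mem hN hM (by rwa [← mul_assoc, ← pow_succ']))

/-- By induction on `n`: the ideal contains `vⁱ` times the ideal with parameters `2e`, `m + 1`,
`n - 1`. -/
theorem exists_v_pow_mem (i m n : ℕ) :
    ∃ M, (v : Inv H) ^ M ∈ Ideal.span {(genP i m n : Inv H), genQ m n} := by
  induction n generalizing i m with
  | zero => exact ⟨i, Ideal.mem_span_pair.mpr ⟨1, 0, by simp [genP, x_zero]⟩⟩
  | succ n ih =>
    obtain ⟨M, hM⟩ := ih (2 ^ (m + 1)) (m + 1)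
    obtain ⟨a, b, hab⟩ := Ideal.mem_span_pair.mp hM
    refine ⟨i + M, Ideal.mem_span_pair.mpr ⟨-a * u ^ 2 ^ m + b, v ^ i * a, ?_⟩⟩
    have h1 : (genP i m (n + 1) : Inv H) = v ^ i * genQ (m + 1) n := by
      rw [← genP_zero, genP, genP, pow_zero, one_mul]
    rw [pow_add, ← hab, genQ_succ, h1, genP_zero]
    ring

theorem exists_pow_mem_genP_genQ (hH : c3 ∈ H) (i m n : ℕ) :
    ∃ N M, (u : Inv H) ^ N ∈ Ideal.span {(genP i m n : Inv H), genQ m n} ∧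
      (v : Inv H) ^ M ∈ Ideal.span {(genP i m n : Inv H), genQ m n} := by
  obtain ⟨M, hM⟩ := exists_v_pow_mem (H := H) i m n
  obtain ⟨N, hN⟩ := exists_u_pow_mem hH hM (g := genQ m n) (Ideal.subset_span (by simp))
    (res_genQ m n)
  exact ⟨N, M, hN, hM⟩

theorem closed_genP_genQ (hH : c3 ∈ H) {i m : ℕ} (n : ℕ) (him : i ≤ 2 ^ m) :
    ∀ h ∈ Ideal.span {(genP i m n : Inv H), genQ m n},
      invS h ∈ Ideal.span {(genP i m n : Inv H), genQ m n} := by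
  obtain ⟨N, M, hN, hM⟩ := exists_pow_mem_genP_genQ hH i m n
  apply closed_span
  · apply mem_of_one_add_pow_mul_mem hN hM (2 * 2 ^ m)
    rw [one_add_pow_mul_invS_genP]
    exact Ideal.mem_span_pair.mpr ⟨_, _, rfl⟩
  · apply mem_of_one_add_pow_mul_mem hN hM (2 ^ m)
    obtain ⟨j, hj⟩ := Nat.exists_eq_add_of_le him
    have h : (v : Inv H) ^ 2 ^ m * x n ^ (2 * 2 ^ m) = v ^ j * genP i m n := by
      rw [genP, ← mul_assoc, ← pow_add, hj, add_comm]
    rw [one_add_pow_mul_invS_genQ, h]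
    exact Ideal.mem_span_pair.mpr ⟨(1 + v ^ j * genP i m n) * v ^ j,
      1 + u ^ 2 ^ m * genQ m n + v ^ 2 ^ m * genQ m n, by ring⟩

theorem closed_fibered {k t : ℕ} (o : ℕ) (hkt : k ≤ 2 ^ t) :
    ∀ h ∈ Ideal.span {(v : Inv H) ^ k, u ^ (2 ^ t * o)},
      invS h ∈ Ideal.span {(v : Inv H) ^ k, u ^ (2 ^ t * o)} := by
  apply closed_span
  · rw [invS_v_pow]
    exact Ideal.mul_mem_left _ _ (Ideal.subset_span (by simp))
  · obtain ⟨j, hj⟩ := Nat.exists_eq_add_of_le hkt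
    have h1 : invS ((u : Inv H) ^ (2 ^ t * o))
        = (u ^ 2 ^ t * (1 + u ^ 2 ^ t) + v ^ j * v ^ k) ^ o := by
      rw [map_pow, invS_u, pow_mul, add_pow_char_pow, add_pow_char_pow, ← pow_add, add_comm j, ← hj]
      ring
    obtain ⟨y, hy⟩ := sub_dvd_pow_sub_pow (u ^ 2 ^ t * (1 + u ^ 2 ^ t) + v ^ j * v ^ k : Inv H)
      (u ^ 2 ^ t * (1 + u ^ 2 ^ t)) o
    refine Ideal.mem_span_pair.mpr ⟨v ^ j * y, (1 + u ^ 2 ^ t) ^ o, ?_⟩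
    rw [h1, pow_mul]
    rw [mul_pow] at hy
    linear_combination -hy

/-- The Steenrod closed parameter ideals of the invariants of `C₃` and of `GL₂(𝔽₂)`. -/
theorem mem_steenrodClosedParameterIdeals_iff (hH : c3 ∈ H) (hQ : HasQuotients H)
    {J : Ideal (Inv H)} : J ∈ steenrodClosedParameterIdeals H ↔ IsListed J := by
  constructor
  · rintro ⟨hpar, hcl⟩
    obtain ⟨f, g, m, n, N, M, hm, hn, hf, hg, rfl, hN, hM⟩ := exists_generators hpar
    exact isListed_of_closed hH hQ M f g m n hm hn hf hg hN hM hcl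
  · rintro (⟨k, t, o, ho, hk, hkt, rfl⟩ | ⟨i, m, n, hi, him, rfl⟩)
    · refine ⟨isParameterIdeal_span hH hQ (by omega) ?_ (v_isHomogeneous.pow k)
        (u_pow_properties _).1 (u_pow_mem_span_fibered _ _) (v_pow_mem_span_fibered _ _),
        closed_fibered o hkt⟩
      have := ho.pos
      positivity
    · obtain ⟨N, M, hN, hM⟩ := exists_pow_mem_genP_genQ hH i m n
      refine ⟨isParameterIdeal_span hH hQ (by omega) ?_ (genP_isHomogeneous i m n)
        (genQ_isHomogeneous m n) hN hM, closed_genP_genQ hH n him⟩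
      have := two_mul_le_xdeg_mul m n
      have := Nat.one_le_two_pow (n := m)
      omega

/-! ### The three families -/

theorem mem_fiberedIdeals_iff {J : Ideal HA4} : J ∈ fiberedIdeals ↔
    ∃ k t o : ℕ, Odd o ∧ 0 < k ∧ k ≤ 2 ^ t ∧ J = Ideal.span {v ^ k, u ^ (2 ^ t * o)} := by
  have hval : ∀ t o : ℕ, Odd o → padicValNat 2 (2 ^ t * o) = t := fun t o ho => by
    rw [padicValNat.mul (by positivity) ho.pos.ne', padicValNat.prime_pow,
      padicValNat.eq_zero_of_not_dvd ho.not_two_dvd_nat, add_zero]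
  constructor
  · rintro ⟨k, l, hl, hk, hkl, rfl⟩
    obtain ⟨t, o, ho, rfl⟩ := Nat.exists_eq_two_pow_mul_odd (show l ≠ 0 by omega)
    rw [hval t o ho] at hkl
    exact ⟨k, t, o, ho, hk, hkl, rfl⟩
  · rintro ⟨k, t, o, ho, hk, hkt, rfl⟩
    have := ho.pos
    exact ⟨k, 2 ^ t * o, Nat.mul_pos (by positivity) this, hk, by rwa [hval t o ho], rfl⟩

theorem mem_twistedIdeals_iff {J : Ideal HA4} : J ∈ twistedIdeals ↔
    ∃ n : ℕ, J = Ideal.span {genP 1 0 (n + 1), genQ 0 (n + 1)} := by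
  have h : ∀ n : ℕ, Ideal.span {(x (n + 2) : HA4), invSq 1 (x (n + 2))}
      = Ideal.span {genP 1 0 (n + 1), genQ 0 (n + 1)} := fun n => by
    rw [Set.pair_comm, invSq_one_x, genP, genQ]
    simp
  constructor
  · rintro ⟨n, hn, rfl⟩
    obtain ⟨n, rfl⟩ := Nat.exists_eq_add_of_le' hn
    exact ⟨n, h n⟩
  · rintro ⟨n, rfl⟩
    exact ⟨n + 2, by omega, (h n).symm⟩

/-- The ideal with `i = e > 1` is also the ideal with `i = 0` of the next series. -/
theorem span_genP_zero (m n : ℕ) : Ideal.span {(genP 0 m (n + 1) : Inv H), genQ m (n + 1)}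
    = Ideal.span {genP (2 ^ (m + 1)) (m + 1) n, genQ (m + 1) n} := by
  rw [genQ_succ, ← genP_zero, Ideal.span_pair_add_mul_left, Ideal.span_pair_comm]

theorem mem_mixedIdeals_iff {J : Ideal HA4} : J ∈ mixedIdeals ↔
    ∃ i m n : ℕ, 0 < i ∧ i ≤ 2 ^ (m + 1) ∧
      J = Ideal.span {genP i (m + 1) (n + 1), genQ (m + 1) (n + 1)} := by
  have h : ∀ i m n : ℕ, Ideal.span {(v : HA4) ^ i * x n ^ 2 ^ (m + 1), x (n + 1) ^ 2 ^ (m + 1 - 1)}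
      = Ideal.span {genP i m n, genQ m n} := fun i m n => by
    rw [genP, genQ, pow_succ', Nat.add_sub_cancel]
  constructor
  · rintro ⟨i, m, n, hm, hin, rfl⟩
    obtain ⟨m, rfl⟩ := Nat.exists_eq_add_of_le' hm
    rw [h]
    rw [Nat.add_sub_cancel] at hin
    rcases Nat.eq_zero_or_pos i with rfl | hi
    · obtain ⟨n, rfl⟩ := Nat.exists_eq_add_of_le' (show 2 ≤ n by omega)
      exact ⟨2 ^ (m + 1), m, n, by positivity, le_rfl, span_genP_zero m (n + 1)⟩
    · obtain ⟨n, rfl⟩ := Nat.exists_eq_add_of_le' (show 1 ≤ n by omega)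
      rcases m with _ | m
      · omega
      · exact ⟨i, m, n, hi, by omega, rfl⟩
  · rintro ⟨i, m, n, hi, him, rfl⟩
    rcases eq_or_lt_of_le him with rfl | hlt
    · exact ⟨0, m + 1, n + 2, by omega, Or.inr ⟨by omega, by positivity⟩,
        by rw [h, span_genP_zero]⟩
    · refine ⟨i, m + 2, n + 1, by omega, ?_, (h _ _ _).symm⟩
      rw [show m + 2 - 1 = m + 1 by omega]
      omega

theorem isListed_iff {J : Ideal HA4} :
    IsListed J ↔ J ∈ fiberedIdeals ∪ twistedIdeals ∪ mixedIdeals := by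
  rw [Set.mem_union, Set.mem_union, mem_fiberedIdeals_iff, mem_twistedIdeals_iff,
    mem_mixedIdeals_iff]
  constructor
  · rintro (h | ⟨i, m, n, hi, him, rfl⟩)
    · exact Or.inl (Or.inl h)
    · rcases n with _ | n
      · refine Or.inl (Or.inl ⟨i, m, 1, odd_one, hi, him, ?_⟩)
        rw [genP, genQ, x_zero, one_pow, mul_one, mul_one]
        rfl
      · rcases m with _ | m
        · obtain rfl : i = 1 := by rw [pow_zero] at him; omega
          exact Or.inl (Or.inr ⟨n, rfl⟩)
        · exact Or.inr ⟨i, m, n, hi, him, rfl⟩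
  · rintro ((h | ⟨n, rfl⟩) | ⟨i, m, n, hi, him, rfl⟩)
    · exact Or.inl h
    · exact Or.inr ⟨1, 0, n + 1, one_pos, by simp, rfl⟩
    · exact Or.inr ⟨i, m + 1, n + 1, hi, him, rfl⟩

theorem le_of_mem_span {p q h : Inv H} {L k : ℕ} (rp : res p = 0)
    (rq : res q = Polynomial.X ^ L) (rh : res h = Polynomial.X ^ k)
    (hh : h ∈ Ideal.span {p, q}) : L ≤ k := by
  obtain ⟨a, b, hab⟩ := Ideal.mem_span_pair.mp hh
  apply X_pow_dvd_X_pow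
  rw [← rh, ← hab, map_add, map_mul, map_mul, rp, rq, mul_zero, zero_add]
  exact dvd_mul_left _ _

/-- The restriction of an ideal `(p, q)` to the line determines the degree of `q`. -/
theorem eq_of_span_eq {p q p' q' : Inv H} {L L' : ℕ} (rp : res p = 0)
    (rq : res q = Polynomial.X ^ L) (rp' : res p' = 0) (rq' : res q' = Polynomial.X ^ L')
    (h : Ideal.span {p, q} = Ideal.span {p', q'}) : L = L' :=
  le_antisymm (le_of_mem_span rp rq rq' (h ▸ Ideal.subset_span (by simp)))
    (le_of_mem_span rp' rq' rq (h ▸ Ideal.subset_span (by simp)))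

theorem mem_of_v_pow_mul_mem (hH : c3 ∈ H) {f g h : Inv H} {L : ℕ}
    (rg : res g = Polynomial.X ^ L) (k : ℕ) (hh : v ^ k * h ∈ Ideal.span {v ^ k * f, g}) :
    h ∈ Ideal.span {f, g} := by
  induction k with
  | zero => simpa using hh
  | succ k ih =>
    rw [pow_succ', mul_assoc, mul_assoc] at hh
    exact ih (mem_of_v_mul_mem hH rg hh)

/-- A fibered ideal `(v^k, u^l)` is different from every ideal `(vⁱ xₙ^(2e), xₙ₊₁^e)` with `n ≥ 1`.
Otherwise `xₙ₊₁^e` has the degree `2l` of `u^l`. If `i < k`, division by `vⁱ` shows that `xₙ^(2e)`,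
which has smaller degree, lies in `(v^(k-i), u^l)`; if `k ≤ i`, division by `v^k` shows that
`(v^(i-k) xₙ^(2e), xₙ₊₁^e)` is the unit ideal. -/
theorem span_fibered_ne (hH : c3 ∈ H) {k l i m n : ℕ} (hk : 0 < k) (hi : 0 < i) :
    Ideal.span {(v : Inv H) ^ k, u ^ l} ≠ Ideal.span {genP i m (n + 1), genQ m (n + 1)} := by
  intro h
  have hl := (u_pow_properties (H := H) l).2
  have hx : res (x (n + 1) ^ (2 * 2 ^ m) : Inv H)
      = Polynomial.X ^ (xdeg (n + 1) * (2 * 2 ^ m)) := by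
    rw [map_pow, res_x, ← pow_mul]
  have hL := eq_of_span_eq (by rw [map_pow, res_v, zero_pow hk.ne']) hl (res_genP hi)
    (res_genQ m (n + 1)) h
  rcases lt_or_ge i k with hik | hik
  · obtain ⟨j, rfl⟩ := Nat.exists_eq_add_of_le hik.le
    have h1 : (genP i m (n + 1) : Inv H) ∈ Ideal.span {(v : Inv H) ^ (i + j), u ^ l} :=
      h ▸ Ideal.subset_span (by simp)
    rw [genP, pow_add] at h1
    have h2 := le_of_mem_span (by rw [map_pow, res_v, zero_pow (by omega)]) hl hx
      (mem_of_v_pow_mul_mem hH hl i h1)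
    rw [hL, xdeg_succ (n + 1)] at h2
    have := Nat.one_le_two_pow (n := m)
    nlinarith
  · obtain ⟨j, rfl⟩ := Nat.exists_eq_add_of_le hik
    have h1 : (v : Inv H) ^ k ∈ Ideal.span {(genP (k + j) m (n + 1) : Inv H), genQ m (n + 1)} :=
      h ▸ Ideal.subset_span (by simp)
    rw [genP, pow_add, mul_assoc] at h1
    refine one_notMem_span ?_ ?_ (genP_isHomogeneous j m (n + 1)) (genQ_isHomogeneous m (n + 1))
      (mem_of_v_pow_mul_mem hH (res_genQ m (n + 1)) k (by rw [mul_one]; exact h1))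
    all_goals
      have := two_mul_le_xdeg_mul m n
      have := two_mul_le_xdeg_mul m (n + 1)
      have := Nat.one_le_two_pow (n := m)
      nlinarith

theorem disjoint_fibered_twisted : Disjoint fiberedIdeals twistedIdeals := by
  rw [Set.disjoint_left]
  intro J h1 h2
  obtain ⟨k, t, o, -, hk, -, rfl⟩ := mem_fiberedIdeals_iff.mp h1
  obtain ⟨n, h⟩ := mem_twistedIdeals_iff.mp h2
  exact span_fibered_ne (Subgroup.mem_zpowers c3) hk one_pos h

theorem disjoint_fibered_mixed : Disjoint fiberedIdeals mixedIdeals := by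
  rw [Set.disjoint_left]
  intro J h1 h2
  obtain ⟨k, t, o, -, hk, -, rfl⟩ := mem_fiberedIdeals_iff.mp h1
  obtain ⟨i, m, n, hi, -, h⟩ := mem_mixedIdeals_iff.mp h2
  exact span_fibered_ne (Subgroup.mem_zpowers c3) hk hi h

/-- The degrees of the second generators differ modulo `4`. -/
theorem disjoint_twisted_mixed : Disjoint twistedIdeals mixedIdeals := by
  rw [Set.disjoint_left]
  intro J h1 h2
  obtain ⟨n, rfl⟩ := mem_twistedIdeals_iff.mp h1
  obtain ⟨i, m, n', hi, -, h⟩ := mem_mixedIdeals_iff.mp h2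
  have hL := eq_of_span_eq (res_genP one_pos) (res_genQ 0 (n + 1)) (res_genP hi)
    (res_genQ (m + 1) (n' + 1)) h
  rw [xdeg_succ (n + 1), xdeg_succ n, xdeg_succ (n' + 1), pow_zero, pow_succ] at hL
  have : (2 + 2 * xdeg (n' + 1)) * (2 ^ m * 2) = 4 * ((1 + xdeg (n' + 1)) * 2 ^ m) := by ring
  omega

/-! ### Restriction to the Dickson algebra -/

/-- The inclusion of the Dickson algebra. -/
abbrev incl : D2 →ₐ[ZMod 2] HA4 := Subalgebra.inclusion D2_le_HA4

theorem incl_x (n : ℕ) : incl (x n) = x n := by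
  induction n using Nat.twoStepInduction with
  | zero => exact map_one incl
  | one => rfl
  | more n h0 h1 =>
    rw [x_add_two, x_add_two, map_add, map_mul, map_mul, map_pow, map_pow, map_pow, h0, h1]
    rfl

theorem incl_genP (i m n : ℕ) : incl (genP i m n) = genP i m n := by
  rw [genP, genP, map_mul, map_pow, map_pow, incl_x]
  rfl

theorem incl_genQ (m n : ℕ) : incl (genQ m n) = genQ m n := by
  rw [genQ, genQ, map_pow, incl_x]

/-- `H^*(BA₄)` is generated by `1` and `w` as a module over the Dickson algebra. -/
theorem exists_eq_incl_add (f : HA4) : ∃ d e : D2, f = incl d + incl e * w := by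
  have hf := mem_HA4_iff.mp f.2
  have ht : tau (f : P) ∈ HA4 := by
    rw [mem_HA4_iff, sigma_tau, hf, hf]
  have hr : res (f + ⟨tau (f : P), ht⟩ : HA4) = 0 := by
    rw [map_add, res_apply, res_apply, resP_tau f.2, CharTwo.add_self_eq_zero]
  obtain ⟨h, hh⟩ := (v_dvd_iff (Subgroup.mem_zpowers c3)).mpr hr
  have hh' : (f : P) + tau f = vP * h := congrArg Subtype.val hh
  have hv : tau vP = vP := (u_v_invariant swapG).2
  have hth : tau (h : P) = h := by
    apply mul_left_cancel₀ vP_ne_zero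
    rw [← hh']
    conv_lhs => rw [← hv, ← map_mul, ← hh', map_add, tau_tau, add_comm]
  have hhD : (h : P) ∈ D2 := mem_D2_iff.mpr ⟨mem_HA4_iff.mp h.2, hth⟩
  -- `h w` and `f` change by the same element `v h` under the transposition.
  have hdD : (f : P) + h * w ∈ D2 := by
    refine mem_D2_iff.mpr ⟨mem_HA4_iff.mp (f + h * w).2, ?_⟩
    rw [map_add, map_mul, hth, tau_w]
    linear_combination hh' + (vP * (h : P) - (f : P)) * two_eq_zero
  refine ⟨⟨_, hdD⟩, ⟨h, hhD⟩, Subtype.ext ?_⟩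
  change (f : P) = (f + h * w) + h * w
  linear_combination -(h : P) * w * two_eq_zero

/-- The elements `1` and `w` are linearly independent over the Dickson algebra. -/
theorem eq_zero_of_incl_eq {d e : D2} (h : incl d = incl e * w) : e = 0 := by
  have h1 : (d : P) = e * w := congrArg Subtype.val h
  have h2 := congrArg tau h1
  rw [map_mul, tau_w, (mem_D2_iff.mp d.2).2, (mem_D2_iff.mp e.2).2] at h2
  have h3 : (e : P) * vP = 0 := by linear_combination h1 - h2
  exact Subtype.ext ((mul_eq_zero.mp h3).resolve_right vP_ne_zero)

/-- An ideal of `H^*(BA₄)` with generators in the Dickson algebra restricts to the ideal with the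
same generators, because `H^*(BA₄)` is free over the Dickson algebra on `1` and `w`. -/
theorem restrict_span (p q : D2) : restrict (Ideal.span {incl p, incl q}) = Ideal.span {p, q} := by
  ext z
  change incl z ∈ Ideal.span {incl p, incl q} ↔ _
  constructor
  · intro hz
    obtain ⟨a, b, hab⟩ := Ideal.mem_span_pair.mp hz
    obtain ⟨a₁, a₂, rfl⟩ := exists_eq_incl_add a
    obtain ⟨b₁, b₂, rfl⟩ := exists_eq_incl_add b
    have h : incl (z - (a₁ * p + b₁ * q)) = incl (a₂ * p + b₂ * q) * w := by
      simp only [map_sub, map_add, map_mul]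
      linear_combination -hab
    have h0 := eq_zero_of_incl_eq h
    rw [h0, map_zero, zero_mul] at h
    have h1 : z - (a₁ * p + b₁ * q) = 0 :=
      Subalgebra.inclusion_injective D2_le_HA4 (by rw [h, map_zero])
    exact Ideal.mem_span_pair.mpr ⟨a₁, b₁, (sub_eq_zero.mp h1).symm⟩
  · intro hz
    obtain ⟨a, b, rfl⟩ := Ideal.mem_span_pair.mp hz
    exact Ideal.mem_span_pair.mpr ⟨incl a, incl b, by simp only [map_add, map_mul]⟩

theorem restrict_fibered (k l : ℕ) :
    restrict (Ideal.span {v ^ k, u ^ l}) = Ideal.span {v ^ k, u ^ l} := by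
  rw [← restrict_span, map_pow, map_pow]
  rfl

theorem restrict_genP_genQ (i m n : ℕ) :
    restrict (Ideal.span {genP i m n, genQ m n}) = Ideal.span {genP i m n, genQ m n} := by
  rw [← restrict_span, incl_genP, incl_genQ]

theorem isListed_restrict {J : Ideal HA4} (hJ : IsListed J) : IsListed (restrict J) := by
  rcases hJ with ⟨k, t, o, ho, hk, hkt, rfl⟩ | ⟨i, m, n, hi, him, rfl⟩
  · exact Or.inl ⟨k, t, o, ho, hk, hkt, restrict_fibered _ _⟩
  · exact Or.inr ⟨i, m, n, hi, him, restrict_genP_genQ _ _ _⟩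

theorem exists_restrict_eq {J : Ideal D2} (hJ : IsListed J) :
    ∃ I : Ideal HA4, IsListed I ∧ restrict I = J := by
  rcases hJ with ⟨k, t, o, ho, hk, hkt, rfl⟩ | ⟨i, m, n, hi, him, rfl⟩
  · exact ⟨_, Or.inl ⟨k, t, o, ho, hk, hkt, rfl⟩, restrict_fibered _ _⟩
  · exact ⟨_, Or.inr ⟨i, m, n, hi, him, rfl⟩, restrict_genP_genQ _ _ _⟩

theorem map_restrict {J : Ideal HA4} (hJ : IsListed J) : (restrict J).map incl = J := by
  rcases hJ with ⟨k, t, o, -, -, -, rfl⟩ | ⟨i, m, n, -, -, rfl⟩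
  · rw [restrict_fibered, Ideal.map_span, Set.image_pair, map_pow, map_pow]
    rfl
  · rw [restrict_genP_genQ, Ideal.map_span, Set.image_pair, incl_genP, incl_genQ]

theorem injOn_restrict : Set.InjOn restrict {J : Ideal HA4 | IsListed J} := fun I hI J hJ h => by
  rw [← map_restrict hI, ← map_restrict hJ, h]

end SteenrodParam

end

open SteenrodParam

theorem mainTheorem3 :
    Set.BijOn restrict
      (steenrodClosedParameterIdeals (Subgroup.zpowers c3)) (steenrodClosedParameterIdeals ⊤) ∧
    steenrodClosedParameterIdeals ⊤ =
      restrict '' fiberedIdeals ∪ restrict '' twistedIdeals ∪ restrict '' mixedIdeals ∧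
    Disjoint (restrict '' fiberedIdeals) (restrict '' twistedIdeals) ∧
    Disjoint (restrict '' fiberedIdeals) (restrict '' mixedIdeals) ∧
    Disjoint (restrict '' twistedIdeals) (restrict '' mixedIdeals) := by
  have hC : steenrodClosedParameterIdeals (Subgroup.zpowers c3) = {J | IsListed J} :=
    Set.ext fun _ => mem_steenrodClosedParameterIdeals_iff (Subgroup.mem_zpowers c3)
      hasQuotients_C3
  have hD : steenrodClosedParameterIdeals ⊤ = {J | IsListed J} :=
    Set.ext fun _ => mem_steenrodClosedParameterIdeals_iff (Subgroup.mem_top c3) hasQuotients_D2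
  have hU : {J : Ideal HA4 | IsListed J} = fiberedIdeals ∪ twistedIdeals ∪ mixedIdeals :=
    Set.ext fun _ => isListed_iff
  have hbij : Set.BijOn restrict
      (steenrodClosedParameterIdeals (Subgroup.zpowers c3)) (steenrodClosedParameterIdeals ⊤) := by
    rw [hC, hD]
    exact ⟨fun J hJ => isListed_restrict hJ, injOn_restrict, fun J hJ => exists_restrict_eq hJ⟩
  have hinj := injOn_restrict
  rw [hU] at hinj
  have hdisj : ∀ {s t : Set (Ideal HA4)}, s ⊆ fiberedIdeals ∪ twistedIdeals ∪ mixedIdeals →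
      t ⊆ fiberedIdeals ∪ twistedIdeals ∪ mixedIdeals → Disjoint s t →
      Disjoint (restrict '' s) (restrict '' t) := by
    intro s t hs ht hst
    rw [Set.disjoint_left] at hst ⊢
    rintro _ ⟨I, hI, rfl⟩ ⟨J, hJ, h⟩
    exact hst hI (hinj (ht hJ) (hs hI) h ▸ hJ)
  have hF : fiberedIdeals ⊆ fiberedIdeals ∪ twistedIdeals ∪ mixedIdeals := fun _ h => .inl (.inl h)
  have hT : twistedIdeals ⊆ fiberedIdeals ∪ twistedIdeals ∪ mixedIdeals := fun _ h => .inl (.inr h)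
  have hM : mixedIdeals ⊆ fiberedIdeals ∪ twistedIdeals ∪ mixedIdeals := fun _ h => .inr h
  refine ⟨hbij, ?_, hdisj hF hT disjoint_fibered_twisted, hdisj hF hM disjoint_fibered_mixed,
    hdisj hT hM disjoint_twisted_mixed⟩
  rw [← hbij.image_eq, hC, hU, Set.image_union, Set.image_union]
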